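/- Let $K\subset S^3$ be a (tame) knot, $X=S^3\setminus K$, $\Gamma=\pi_1(X)$, and let $\epsilon:\Gamma\to\mathbb Z$ be a surjective homomorphism. Let $\Gamma=\langle x_0,\dots,x_n\mid r_0,\dots,r_{n-1}\rangle$ be the Wirtinger presentation of a regular diagram of $K$ (one relator omitted), and give $X$ the cell structure derived from it: one vertex, one edge for each generator, one 2-cell for each relator. Thus the chain complex $C_\cdot$ of the universal covering consists of free $\mathbb C[\Gamma]$-modules, with $\partial e_j=x_j-1$ on edges and $\partial f_i=\sum_j\frac{\partial r_i}{\partial x_j}e_j$ (Fox derivatives) on 2-cells. Let $\rho:\Gamma\to U(V)$ be a finite dimensional unitary representation, $v_1,\dots,v_m$ an orthonormal basis of $V$, and $X_\infty$ the infinite cyclic covering of $X$ belonging to $\ker\epsilon$. Let $$H_i(X_\infty,\rho)=H_i\big(C_\cdot\otimes_{\mathbb C[\ker\epsilon]}V\big),\quad H^i(X_\infty,\rho)=H^i\big(\mathrm{Hom}_{\mathbb C[\ker\epsilon]}(C_\cdot,V)\big),\quad H^i(X,\rho)=H^i\big(\mathrm{Hom}_{\mathbb C[\Gamma]}(C_\cdot,V)\big),$$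 and assume that $H_i(X_\infty,\rho)$ is finite dimensional over $\mathbb C$ for all $i$. Let $\tau^*$ be the action on $H^i(X_\infty,\rho)$ of the generator $t$ of the group $\mathbb Z$ of covering transformations: if $g\in\Gamma$, $\epsilon(g)=1$, it is induced by $f\mapsto\rho(g)^{-1}f(g\,\cdot)$. The Alexander invariant is $$A^*_\rho(t)=\frac{\det[t-\tau^*\mid H^0(X_\infty,\rho)]\cdot\det[t-\tau^*\mid H^2(X_\infty,\rho)]}{\det[t-\tau^*\mid H^1(X_\infty,\rho)]}.$$ Let $\Phi:\mathbb C[F]\to M_m(\mathbb C(t))$, where $F$ is the free group on $x_0,\dots,x_n$, be the ring homomorphism induced by $\gamma\mapsto t^{\epsilon(\gamma)}\rho(\gamma)$. For any $j\in\{0,\dots,n\}$, the twisted Alexander polynomial is $$\Delta_{K,\rho}(t)=\frac{\det\big(\Phi(\partial r_i/\partial x_l)\big)_{0\le i<n,\;l\ne j}}{\det\Phi(x_j-1)}\in\mathbb C(t).$$ When all $H^i(X,\rho)$ vanish, let $\tau^*_{\mathbb C}(X,\rho)$ be the cohomological Milnor–Reidemeister torsion of the acyclic complex $C^\cdot=\mathrm{Hom}_{\mathbb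 C[\Gamma]}(C_\cdot,V)$ with respect to the basis dual to the cells, tensored with $v_1,\dots,v_m$. That is, $\tau^*_{\mathbb C}(X,\rho)=\pm\det(\mathbf y,d\mathbf x)/\det(\mathbf x,d\mathbf y)$, where $\mathbf x$ in $C^0\oplus C^2$ and $\mathbf y$ in $C^1$ are such that $d\mathbf x$ and $d\mathbf y$ are bases of the images of $d$ in $C^1$ and in $C^0\oplus C^2$, respectively. Then all $H^i(X_\infty,\rho)$ are finite dimensional and $\Delta_{K,\rho}\neq0$. If $H^0(X_\infty,\rho)=0$, then $$\mathrm{ord}_{t=1}\Delta_{K,\rho}(t)=-\mathrm{ord}_{t=1}A^*_\rho(t)\ \ge\ \dim H^1(X,\rho),$$ and equality holds if the action of $\tau^*$ on $H^1(X_\infty,\rho)$ is semisimple. Moreover, if $H^i(X,\rho)=0$ for all $i$, then $$|\tau^*_{\mathbb C}(X,\rho)|=\frac1{|\Delta_{K,\rho}(1)|}.$$ -/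

import Mathlib

open scoped TensorProduct

noncomputable section

namespace KnotTorsion

/-! ## Knots, diagrams, Wirtinger relators -/

/-- Euclidean 3-space; its one-point compactification is the 3-sphere. -/
abbrev E3 : Type := EuclideanSpace ℝ (Fin 3)

/-- The standard 3-sphere. -/
abbrev S3 : Type := Metric.sphere (0 : EuclideanSpace ℝ (Fin 4)) 1

/-- A regular oriented diagram of a (tame) knot `K ⊂ S³`: after a homeomorphism `S³ ≃ ℝ³ ∪ {∞}`
the knot is a smooth closed curve in `ℝ³` whose projection to the first two coordinates is an
immersion with finitely many transverse double points and no other multiple points.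
There are `n + 1` crossings (at least one, which can always be arranged by adding a kink), listed
in the order in which they are passed underneath. -/
structure Diagram (K : Set S3) where
  /-- identification of the 3-sphere with `ℝ³ ∪ {∞}` -/
  chart : S3 ≃ₜ OnePoint E3
  /-- the knot as a curve of period `1` -/
  curve : ℝ → E3
  chart_image : chart '' K = (fun p : E3 => (p : OnePoint E3)) '' Set.range curve
  smooth : ContDiff ℝ ((⊤ : ℕ∞) : WithTop ℕ∞) curve
  periodic : Function.Periodic curve 1
  injOn : Set.InjOn curve (Set.Ico 0 1)
  /-- the projection is an immersion -/
  immersion : ∀ s, ¬ (deriv curve s 0 = 0 ∧ deriv curve s 1 = 0)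
  /-- the number of crossings is `n + 1` -/
  n : ℕ
  /-- the parameter at which the `i`-th crossing is passed underneath -/
  under : Fin (n + 1) → ℝ
  /-- the parameter at which the `i`-th crossing is passed above -/
  top : Fin (n + 1) → ℝ
  under_mem : ∀ i, under i ∈ Set.Ico (0 : ℝ) 1
  top_mem : ∀ i, top i ∈ Set.Ico (0 : ℝ) 1
  under_strictMono : StrictMono under
  top_injective : Function.Injective top
  top_ne_under : ∀ i j, top i ≠ under j
  proj_zero : ∀ i, curve (top i) 0 = curve (under i) 0
  proj_one : ∀ i, curve (top i) 1 = curve (under i) 1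
  height : ∀ i, curve (under i) 2 < curve (top i) 2
  /-- there are no other double points -/
  complete : ∀ s ∈ Set.Ico (0 : ℝ) 1, ∀ t ∈ Set.Ico (0 : ℝ) 1, s ≠ t →
    curve s 0 = curve t 0 → curve s 1 = curve t 1 →
    ∃ i, (s = under i ∧ t = top i) ∨ (s = top i ∧ t = under i)
  /-- the double points are transverse -/
  transverse : ∀ i, deriv curve (top i) 0 * deriv curve (under i) 1
    - deriv curve (top i) 1 * deriv curve (under i) 0 ≠ 0

namespace Diagram

variable {K : Set S3} (D : Diagram K)

/-- The sign of the `i`-th crossing: `1` if (direction of the over-strand, direction of the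
under-strand) is a positively oriented basis of the plane, `-1` otherwise. -/
def sign (i : Fin (D.n + 1)) : ℤ :=
  if 0 < deriv D.curve (D.top i) 0 * deriv D.curve (D.under i) 1
    - deriv D.curve (D.top i) 1 * deriv D.curve (D.under i) 0 then 1 else -1

/-- The index of the arc containing the point of parameter `s` (not an under-crossing). The arcs
are the `n + 1` pieces into which the under-crossings cut the knot; arc `i` ends at the `i`-th
under-crossing (and arc `0` passes through the parameter `0`), so that the under-strand of
crossing `i` passes from arc `i` to arc `i + 1`, cyclically. -/
def arc (s : ℝ) : Fin (D.n + 1) :=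
  Fin.ofNat (D.n + 1) (Nat.card {i // D.under i < s})

/-- The Wirtinger relators `x_k^{±1} x_i x_k^{∓1} x_{i+1}^{-1}`, where `x_k` is the over-strand of
crossing `i`, of all crossings but the last; `x_0, …, x_n` correspond to the arcs. (The signs are
those of the standard meridians for the order of multiplication of Mathlib's `FundamentalGroup`,
in which `p * q` is the loop `q` followed by `p`.) -/
def relator (i : Fin D.n) : FreeGroup (Fin (D.n + 1)) :=
  FreeGroup.of (D.arc (D.top i.castSucc)) ^ D.sign i.castSucc *
    FreeGroup.of i.castSucc *
    (FreeGroup.of (D.arc (D.top i.castSucc)) ^ D.sign i.castSucc)⁻¹ *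
    (FreeGroup.of i.succ)⁻¹

end Diagram

/-- `π` exhibits `Γ` as the group with generators `ι` and relators `r`. -/
def IsPresentation {ι κ Γ : Type*} [Group Γ] (π : FreeGroup ι →* Γ) (r : κ → FreeGroup ι) : Prop :=
  Function.Surjective π ∧ π.ker = Subgroup.normalClosure (Set.range r)

/-! ## Fox calculus -/

/-- The Fox derivative `∂w/∂x_j` of a word, determined by `∂(uv) = ∂u + u ∂v`,
`∂x_a/∂x_j = δ_{aj}` and `∂x_a⁻¹/∂x_j = -δ_{aj} x_a⁻¹`. -/
def foxWord {ι : Type*} [DecidableEq ι] (j : ι) :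
    List (ι × Bool) → MonoidAlgebra ℂ (FreeGroup ι)
  | [] => 0
  | (a, true) :: w => (if a = j then 1 else 0)
      + MonoidAlgebra.of ℂ (FreeGroup ι) (FreeGroup.of a) * foxWord j w
  | (a, false) :: w => MonoidAlgebra.of ℂ (FreeGroup ι) (FreeGroup.of a)⁻¹ *
      ((if a = j then -1 else 0) + foxWord j w)

/-- The Fox derivative `∂w/∂x_j ∈ ℂ[F]` of an element of the free group. -/
def fox {ι : Type*} [DecidableEq ι] (j : ι) (w : FreeGroup ι) : MonoidAlgebra ℂ (FreeGroup ι) :=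
  foxWord j w.toWord

/-! ## The cellular chain complex of the universal covering of a presentation complex -/

/-- The cells of the 2-complex of a presentation: one vertex, one edge for each generator and one
2-cell for each relator. -/
inductive Cell (ι κ : Type) : ℕ → Type
  | vertex : Cell ι κ 0
  | edge (j : ι) : Cell ι κ 1
  | face (α : κ) : Cell ι κ 2

/-- There is one vertex. -/
def vertexEquiv (ι κ : Type) : Unit ≃ Cell ι κ 0 where
  toFun _ := .vertex
  invFun _ := ()
  left_inv _ := rfl
  right_inv c := by cases c; rfl

/-- The edges correspond to the generators. -/
def edgeEquiv (ι κ : Type) : ι ≃ Cell ι κ 1 where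
  toFun j := .edge j
  invFun | .edge j => j
  left_inv _ := rfl
  right_inv c := by cases c; rfl

/-- The 2-cells correspond to the relators. -/
def faceEquiv (ι κ : Type) : κ ≃ Cell ι κ 2 where
  toFun α := .face α
  invFun | .face α => α
  left_inv _ := rfl
  right_inv c := by cases c; rfl

instance (ι κ : Type) : Fintype (Cell ι κ 0) := Fintype.ofEquiv _ (vertexEquiv ι κ)

instance (ι κ : Type) : DecidableEq (Cell ι κ 0) := (vertexEquiv ι κ).symm.decidableEq

instance (ι κ : Type) [Fintype ι] : Fintype (Cell ι κ 1) := Fintype.ofEquiv _ (edgeEquiv ι κ)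

instance (ι κ : Type) [DecidableEq ι] : DecidableEq (Cell ι κ 1) :=
  (edgeEquiv ι κ).symm.decidableEq

instance (ι κ : Type) [Fintype κ] : Fintype (Cell ι κ 2) := Fintype.ofEquiv _ (faceEquiv ι κ)

instance (ι κ : Type) [DecidableEq κ] : DecidableEq (Cell ι κ 2) :=
  (faceEquiv ι κ).symm.decidableEq

section Complex

variable {Γ : Type*} [Group Γ] {ι κ : Type}

/-- `C_i` of the universal covering: the free left `ℂ[Γ]`-module on (lifts of) the `i`-cells. -/
abbrev Chain (Γ : Type*) [Group Γ] (ι κ : Type) (i : ℕ) : Type _ :=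
  Cell ι κ i →₀ MonoidAlgebra ℂ Γ

/-- The action of `g ∈ Γ` on the chains of the universal covering. -/
def act (g : Γ) (i : ℕ) : Chain Γ ι κ i →ₗ[ℂ] Chain Γ ι κ i where
  toFun c := MonoidAlgebra.of ℂ Γ g • c
  map_add' := smul_add _
  map_smul' a c := smul_comm (MonoidAlgebra.of ℂ Γ g) a c

lemma act_mul (g h : Γ) (i : ℕ) (c : Chain Γ ι κ i) : act (g * h) i c = act g i (act h i c) := by
  change MonoidAlgebra.of ℂ Γ (g * h) • c = MonoidAlgebra.of ℂ Γ g • MonoidAlgebra.of ℂ Γ h • c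
  rw [map_mul, mul_smul]

variable [Fintype ι] [DecidableEq ι]

/-- The boundaries of the cells: `∂ e_j = x_j - 1` for an edge and
`∂ f_α = ∑_j (∂r_α/∂x_j) e_j` for a 2-cell. -/
def cellBoundary (π : FreeGroup ι →* Γ) (r : κ → FreeGroup ι) :
    (i : ℕ) → Cell ι κ (i + 1) → Chain Γ ι κ i
  | 0, .edge j => Finsupp.single .vertex (MonoidAlgebra.of ℂ Γ (π (FreeGroup.of j)) - 1)
  | 1, .face α => ∑ j : ι, Finsupp.single (.edge j) (MonoidAlgebra.mapDomain π (fox j (r α)))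

/-- The boundary map `C_{i+1} → C_i`, linear over `ℂ[Γ]`. -/
def boundary (π : FreeGroup ι →* Γ) (r : κ → FreeGroup ι) (i : ℕ) :
    Chain Γ ι κ (i + 1) →ₗ[MonoidAlgebra ℂ Γ] Chain Γ ι κ i :=
  Finsupp.linearCombination (MonoidAlgebra ℂ Γ) (cellBoundary π r i)

variable {V : Type*} [AddCommGroup V] [Module ℂ V]

/-! ### Twisted homology of the covering with group `H` -/

/-- `C_i ⊗_ℂ V`. -/
def TensorChain (Γ : Type*) [Group Γ] (ι κ : Type) (V : Type*) [AddCommGroup V] [Module ℂ V]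
    (i : ℕ) : Type _ := Chain Γ ι κ i ⊗[ℂ] V

instance (i : ℕ) : AddCommGroup (TensorChain Γ ι κ V i) :=
  inferInstanceAs (AddCommGroup (Chain Γ ι κ i ⊗[ℂ] V))

instance (i : ℕ) : Module ℂ (TensorChain Γ ι κ V i) :=
  inferInstanceAs (Module ℂ (Chain Γ ι κ i ⊗[ℂ] V))

/-- The tensor `c ⊗ v`. -/
def tmul {i : ℕ} (c : Chain Γ ι κ i) (v : V) : TensorChain Γ ι κ V i := c ⊗ₜ[ℂ] v

/-- The relations `hc ⊗ hv = c ⊗ v`, `h ∈ H`, defining `C_i ⊗_{ℂ[H]} V` as a quotient of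
`C_i ⊗_ℂ V`. -/
def coinvRel (ι κ : Type) (ρ : Representation ℂ Γ V) (H : Subgroup Γ) (i : ℕ) :
    Submodule ℂ (TensorChain Γ ι κ V i) :=
  Submodule.span ℂ
    {z | ∃ h ∈ H, ∃ (c : Chain Γ ι κ i) (v : V), z = tmul (act h i c) (ρ h v) - tmul c v}

/-- `C_i(X_H, ρ) = C_i ⊗_{ℂ[H]} V`, the twisted chains of the covering with group `H`. -/
abbrev TwChain (ι κ : Type) (ρ : Representation ℂ Γ V) (H : Subgroup Γ) (i : ℕ) : Type _ :=
  TensorChain Γ ι κ V i ⧸ coinvRel ι κ ρ H i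

lemma boundary_act (π : FreeGroup ι →* Γ) (r : κ → FreeGroup ι) (g : Γ) (i : ℕ)
    (c : Chain Γ ι κ (i + 1)) : boundary π r i (act g (i + 1) c) = act g i (boundary π r i c) :=
  (boundary π r i).map_smul _ _

/-- The boundary map as a `ℂ`-linear map. -/
def boundaryC (π : FreeGroup ι →* Γ) (r : κ → FreeGroup ι) (i : ℕ) :
    Chain Γ ι κ (i + 1) →ₗ[ℂ] Chain Γ ι κ i :=
  (boundary π r i).restrictScalars ℂ

/-- The map `∂ ⊗ 1 : C_{i+1} ⊗_ℂ V → C_i ⊗_ℂ V`. -/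
def tensorBoundary (π : FreeGroup ι →* Γ) (r : κ → FreeGroup ι) (V : Type*) [AddCommGroup V]
    [Module ℂ V] (i : ℕ) : TensorChain Γ ι κ V (i + 1) →ₗ[ℂ] TensorChain Γ ι κ V i :=
  LinearMap.rTensor V (boundaryC π r i)

/-- The boundary map `∂ ⊗ 1 : C_{i+1}(X_H, ρ) → C_i(X_H, ρ)`. -/
def twBoundary (π : FreeGroup ι →* Γ) (r : κ → FreeGroup ι) (ρ : Representation ℂ Γ V)
    (H : Subgroup Γ) (i : ℕ) : TwChain ι κ ρ H (i + 1) →ₗ[ℂ] TwChain ι κ ρ H i :=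
  Submodule.mapQ _ _ (tensorBoundary π r V i) <| by
    rw [coinvRel, Submodule.span_le]
    rintro _ ⟨h, hh, c, v, rfl⟩
    refine Submodule.subset_span ⟨h, hh, boundaryC π r i c, v, ?_⟩
    have h1 : ∀ (c : Chain Γ ι κ (i + 1)) (v : V),
      tensorBoundary π r V i (tmul c v) = tmul (boundaryC π r i c) v := fun _ _ => rfl
    rw [map_sub, h1, h1]
    simp [boundaryC, boundary_act]

/-- The cycles in `C_i(X_H, ρ)`. -/
def cycles (π : FreeGroup ι →* Γ) (r : κ → FreeGroup ι) (ρ : Representation ℂ Γ V)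
    (H : Subgroup Γ) : (i : ℕ) → Submodule ℂ (TwChain ι κ ρ H i)
  | 0 => ⊤
  | i + 1 => LinearMap.ker (twBoundary π r ρ H i)

/-- `H_i(X_H, ρ)`. -/
abbrev Homology (π : FreeGroup ι →* Γ) (r : κ → FreeGroup ι) (ρ : Representation ℂ Γ V)
    (H : Subgroup Γ) (i : ℕ) : Type _ :=
  cycles π r ρ H i ⧸ (LinearMap.range (twBoundary π r ρ H i)).submoduleOf (cycles π r ρ H i)

/-! ### Twisted cohomology of the covering with group `H` -/

/-- The `ℂ[H]`-linear maps `C_i → V`. -/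
def equivariantMaps (ι κ : Type) (ρ : Representation ℂ Γ V) (H : Subgroup Γ) (i : ℕ) :
    Submodule ℂ (Chain Γ ι κ i →ₗ[ℂ] V) where
  carrier := {f | ∀ h ∈ H, ∀ c, f (act h i c) = ρ h (f c)}
  add_mem' hf hg h hh c := by simp [hf h hh c, hg h hh c]
  zero_mem' h _ c := by simp
  smul_mem' a f hf h hh c := by simp [hf h hh c]

/-- `C^i(X_H, ρ) = Hom_{ℂ[H]}(C_i, V)`, the twisted cochains of the covering with group `H`. -/
def Cochain (ι κ : Type) (ρ : Representation ℂ Γ V) (H : Subgroup Γ) (i : ℕ) : Type _ :=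
  equivariantMaps ι κ ρ H i

instance (ρ : Representation ℂ Γ V) (H : Subgroup Γ) (i : ℕ) : AddCommGroup (Cochain ι κ ρ H i) :=
  inferInstanceAs (AddCommGroup (equivariantMaps ι κ ρ H i))

instance (ρ : Representation ℂ Γ V) (H : Subgroup Γ) (i : ℕ) : Module ℂ (Cochain ι κ ρ H i) :=
  inferInstanceAs (Module ℂ (equivariantMaps ι κ ρ H i))

/-- The coboundary `C^i(X_H, ρ) → C^{i+1}(X_H, ρ)`, `f ↦ f ∘ ∂`. -/
def coboundary (π : FreeGroup ι →* Γ) (r : κ → FreeGroup ι) (ρ : Representation ℂ Γ V)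
    (H : Subgroup Γ) (i : ℕ) : Cochain ι κ ρ H i →ₗ[ℂ] Cochain ι κ ρ H (i + 1) where
  toFun f := ⟨f.1 ∘ₗ boundaryC π r i, fun h hh c => by
    simp [boundaryC, boundary_act, f.2 h hh]⟩
  map_add' _ _ := rfl
  map_smul' _ _ := rfl

/-- The cocycles in `C^i(X_H, ρ)`. -/
def cocycles (π : FreeGroup ι →* Γ) (r : κ → FreeGroup ι) (ρ : Representation ℂ Γ V)
    (H : Subgroup Γ) (i : ℕ) : Submodule ℂ (Cochain ι κ ρ H i) :=
  LinearMap.ker (coboundary π r ρ H i)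

/-- The coboundaries in `C^i(X_H, ρ)`. -/
def coboundaries (π : FreeGroup ι →* Γ) (r : κ → FreeGroup ι) (ρ : Representation ℂ Γ V)
    (H : Subgroup Γ) : (i : ℕ) → Submodule ℂ (Cochain ι κ ρ H i)
  | 0 => ⊥
  | i + 1 => LinearMap.range (coboundary π r ρ H i)

/-- `H^i(X_H, ρ)`. -/
abbrev Cohomology (π : FreeGroup ι →* Γ) (r : κ → FreeGroup ι) (ρ : Representation ℂ Γ V)
    (H : Subgroup Γ) (i : ℕ) : Type _ :=
  cocycles π r ρ H i ⧸ (coboundaries π r ρ H i).submoduleOf (cocycles π r ρ H i)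

/-! ### The action of the covering transformations on the cohomology -/

/-- The action of the covering transformation of `X_H` (`H` normal) given by `g ∈ Γ` on
`C^i(X_H, ρ)` by pull-back: `(g^* f)(c) = ρ(g)⁻¹ f(g c)`. It depends only on the class of `g`
modulo `H`. -/
def deckCochain (ρ : Representation ℂ Γ V) (H : Subgroup Γ) [H.Normal] (g : Γ) (i : ℕ) :
    Cochain ι κ ρ H i →ₗ[ℂ] Cochain ι κ ρ H i where
  toFun f := ⟨ρ g⁻¹ ∘ₗ f.1 ∘ₗ act g i, fun h hh c => by
    change ρ g⁻¹ (f.1 (act g i (act h i c))) = ρ h (ρ g⁻¹ (f.1 (act g i c)))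
    have h1 : act g i (act h i c) = act (g * h * g⁻¹) i (act g i c) := by
      rw [← act_mul, ← act_mul]; simp
    rw [h1, f.2 _ (Subgroup.Normal.conj_mem inferInstance h hh g), ← Module.End.mul_apply,
      ← Module.End.mul_apply, ← map_mul, ← map_mul]
    simp [mul_assoc]⟩
  map_add' f f' := Subtype.ext <| LinearMap.ext fun c =>
    map_add (ρ g⁻¹) (f.1 (act g i c)) (f'.1 (act g i c))
  map_smul' a f := Subtype.ext <| LinearMap.ext fun c => map_smul (ρ g⁻¹) a (f.1 (act g i c))

lemma coboundary_deck (π : FreeGroup ι →* Γ) (r : κ → FreeGroup ι) (ρ : Representation ℂ Γ V)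
    (H : Subgroup Γ) [H.Normal] (g : Γ) (i : ℕ) (f : Cochain ι κ ρ H i) :
    coboundary π r ρ H i (deckCochain ρ H g i f) =
      deckCochain ρ H g (i + 1) (coboundary π r ρ H i f) := by
  refine Subtype.ext (LinearMap.ext fun c => ?_)
  change ρ g⁻¹ (f.1 (act g i (boundary π r i c))) = ρ g⁻¹ (f.1 (boundary π r i (act g (i + 1) c)))
  rw [boundary_act]

lemma deck_cocycles (π : FreeGroup ι →* Γ) (r : κ → FreeGroup ι) (ρ : Representation ℂ Γ V)
    (H : Subgroup Γ) [H.Normal] (g : Γ) (i : ℕ) :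
    ∀ f ∈ cocycles π r ρ H i, deckCochain ρ H g i f ∈ cocycles π r ρ H i := by
  intro f hf
  have hf' : coboundary π r ρ H i f = 0 := hf
  change coboundary π r ρ H i (deckCochain ρ H g i f) = 0
  rw [coboundary_deck, hf', map_zero]

/-- The action of the covering transformation given by `g ∈ Γ` on `H^i(X_H, ρ)`. -/
def deck (π : FreeGroup ι →* Γ) (r : κ → FreeGroup ι) (ρ : Representation ℂ Γ V)
    (H : Subgroup Γ) [H.Normal] (g : Γ) (i : ℕ) :
    Module.End ℂ (Cohomology π r ρ H i) :=
  Submodule.mapQ _ _ ((deckCochain ρ H g i).restrict (deck_cocycles π r ρ H g i)) <| by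
    rintro ⟨f, hf⟩ hfb
    cases i with
    | zero =>
      have h0 : f = 0 := hfb
      subst h0
      change deckCochain ρ H g 0 0 = 0
      exact map_zero _
    | succ i =>
      obtain ⟨b, rfl⟩ : ∃ b, coboundary π r ρ H i b = f := hfb
      exact ⟨deckCochain ρ H g i b, coboundary_deck π r ρ H g i b⟩

end Complex

/-! ## Characteristic polynomials and the Alexander invariant -/

open Classical in
/-- The characteristic polynomial `det[t - T]` of an endomorphism of a finite dimensional
complex vector space (`1` by convention on an infinite dimensional one). -/
def detPoly {M : Type*} [AddCommGroup M] [Module ℂ M] (T : Module.End ℂ M) : Polynomial ℂ :=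
  if h : Module.Finite ℂ M then
    haveI := h
    LinearMap.charpoly T
  else 1

section Invariants

variable {Γ : Type*} [Group Γ] {ι κ : Type} [Fintype ι] [DecidableEq ι]
variable {V : Type*} [NormedAddCommGroup V] [InnerProductSpace ℂ V]

/-- The Alexander invariant
`A_ρ^*(t) = det[t - τ^* | H⁰] det[t - τ^* | H²] / det[t - τ^* | H¹]`, `H^i = H^i(X_∞, ρ)`, where
`X_∞` is the infinite cyclic covering belonging to the kernel of `ε`, and `τ^*` is the action of
the covering transformation given by `g`. -/
def alexanderInvariant (π : FreeGroup ι →* Γ) (r : κ → FreeGroup ι) (ρ : Representation ℂ Γ V)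
    (ε : Γ →* Multiplicative ℤ) (g : Γ) : RatFunc ℂ :=
  algebraMap (Polynomial ℂ) (RatFunc ℂ) (detPoly (deck π r ρ ε.ker g 0)) *
    algebraMap (Polynomial ℂ) (RatFunc ℂ) (detPoly (deck π r ρ ε.ker g 2)) /
    algebraMap (Polynomial ℂ) (RatFunc ℂ) (detPoly (deck π r ρ ε.ker g 1))

/-- The order at `t = 1` of a nonzero rational function. -/
def ordOne (f : RatFunc ℂ) : ℤ :=
  (f.num.rootMultiplicity 1 : ℤ) - (f.denom.rootMultiplicity 1 : ℤ)

/-! ## The twisted Alexander polynomial -/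

/-- `g ↦ t^{ε(g)} ρ(g) ∈ M_m(ℂ(t))`, where `ρ(g)` is written in the basis `v`. -/
def rhoEps {m : ℕ} (v : OrthonormalBasis (Fin m) ℂ V) (ρ : Representation ℂ Γ V)
    (ε : Γ →* Multiplicative ℤ) : Γ →* Matrix (Fin m) (Fin m) (RatFunc ℂ) where
  toFun g := (RatFunc.X : RatFunc ℂ) ^ (Multiplicative.toAdd (ε g)) •
    (LinearMap.toMatrix v.toBasis v.toBasis (ρ g)).map RatFunc.C
  map_one' := by
    have : LinearMap.toMatrix v.toBasis v.toBasis (ρ 1) = 1 := by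
      rw [map_one]; exact LinearMap.toMatrix_id v.toBasis
    rw [this]
    simp [Matrix.map_one]
  map_mul' g h := by
    rw [map_mul ρ, LinearMap.toMatrix_mul, Matrix.map_mul, map_mul,
      toAdd_mul, zpow_add₀ RatFunc.X_ne_zero, smul_mul_smul_comm]

/-- The ring homomorphism `Φ : ℂ[F] → M_m(ℂ(t))` induced by `ρ ⊗ ε`. -/
def Phi {m : ℕ} (π : FreeGroup ι →* Γ) (v : OrthonormalBasis (Fin m) ℂ V)
    (ρ : Representation ℂ Γ V) (ε : Γ →* Multiplicative ℤ) :
    MonoidAlgebra ℂ (FreeGroup ι) →ₐ[ℂ] Matrix (Fin m) (Fin m) (RatFunc ℂ) :=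
  MonoidAlgebra.lift ℂ _ _ ((rhoEps v ρ ε).comp π)

/-- The twisted Alexander polynomial `Δ_{K,ρ} = det A_j / det Φ(x_j - 1)` of a group with `n + 1`
generators and `n` relators: `A_j` is the block matrix of the `Φ(∂r_i/∂x_l)`, with the generator
`x_j` left out. -/
def twistedAlexander {n m : ℕ} (π : FreeGroup (Fin (n + 1)) →* Γ)
    (r : Fin n → FreeGroup (Fin (n + 1))) (v : OrthonormalBasis (Fin m) ℂ V)
    (ρ : Representation ℂ Γ V) (ε : Γ →* Multiplicative ℤ) (j : Fin (n + 1)) : RatFunc ℂ :=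
  Matrix.det (Matrix.of fun (a b : Fin n × Fin m) =>
      Phi π v ρ ε (fox (j.succAbove b.1) (r a.1)) a.2 b.2) /
    Matrix.det (Phi π v ρ ε (MonoidAlgebra.of ℂ _ (FreeGroup.of j) - 1))

/-! ## The Milnor-Reidemeister torsion of the twisted cochain complex -/

/-- `z` is a value of the (cohomological) Milnor-Reidemeister torsion of the acyclic based complex
with even part `E`, odd part `O`, differentials `dE : E → O`, `dO : O → E` and preferred bases
`cE`, `cO`. Choose `x` in `E` and `y` in `O` such that `dE x` and `dO y` are bases of the images of
`dE` and `dO`; then the torsion is `± det (y, dE x) / det (x, dO y)`, the determinants being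
formed with respect to `cO` and `cE`. (The orderings `e₀`, `e₁` affect only the sign.) -/
def IsTorsion {E O ιE ιO : Type*} [AddCommGroup E] [Module ℂ E] [AddCommGroup O] [Module ℂ O]
    [Fintype ιE] [DecidableEq ιE] [Fintype ιO] [DecidableEq ιO]
    (dE : E →ₗ[ℂ] O) (dO : O →ₗ[ℂ] E) (cE : Module.Basis ιE ℂ E) (cO : Module.Basis ιO ℂ O)
    (z : ℂ) : Prop :=
  ∃ (p q : ℕ) (x : Fin p → E) (y : Fin q → O) (e₀ : ιE ≃ Fin p ⊕ Fin q)
    (e₁ : ιO ≃ Fin q ⊕ Fin p),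
    LinearIndependent ℂ (dE ∘ x) ∧ Submodule.span ℂ (Set.range (dE ∘ x)) = LinearMap.range dE ∧
    LinearIndependent ℂ (dO ∘ y) ∧ Submodule.span ℂ (Set.range (dO ∘ y)) = LinearMap.range dO ∧
    (z = cO.det (Sum.elim y (dE ∘ x) ∘ e₁) / cE.det (Sum.elim x (dO ∘ y) ∘ e₀) ∨
      z = -(cO.det (Sum.elim y (dE ∘ x) ∘ e₁) / cE.det (Sum.elim x (dO ∘ y) ∘ e₀)))

/-- A cochain of `X` itself, i.e. an element of `Hom_{ℂ[Γ]}(C_i, V)`, is the same as its values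
on the cells. -/
def cochainEquiv (ι κ : Type) (ρ : Representation ℂ Γ V) (i : ℕ) :
    Cochain ι κ ρ (⊤ : Subgroup Γ) i ≃ₗ[ℂ] (Cell ι κ i → V) where
  toFun f α := f.1 (Finsupp.single α 1)
  map_add' _ _ := rfl
  map_smul' _ _ := rfl
  invFun w := ⟨Finsupp.lsum ℂ fun α => (LinearMap.applyₗ (w α)) ∘ₗ ρ.asAlgebraHom.toLinearMap, by
    intro h _ c
    induction c using Finsupp.induction_linear with
    | zero => simp only [map_zero]
    | add c d hc hd => simp only [map_add, hc, hd]
    | single α a =>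
      have h1 : act h i (Finsupp.single α a : Cell ι κ i →₀ MonoidAlgebra ℂ Γ) =
          Finsupp.single α (MonoidAlgebra.of ℂ Γ h * a) := Finsupp.smul_single _ _ _
      rw [h1, Finsupp.lsum_single, Finsupp.lsum_single]
      simp⟩
  left_inv f := by
    refine Subtype.ext (Finsupp.lhom_ext fun α a => ?_)
    induction a using MonoidAlgebra.induction_linear with
    | zero => simp only [Finsupp.single_zero, map_zero]
    | add a b ha hb => simp only [Finsupp.single_add, map_add, ha, hb]
    | single g a =>
      have h1 : (Finsupp.single α (MonoidAlgebra.single g a) : Cell ι κ i →₀ MonoidAlgebra ℂ Γ) =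
          a • act g i (Finsupp.single α 1) := by
        simp [act]
      have h2 := f.2 g trivial (Finsupp.single α 1 : Cell ι κ i →₀ MonoidAlgebra ℂ Γ)
      rw [h1, map_smul, map_smul, h2]
      simp [act]
  right_inv w := by
    funext α
    simp

/-- The preferred basis `c^i_α ⊗ v_j` of `C^i(X, ρ)`: the cochain `c^i_α ⊗ v_j` takes the value
`v_j` on the cell `c_{i,α}` and `0` on the other cells. -/
def cochainBasis {m : ℕ} (ι κ : Type) (ρ : Representation ℂ Γ V) (v : OrthonormalBasis (Fin m) ℂ V)
    (i : ℕ) [Fintype (Cell ι κ i)] :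
    Module.Basis ((_ : Cell ι κ i) × Fin m) ℂ (Cochain ι κ ρ (⊤ : Subgroup Γ) i) :=
  (Pi.basis fun _ : Cell ι κ i => v.toBasis).map (cochainEquiv ι κ ρ i).symm

/-- `z` is a value of the Milnor-Reidemeister torsion `τ_ℂ^*(X, ρ)` of the acyclic complex
`C^·(X, ρ)` with respect to the preferred bases. The even part of the complex is
`C^0 ⊕ C^2`, the odd part is `C^1`. -/
def IsCochainTorsion {m : ℕ} [Fintype κ] [DecidableEq κ] (π : FreeGroup ι →* Γ)
    (r : κ → FreeGroup ι) (ρ : Representation ℂ Γ V) (v : OrthonormalBasis (Fin m) ℂ V)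
    (z : ℂ) : Prop :=
  IsTorsion
    (LinearMap.coprod (coboundary π r ρ (⊤ : Subgroup Γ) 0) 0)
    (LinearMap.prod 0 (coboundary π r ρ (⊤ : Subgroup Γ) 1))
    ((cochainBasis ι κ ρ v 0).prod (cochainBasis ι κ ρ v 2))
    (cochainBasis ι κ ρ v 1) z

end Invariants

end KnotTorsion

end

/-! Write Λ = ℂ[T,T⁻¹] and fix t with ε(t) = 1. A `ker ε`-equivariant cochain is determined on each
cell by its values on the translates of the cell by powers of t, and these values are arbitrary
vectors of V. So C^i(X_∞,ρ) becomes a finite power of `Seq`, the two-sided complex sequences, on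
which Λ acts with T as translation. In these coordinates τ^* is multiplication by T, and the
coboundaries are matrices over Λ, the images of ∂e_j and of the Fox derivatives under g ↦
T^{ε(g)}ρ(g). With the j-th edge singled out, they contain the square matrices A (`foxMatrix`) and C
(`edgeMatrix`), and Δ = det A / det C.

Everything rests on two properties of `Seq`, which is the ℂ-dual of Λ. First, it is divisible
(`Seq.isDivisible`). Hence every nonzero polynomial in τ^* is onto on cochains, which forces the
finite dimensional H² of X_∞ to vanish by Cayley–Hamilton; then A acts surjectively and det A ≠ 0.
That det C ≠ 0 follows from unitarity, by evaluation at T = 2. Second, T - 1 has a one-dimensional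
kernel on `Seq`. Hence the (T - 1)-primary part of the kernel of a square matrix B with det B ≠ 0
has dimension equal to the order of det B at 1 (`finrank_genKer`).

If H⁰(X_∞,ρ) = 0, the primary kernels of C and A and the generalized 1-eigenspace of τ^* on
H¹(X_∞,ρ) form a short exact sequence (`finrank_genKer_foxMatrix`). So the order of Δ is the
dimension of that eigenspace, which is also minus the order of the Alexander invariant. The Wang
sequence identifies H¹(X,ρ) with the ordinary 1-eigenspace (`finrank_cohomology_one_eq`); this gives
the inequality, with equality in the semisimple case.

For the torsion, a block determinant identity over Λ (`det_foxMatrix_mul`) rewrites det A / det C,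
for any choice of x and y, as a quotient that at T = 1 is the inverse of the torsion up to sign. It
makes sense even if det C vanishes at 1. -/

noncomputable section

namespace KnotTorsion

/-! ### Matrices acting on vectors over a divisible module -/

section MatAct

variable {R M : Type*} [CommRing R] [AddCommGroup M] [Module R M]
variable {a b c : Type*} [Fintype b] [Fintype c]

/-- The action of a matrix over `R` on vectors with entries in an `R`-module. -/
def matAct (M : Type*) [AddCommGroup M] [Module R M] (B : Matrix a b R) :
    (b → M) →ₗ[R] (a → M) :=
  LinearMap.pi fun i => ∑ k, B i k • LinearMap.proj k

lemma matAct_apply (B : Matrix a b R) (z : b → M) (i : a) :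
    matAct M B z i = ∑ k, B i k • z k := by
  simp [matAct]

lemma matAct_mul (B : Matrix a b R) (C : Matrix b c R) (z : c → M) :
    matAct M (B * C) z = matAct M B (matAct M C z) := by
  ext i
  simp only [matAct_apply, Matrix.mul_apply, Finset.sum_smul, Finset.smul_sum, mul_smul]
  exact Finset.sum_comm

lemma matAct_smul_one [Fintype a] [DecidableEq a] (x : R) (z : a → M) :
    matAct M (x • (1 : Matrix a a R)) z = x • z := by
  ext i
  simp [matAct_apply, Matrix.one_apply]

lemma matAct_zero (z : b → M) : matAct M (0 : Matrix a b R) z = 0 := by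
  ext i
  simp [matAct_apply]

lemma matAct_add (B C : Matrix a b R) (z : b → M) :
    matAct M (B + C) z = matAct M B z + matAct M C z := by
  ext i
  simp [matAct_apply, add_smul, Finset.sum_add_distrib]

/-- Cramer's rule: multiply by the adjugate. -/
lemma det_smul_eq_zero [Fintype a] [DecidableEq a] (B : Matrix a a R) {z : a → M}
    (hz : matAct M B z = 0) : B.det • z = 0 := by
  rw [← matAct_smul_one, ← Matrix.adjugate_mul, matAct_mul, hz, map_zero]

/-- Every nonzero element of `R` acts surjectively on `M`. -/
def IsDivisible (R M : Type*) [CommRing R] [AddCommGroup M] [Module R M] : Prop :=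
  ∀ x : R, x ≠ 0 → Function.Surjective fun y : M => x • y

/-- Cramer's rule again: divide the target by the determinant and apply the adjugate. -/
lemma IsDivisible.matAct_surjective [Fintype a] [DecidableEq a] (h : IsDivisible R M) {B : Matrix a a R}
    (hB : B.det ≠ 0) : Function.Surjective (matAct M B) := by
  intro y
  choose g hg using h _ hB
  refine ⟨matAct M B.adjugate fun i => g (y i), ?_⟩
  rw [← matAct_mul, Matrix.mul_adjugate, matAct_smul_one]
  ext i
  exact hg (y i)

/-- If the determinant vanished, there would be a row w ≠ 0 with wB = 0, so w would kill the image
of B, which is everything. But a nonzero entry of w acts surjectively on a nonzero module, so w does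
not kill all vectors. -/
lemma IsDivisible.det_ne_zero [IsDomain R] [Nontrivial M] [Fintype a]
    [DecidableEq a] (h : IsDivisible R M)
    {B : Matrix a a R} (hB : Function.Surjective (matAct M B)) : B.det ≠ 0 := by
  intro h0
  obtain ⟨w, hw, hwB⟩ := Matrix.exists_vecMul_eq_zero_iff.2 h0
  obtain ⟨i, hi⟩ := Function.ne_iff.1 hw
  obtain ⟨x, hx⟩ := exists_ne (0 : M)
  obtain ⟨x', hx'⟩ := h _ hi x
  obtain ⟨z, hz⟩ := hB (Pi.single i x')
  have h1 : matAct M (Matrix.of fun (_ : Unit) k => w k) (matAct M B z) = 0 := by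
    rw [← matAct_mul]
    have h2 : (Matrix.of fun (_ : Unit) k => w k) * B = 0 := by
      ext _ k
      exact congrFun hwB k
    rw [h2, matAct_zero]
  have h2 := congrFun h1 ()
  rw [hz, matAct_apply] at h2
  simp only [Matrix.of_apply, Pi.zero_apply] at h2
  rw [Finset.sum_eq_single i (by intro k _ hk; simp [hk]) (by simp)] at h2
  rw [Pi.single_eq_same] at h2
  exact hx (hx'.symm.trans h2)

end MatAct

/-- An element not in the kernel of a character is coprime to a generator of the kernel. -/
lemma isCoprime_of_eval_ne_zero {R : Type*} [CommRing R] [Algebra ℂ R] (ev : R →ₐ[ℂ] ℂ) {p : R}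
    (hp : ∀ x, ev x = 0 ↔ p ∣ x) {c : R} (hc : ev c ≠ 0) : IsCoprime c p := by
  have h1 : ev (c - algebraMap ℂ R (ev c)) = 0 := by simp
  obtain ⟨d, hd⟩ := (hp _).1 h1
  refine ⟨algebraMap ℂ R (ev c)⁻¹, -(algebraMap ℂ R (ev c)⁻¹ * d), ?_⟩
  have h2 : algebraMap ℂ R (ev c)⁻¹ * algebraMap ℂ R (ev c) = 1 := by
    rw [← map_mul, inv_mul_cancel₀ hc, map_one]
  linear_combination algebraMap ℂ R (ev c)⁻¹ * hd + h2

/-! ### Primary kernels and the order of vanishing of a determinant -/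

section GenKer

variable {R M : Type*} [CommRing R] [AddCommGroup M] [Module R M]
variable {a : Type*} [Fintype a]

/-- The part of the kernel of a matrix, acting on vectors with entries in `M`, that is killed by
a power of `p`. -/
def genKer (M : Type*) [AddCommGroup M] [Module R M] (p : R) (B : Matrix a a R) :
    Submodule R (a → M) where
  carrier := {z | matAct M B z = 0 ∧ ∃ k : ℕ, p ^ k • z = 0}
  zero_mem' := ⟨map_zero _, 0, smul_zero _⟩
  add_mem' := by
    rintro x y ⟨hx, k, hk⟩ ⟨hy, l, hl⟩
    refine ⟨by rw [map_add, hx, hy, add_zero], k + l, ?_⟩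
    rw [smul_add, pow_add, mul_smul, mul_smul, hl, smul_zero, add_zero, smul_comm, hk, smul_zero]
  smul_mem' := by
    rintro c x ⟨hx, k, hk⟩
    exact ⟨by rw [map_smul, hx, smul_zero], k, by rw [smul_comm, hk, smul_zero]⟩

/-- The identity matrix with column `i` replaced by `-v`, and by `p` in the diagonal entry. -/
def columnFactor [DecidableEq a] (p : R) (v : a → R) (i : a) : Matrix a a R :=
  (1 : Matrix a a R).updateCol i (Function.update (-v) i p)

lemma det_columnFactor [DecidableEq a] (p : R) (v : a → R) (i : a) :
    (columnFactor p v i).det = p := by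
  rw [columnFactor, ← Matrix.cramer_apply, Matrix.cramer_one]
  simp

/-- A null vector v of B modulo p, normalized at i, lets one split off a factor of determinant p.
The product can differ from B only in column i, where it is p w - ∑_{x ≠ i} v_x B_x, and this is B_i
because Bv = p w and v_i = 1. -/
lemma updateCol_mul_columnFactor [DecidableEq a] (B : Matrix a a R) (p : R) (v w : a → R) (i : a)
    (hv : v i = 1) (hw : B.mulVec v = p • w) :
    B.updateCol i w * columnFactor p v i = B := by
  ext k l
  rw [Matrix.mul_apply]
  by_cases hl : l = i
  · subst hl
    have h1 := congrFun hw k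
    simp only [Matrix.mulVec, dotProduct, Pi.smul_apply, smul_eq_mul] at h1
    rw [← Finset.add_sum_erase _ _ (Finset.mem_univ l)] at h1 ⊢
    have h2 : ∀ x ∈ Finset.univ.erase l, B.updateCol l w k x * columnFactor p v l x l
        = - (B k x * v x) := by
      intro x hx
      have hx' := Finset.ne_of_mem_erase hx
      simp [columnFactor, hx']
    rw [Finset.sum_congr rfl h2, Finset.sum_neg_distrib]
    simp only [columnFactor, Matrix.updateCol_self, Function.update_self]
    rw [hv] at h1
    linear_combination -h1
  · simp [columnFactor, Matrix.updateCol_apply, hl, Matrix.one_apply]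

lemma matAct_columnFactor [DecidableEq a] (p : R) (v : a → R) (i : a) (z : a → M) (k : a) :
    matAct M (columnFactor p v i) z k = if k = i then p • z i else z k - v k • z i := by
  rw [matAct_apply, ← Finset.add_sum_erase _ _ (Finset.mem_univ i)]
  have h2 : ∀ x ∈ Finset.univ.erase i, columnFactor p v i k x • z x =
      if k = x then z x else 0 := by
    intro x hx
    have hx' := Finset.ne_of_mem_erase hx
    simp [columnFactor, hx', Matrix.one_apply]
  rw [Finset.sum_congr rfl h2, Finset.sum_ite_eq]
  by_cases hk : k = i
  · subst hk
    simp [columnFactor]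
  · simp [columnFactor, hk]
    abel

variable [Algebra ℂ R] [Module ℂ M] [IsScalarTower ℂ R M]

/-- Exactness of kernels for a product of matrices, on `p`-primary parts. -/
lemma finrank_genKer_mul [DecidableEq a] {p : R} {B C : Matrix a a R} (hC : C.det = p)
    (hs : Function.Surjective (matAct M C))
    [Module.Finite ℂ (LinearMap.ker (matAct M C))] [Module.Finite ℂ (genKer M p B)] :
    Module.Finite ℂ (genKer M p (B * C)) ∧ Module.finrank ℂ (genKer M p (B * C)) =
      Module.finrank ℂ (genKer M p B) + Module.finrank ℂ (LinearMap.ker (matAct M C)) := by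
  let f : genKer M p (B * C) →ₗ[R] genKer M p B :=
    (matAct M C).restrict (by
      rintro z ⟨hz, k, hk⟩
      exact ⟨by rw [← matAct_mul, hz], k, by rw [← map_smul, hk, map_zero]⟩)
  have hf : Function.Surjective f := by
    rintro ⟨y, hy, k, hk⟩
    obtain ⟨z, rfl⟩ := hs y
    refine ⟨⟨z, by rw [matAct_mul, hy], k + 1, ?_⟩, rfl⟩
    rw [pow_succ', mul_smul, ← hC]
    exact det_smul_eq_zero C (by rw [hC, map_smul, hk])
  have hle : LinearMap.ker (matAct M C) ≤ genKer M p (B * C) := by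
    intro z hz
    have hz' : matAct M C z = 0 := hz
    exact ⟨by rw [matAct_mul, hz', map_zero], 1, by
      rw [pow_one, ← hC]; exact det_smul_eq_zero C hz'⟩
  let g : LinearMap.ker (matAct M C) →ₗ[R] genKer M p (B * C) := Submodule.inclusion hle
  have hg : Function.Injective g := Submodule.inclusion_injective hle
  have hgf : Function.Exact (g.restrictScalars ℂ) (f.restrictScalars ℂ) := by
    rintro ⟨z, hz⟩
    constructor
    · intro h
      exact ⟨⟨z, congrArg Subtype.val h⟩, rfl⟩
    · rintro ⟨⟨y, hy⟩, h⟩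
      have : y = z := congrArg Subtype.val h
      subst this
      exact Subtype.ext hy
  have hfin := Module.Finite.of_exact (f := g.restrictScalars ℂ) (g := f.restrictScalars ℂ) hgf hf
  refine ⟨hfin, ?_⟩
  have h1 := LinearMap.finrank_range_add_finrank_ker (f.restrictScalars ℂ)
  rw [LinearMap.range_eq_top.2 (show Function.Surjective (f.restrictScalars ℂ) from hf),
    finrank_top, hgf.linearMap_ker_eq,
    LinearMap.finrank_range_of_inj (show Function.Injective (g.restrictScalars ℂ) from hg)] at h1
  exact h1.symm

/-- The kernel of a square matrix acting on vectors in a divisible module, localized at the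
prime element `p`, has the order of vanishing of the determinant as its dimension. -/
theorem finrank_genKer [DecidableEq a] [IsDomain R] (ev : R →ₐ[ℂ] ℂ) {p : R}
    (hp : ∀ x, ev x = 0 ↔ p ∣ x) (hp0 : p ≠ 0) (hM : IsDivisible R M)
    [Module.Finite ℂ (LinearMap.ker (LinearMap.lsmul R M p))]
    (hker : Module.finrank ℂ (LinearMap.ker (LinearMap.lsmul R M p)) = 1)
    (k : ℕ) : ∀ (B : Matrix a a R) (c : R), ev c ≠ 0 → B.det = p ^ k * c →
      Module.Finite ℂ (genKer M p B) ∧ Module.finrank ℂ (genKer M p B) = k := by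
  induction k with
  | zero =>
    intro B c hc hB
    rw [pow_zero, one_mul] at hB
    have hcop := isCoprime_of_eval_ne_zero ev hp hc
    have h0 : ∀ z : genKer M p B, z = 0 := by
      rintro ⟨z, hz, l, hl⟩
      obtain ⟨u, w, huw⟩ := hcop.pow_right (n := l)
      refine Subtype.ext ?_
      change z = 0
      rw [← one_smul R z, ← huw, add_smul, mul_smul, mul_smul, hl, ← hB, det_smul_eq_zero B hz]
      simp
    have : Subsingleton (genKer M p B) := ⟨fun x y => by rw [h0 x, h0 y]⟩
    exact ⟨inferInstance, Module.finrank_zero_of_subsingleton⟩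
  | succ k ih =>
    intro B c hc hB
    -- The reduction of B modulo p is singular. A null vector over ℂ, scaled to have i-th entry 1
    -- and lifted to constants, is a null vector of B modulo p.
    have hdet : (ev.mapMatrix B).det = 0 := by
      rw [← AlgHom.map_det, hp, hB, pow_succ', mul_assoc]
      exact dvd_mul_right _ _
    obtain ⟨v, hv, hBv⟩ := Matrix.exists_mulVec_eq_zero_iff.2 hdet
    obtain ⟨i, hi⟩ := Function.ne_iff.1 hv
    let v' : a → R := fun l => algebraMap ℂ R ((v i)⁻¹ * v l)
    have hv'i : v' i = 1 := by
      simp only [v']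
      rw [inv_mul_cancel₀ hi, map_one]
    have hdiv : ∀ l, p ∣ B.mulVec v' l := by
      intro l
      rw [← hp]
      have h1 := congrFun hBv l
      simp only [Matrix.mulVec, dotProduct, AlgHom.mapMatrix_apply, Matrix.map_apply,
        Pi.zero_apply] at h1
      simp only [Matrix.mulVec, dotProduct, map_sum, map_mul, v', AlgHom.commutes,
        Algebra.algebraMap_self, RingHom.id_apply]
      calc ∑ x, ev (B l x) * ((v i)⁻¹ * v x) = (v i)⁻¹ * ∑ x, ev (B l x) * v x := by
            rw [Finset.mul_sum]; exact Finset.sum_congr rfl fun x _ => by ring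
        _ = 0 := by rw [h1, mul_zero]
    choose w hw using hdiv
    set B' := B.updateCol i w
    set C := columnFactor p v' i
    have hBC : B' * C = B := updateCol_mul_columnFactor B p v' w i hv'i (funext hw)
    have hdetC : C.det = p := det_columnFactor p v' i
    have hdetB' : B'.det = p ^ k * c := by
      have h1 : B'.det * p = p ^ (k + 1) * c := by rw [← hB, ← hBC, Matrix.det_mul, hdetC]
      apply mul_right_cancel₀ hp0
      rw [h1]; ring
    obtain ⟨h1, h2⟩ := ih B' c hc hdetB'
    have hs : Function.Surjective (matAct M C) :=
      hM.matAct_surjective (by rw [hdetC]; exact hp0)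
    -- The rows of C z = 0 read p z_i = 0 and z_k = v'_k z_i for k ≠ i, so the i-th coordinate is a
    -- free parameter in the kernel of p.
    let e : LinearMap.ker (matAct M C) ≃ₗ[ℂ] LinearMap.ker (LinearMap.lsmul R M p) :=
      { toFun := fun z => ⟨z.1 i, by
          have := congrFun (show matAct M C z.1 = 0 from z.2) i
          rw [matAct_columnFactor, if_pos rfl] at this
          exact this⟩
        invFun := fun m => ⟨fun l => v' l • m.1, by
          have hm : p • m.1 = 0 := m.2
          change matAct M C _ = 0
          ext l
          rw [matAct_columnFactor, hv'i, one_smul, sub_self, hm]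
          simp⟩
        map_add' := fun _ _ => rfl
        map_smul' := fun _ _ => rfl
        left_inv := fun z => by
          refine Subtype.ext (funext fun l => ?_)
          have := congrFun (show matAct M C z.1 = 0 from z.2) l
          rw [matAct_columnFactor] at this
          by_cases hl : l = i
          · subst hl
            change v' l • z.1 l = z.1 l
            rw [hv'i, one_smul]
          · rw [if_neg hl] at this
            exact (sub_eq_zero.1 this).symm
        right_inv := fun m => by
          refine Subtype.ext ?_
          change v' i • m.1 = m.1
          rw [hv'i, one_smul] }
    have : Module.Finite ℂ (LinearMap.ker (matAct M C)) := Module.Finite.equiv e.symm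
    obtain ⟨h3, h4⟩ := finrank_genKer_mul (B := B') hdetC hs
    rw [hBC] at h3 h4
    exact ⟨h3, by rw [h4, h2, e.finrank_eq, hker]⟩

end GenKer

/-! ### Laurent polynomials: evaluation at 1 and passage to rational functions -/

open LaurentPolynomial

section Laurent

variable {A : Type*} [Semiring A] [Algebra ℂ A]

/-- Substitution of a unit in Laurent polynomials. -/
def laurentEval (u : Aˣ) : ℂ[T;T⁻¹] →ₐ[ℂ] A :=
  AddMonoidAlgebra.lift ℂ A ℤ ((Units.coeHom A).comp (zpowersHom _ u))

@[simp] lemma laurentEval_T (u : Aˣ) (n : ℤ) : laurentEval u (T n) = ((u ^ n : Aˣ) : A) := by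
  rw [laurentEval, T, AddMonoidAlgebra.lift_single, one_smul]
  rfl

lemma laurentEval_toLaurent (u : Aˣ) (p : Polynomial ℂ) :
    laurentEval u (Polynomial.toLaurent p) = Polynomial.aeval (u : A) p := by
  have h : (laurentEval u).comp Polynomial.toLaurentAlg = Polynomial.aeval (u : A) := by
    ext
    simp
  exact DFunLike.congr_fun h p

lemma isUnit_laurentEval_T (u : Aˣ) (n : ℤ) : IsUnit (laurentEval u (T n)) := by
  rw [laurentEval_T]
  exact Units.isUnit _

/-- Evaluation of Laurent polynomials at `1`. -/
abbrev evalOne : ℂ[T;T⁻¹] →ₐ[ℂ] ℂ := laurentEval 1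

/-- Laurent polynomials as rational functions. -/
abbrev toRat : ℂ[T;T⁻¹] →ₐ[ℂ] RatFunc ℂ := laurentEval (Units.mk0 RatFunc.X RatFunc.X_ne_zero)

lemma evalOne_toLaurent (p : Polynomial ℂ) : evalOne (Polynomial.toLaurent p) = p.eval 1 := by
  rw [laurentEval_toLaurent]
  simp [Polynomial.aeval_def, Polynomial.eval₂_eq_eval_map]

lemma toRat_toLaurent (p : Polynomial ℂ) :
    toRat (Polynomial.toLaurent p) = algebraMap (Polynomial ℂ) (RatFunc ℂ) p := by
  rw [laurentEval_toLaurent]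
  exact RatFunc.aeval_X_left_eq_algebraMap p

lemma toRat_injective : Function.Injective toRat := by
  rw [injective_iff_map_eq_zero]
  intro p hp
  obtain ⟨n, q, hq⟩ := exists_T_pow p
  have h1 := toRat_toLaurent q
  rw [hq, map_mul, hp, zero_mul] at h1
  have h2 : q = 0 := (map_eq_zero_iff _ (RatFunc.algebraMap_injective ℂ)).1 h1.symm
  rw [h2, map_zero] at hq
  exact (isUnit_T (n : ℤ)).mul_left_eq_zero.1 hq.symm

lemma T_one_sub_one_ne_zero : (T 1 - 1 : ℂ[T;T⁻¹]) ≠ 0 := by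
  have h : (T 1 - 1 : ℂ[T;T⁻¹]) = Polynomial.toLaurent (Polynomial.X - 1) := by simp
  rw [h, Polynomial.toLaurent_ne_zero]
  exact Polynomial.X_sub_C_ne_zero 1

/-- The factor theorem, after multiplication by a power of the unit T. It supplies the hypothesis of
`finrank_genKer` for p = T - 1. -/
lemma evalOne_eq_zero_iff (p : ℂ[T;T⁻¹]) : evalOne p = 0 ↔ (T 1 - 1) ∣ p := by
  constructor
  · intro h
    obtain ⟨n, q, hq⟩ := exists_T_pow p
    have h1 := evalOne_toLaurent q
    rw [hq, map_mul, h, zero_mul] at h1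
    obtain ⟨s, hs⟩ := Polynomial.dvd_iff_isRoot.2 h1.symm
    have h2 : (T 1 - 1 : ℂ[T;T⁻¹]) ∣ p * T n := by
      rw [← hq, hs]
      exact ⟨Polynomial.toLaurent s, by simp⟩
    exact (isUnit_T (n : ℤ)).dvd_mul_right.1 h2
  · rintro ⟨q, rfl⟩
    simp

lemma exists_eq_pow_mul {p : ℂ[T;T⁻¹]} (hp : p ≠ 0) :
    ∃ (k : ℕ) (c : ℂ[T;T⁻¹]), evalOne c ≠ 0 ∧ p = (T 1 - 1) ^ k * c := by
  obtain ⟨n, q, hq⟩ := exists_T_pow p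
  have hq0 : q ≠ 0 := by
    rintro rfl
    rw [map_zero] at hq
    exact hp ((isUnit_T (n : ℤ)).mul_left_eq_zero.1 hq.symm)
  obtain ⟨s, hs, hs'⟩ := Polynomial.exists_eq_pow_rootMultiplicity_mul_and_not_dvd q hq0 1
  refine ⟨q.rootMultiplicity 1, Polynomial.toLaurent s * T (-n), ?_, ?_⟩
  · rw [map_mul, evalOne_toLaurent]
    refine mul_ne_zero (fun h => hs' (Polynomial.dvd_iff_isRoot.2 h)) ?_
    exact (isUnit_laurentEval_T _ _).ne_zero
  · have h1 : p = Polynomial.toLaurent q * T (-n) := by rw [hq, mul_T_assoc]; simp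
    rw [h1, ← mul_assoc]
    congr 1
    conv_lhs => rw [hs]
    simp

/-- `ordOne` is defined through the reduced fraction; cancelled common factors contribute equally to
both multiplicities. -/
lemma ordOne_div {p q : Polynomial ℂ} (hp : p ≠ 0) (hq : q ≠ 0) :
    ordOne (algebraMap _ (RatFunc ℂ) p / algebraMap _ (RatFunc ℂ) q) =
      (p.rootMultiplicity 1 : ℤ) - q.rootMultiplicity 1 := by
  set f := algebraMap _ (RatFunc ℂ) p / algebraMap _ (RatFunc ℂ) q with hf
  have h : f.num * q = p * f.denom := (RatFunc.num_mul_eq_mul_denom_iff hq).2 hf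
  have hf0 : f ≠ 0 := div_ne_zero (RatFunc.algebraMap_ne_zero hp) (RatFunc.algebraMap_ne_zero hq)
  have h1 := congrArg (Polynomial.rootMultiplicity 1) h
  have hn : f.num ≠ 0 := RatFunc.num_ne_zero hf0
  have hd : f.denom ≠ 0 := f.denom_ne_zero
  rw [Polynomial.rootMultiplicity_mul (mul_ne_zero hn hq),
    Polynomial.rootMultiplicity_mul (mul_ne_zero hp hd)] at h1
  rw [ordOne]
  omega

lemma ordOne_toRat_div {p q c d : ℂ[T;T⁻¹]} {k l : ℕ} (hc : evalOne c ≠ 0) (hd : evalOne d ≠ 0)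
    (hp : p = (T 1 - 1) ^ k * c) (hq : q = (T 1 - 1) ^ l * d) :
    ordOne (toRat p / toRat q) = k - l := by
  obtain ⟨n, c', hc'⟩ := exists_T_pow c
  obtain ⟨m, d', hd'⟩ := exists_T_pow d
  have key : toRat p / toRat q =
      algebraMap _ (RatFunc ℂ) ((Polynomial.X - 1) ^ k * c' * Polynomial.X ^ m) /
      algebraMap _ (RatFunc ℂ) ((Polynomial.X - 1) ^ l * d' * Polynomial.X ^ n) := by
    -- Numerator and denominator are both multiplied by T^n T^m, which makes them polynomials at
    -- once and adds only powers of X, invisible at 1.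
    have h1 : toRat ((T 1 - 1) ^ k * c * T n * T m) =
        algebraMap _ (RatFunc ℂ) ((Polynomial.X - 1) ^ k * c' * Polynomial.X ^ m) := by
      rw [← toRat_toLaurent]
      simp only [map_mul, map_pow, map_sub, map_one, Polynomial.toLaurent_X, hc', mul_assoc]
      simp
    have h2 : toRat ((T 1 - 1) ^ l * d * T n * T m) =
        algebraMap _ (RatFunc ℂ) ((Polynomial.X - 1) ^ l * d' * Polynomial.X ^ n) := by
      rw [← toRat_toLaurent]
      simp only [map_mul, map_pow, map_sub, map_one, Polynomial.toLaurent_X, hd', mul_assoc]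
      simp [mul_comm]
    rw [← h1, ← h2, ← hp, ← hq]
    simp only [map_mul]
    rw [mul_div_mul_right _ _ (isUnit_laurentEval_T _ _).ne_zero,
      mul_div_mul_right _ _ (isUnit_laurentEval_T _ _).ne_zero]
  have mult : ∀ (e : ℂ[T;T⁻¹]) (e' : Polynomial ℂ) (k r s : ℕ), evalOne e ≠ 0 →
      Polynomial.toLaurent e' = e * T r →
      (Polynomial.X - 1) ^ k * e' * Polynomial.X ^ s ≠ 0 ∧
      ((Polynomial.X - 1) ^ k * e' * Polynomial.X ^ s).rootMultiplicity 1 = k := by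
    intro e e' k r s he h
    have h0 : e'.eval 1 ≠ 0 := by
      rw [← evalOne_toLaurent, h, map_mul]
      exact mul_ne_zero he (isUnit_laurentEval_T _ _).ne_zero
    have h1 : e' ≠ 0 := by
      rintro rfl
      simp at h0
    have h2 : ((Polynomial.X - 1) ^ k * e' * Polynomial.X ^ s : Polynomial ℂ) ≠ 0 :=
      mul_ne_zero (mul_ne_zero (pow_ne_zero _ (Polynomial.X_sub_C_ne_zero 1)) h1)
        (pow_ne_zero _ Polynomial.X_ne_zero)
    refine ⟨h2, ?_⟩
    rw [Polynomial.rootMultiplicity_mul h2, Polynomial.rootMultiplicity_mul (left_ne_zero_of_mul h2),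
      Polynomial.rootMultiplicity_eq_zero (p := e') h0,
      Polynomial.rootMultiplicity_eq_zero (p := Polynomial.X ^ s) (by simp)]
    simpa using Polynomial.rootMultiplicity_X_sub_C_pow (1 : ℂ) k
  obtain ⟨h1, h1'⟩ := mult c c' k n m hc hc'
  obtain ⟨h2, h2'⟩ := mult d d' l m n hd hd'
  rw [key, ordOne_div h1 h2, h1', h2']

/-- `RatFunc.eval` uses the reduced denominator. This divides the given polynomial denominator,
hence does not vanish at 1 either, and cross-multiplication is legitimate. -/
lemma eval_toRat_div {p q : ℂ[T;T⁻¹]} (hq : evalOne q ≠ 0) :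
    (toRat p / toRat q).eval (RingHom.id ℂ) 1 = evalOne p / evalOne q := by
  obtain ⟨n, p', hp'⟩ := exists_T_pow p
  obtain ⟨m, q', hq'⟩ := exists_T_pow q
  have hT : ∀ k : ℤ, evalOne (T k) = 1 := fun k => by simp
  set a := p' * Polynomial.X ^ m
  set b := q' * Polynomial.X ^ n
  have ha : Polynomial.toLaurent a = p * (T n * T m) := by
    simp only [a, map_mul, hp', Polynomial.toLaurent_X_pow, mul_assoc]
  have hb : Polynomial.toLaurent b = q * (T n * T m) := by
    simp only [b, map_mul, hq', Polynomial.toLaurent_X_pow, mul_assoc, mul_comm (T (m : ℤ))]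
  have ha1 : a.eval 1 = evalOne p := by
    rw [← evalOne_toLaurent, ha]
    simp only [map_mul, hT, mul_one]
  have hb1 : b.eval 1 = evalOne q := by
    rw [← evalOne_toLaurent, hb]
    simp only [map_mul, hT, mul_one]
  have hb0 : b ≠ 0 := by
    intro h
    rw [h, Polynomial.eval_zero] at hb1
    exact hq hb1.symm
  have key : toRat p / toRat q = algebraMap _ (RatFunc ℂ) a / algebraMap _ (RatFunc ℂ) b := by
    rw [← toRat_toLaurent, ← toRat_toLaurent, ha, hb, map_mul toRat p, map_mul toRat q,
      mul_div_mul_right]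
    rw [map_mul]
    exact mul_ne_zero (isUnit_laurentEval_T _ _).ne_zero (isUnit_laurentEval_T _ _).ne_zero
  rw [key, ← ha1, ← hb1]
  set f := algebraMap _ (RatFunc ℂ) a / algebraMap _ (RatFunc ℂ) b with hf
  have h := congrArg (Polynomial.eval 1) ((RatFunc.num_mul_eq_mul_denom_iff hb0).2 hf)
  rw [Polynomial.eval_mul (p := f.num) (q := b), Polynomial.eval_mul (p := a)] at h
  have hd : f.denom.eval 1 ≠ 0 := by
    intro h0
    obtain ⟨s, hs⟩ := RatFunc.denom_div_dvd a b
    rw [← hf] at hs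
    rw [← hb1, hs, Polynomial.eval_mul, h0, zero_mul] at hq
    exact hq rfl
  have hb2 : b.eval 1 ≠ 0 := by rwa [hb1]
  rw [RatFunc.eval, Polynomial.eval₂_id, Polynomial.eval₂_id, div_eq_div_iff hd hb2]
  exact h

end Laurent

/-! ### Two-sided sequences -/

/-- Two-sided sequences of complex numbers. -/
def Seq : Type := ℤ → ℂ

/-- The sequence with given entries. -/
def Seq.mk (f : ℤ → ℂ) : Seq := f

lemma Seq.mk_apply (f : ℤ → ℂ) (k : ℤ) : Seq.mk f k = f k := rfl

instance : AddCommGroup Seq := inferInstanceAs (AddCommGroup (ℤ → ℂ))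

instance : Module ℂ Seq := inferInstanceAs (Module ℂ (ℤ → ℂ))

instance : Nontrivial Seq := inferInstanceAs (Nontrivial (ℤ → ℂ))

/-- The action of `ℤ` on two-sided sequences by translations. -/
def Seq.shift : Multiplicative ℤ →* Module.End ℂ Seq where
  toFun n :=
    { toFun := fun f k => f (k + n.toAdd)
      map_add' := fun _ _ => rfl
      map_smul' := fun _ _ => rfl }
  map_one' := LinearMap.ext fun f => funext fun k => congrArg f (add_zero k)
  map_mul' a b := LinearMap.ext fun f => funext fun k => congrArg f
    (show k + (a.toAdd + b.toAdd) = (k + a.toAdd) + b.toAdd by ring)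

/-- The action of Laurent polynomials on sequences, the variable acting as the translation. -/
def Seq.laurentHom : ℂ[T;T⁻¹] →ₐ[ℂ] Module.End ℂ Seq := AddMonoidAlgebra.lift ℂ _ ℤ Seq.shift

instance : Module ℂ[T;T⁻¹] Seq := Module.compHom Seq Seq.laurentHom.toRingHom

lemma Seq.laurent_smul_def (p : ℂ[T;T⁻¹]) (f : Seq) : p • f = Seq.laurentHom p f := rfl

instance : IsScalarTower ℂ ℂ[T;T⁻¹] Seq where
  smul_assoc c p f := by
    rw [Seq.laurent_smul_def, Seq.laurent_smul_def, map_smul, LinearMap.smul_apply]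

lemma Seq.T_smul (n : ℤ) (f : Seq) (k : ℤ) : ((T n : ℂ[T;T⁻¹]) • f) k = f (k + n) := by
  rw [Seq.laurent_smul_def, Seq.laurentHom, LaurentPolynomial.T,
    AddMonoidAlgebra.lift_single, one_smul]
  rfl

lemma Seq.add_apply (f g : Seq) (k : ℤ) : (f + g) k = f k + g k := rfl

lemma Seq.sub_apply (f g : Seq) (k : ℤ) : (f - g) k = f k - g k := rfl

lemma Seq.smul_apply (c : ℂ) (f : Seq) (k : ℤ) : (c • f) k = c * f k := rfl

lemma Seq.C_smul (c : ℂ) (f : Seq) : (C c : ℂ[T;T⁻¹]) • f = c • f := by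
  rw [C_eq_algebraMap, algebraMap_smul]

/-- h(k) is the sum of g over [0, k) for k ≥ 0, and minus the sum over [k, 0) for k < 0; one of the
two sums is always empty. -/
lemma exists_forall_add_one_sub_eq (g : ℤ → ℂ) : ∃ h : ℤ → ℂ, ∀ k, h (k + 1) - h k = g k := by
  refine ⟨fun k => ∑ i ∈ Finset.range k.toNat, g i -
    ∑ i ∈ Finset.range (-k).toNat, g (-(i : ℤ) - 1), fun k => ?_⟩
  rcases lt_or_ge k 0 with hk | hk
  · obtain ⟨m, rfl⟩ : ∃ m : ℕ, k = -(m : ℤ) - 1 := ⟨(-k - 1).toNat, by omega⟩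
    have h1 : (-(m : ℤ) - 1 + 1).toNat = 0 := by omega
    have h2 : (-(m : ℤ) - 1).toNat = 0 := by omega
    have h3 : (-(-(m : ℤ) - 1 + 1)).toNat = m := by omega
    have h4 : (-(-(m : ℤ) - 1)).toNat = m + 1 := by omega
    simp only [h1, h2, h3, h4]
    rw [Finset.sum_range_succ]
    simp
  · obtain ⟨m, rfl⟩ := Int.eq_ofNat_of_zero_le hk
    have h1 : ((m : ℤ) + 1).toNat = m + 1 := by omega
    have h2 : ((m : ℤ)).toNat = m := by omega
    have h3 : (-((m : ℤ) + 1)).toNat = 0 := by omega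
    have h4 : (-(m : ℤ)).toNat = 0 := by omega
    simp only [h1, h2, h3, h4]
    rw [Finset.sum_range_succ]
    simp

/-- Variation of constants: for r ≠ 0 the substitution f(k) = r^k h(k) turns f(k+1) - r f(k) = g(k)
into a plain difference equation for h. For r = 0 a translation suffices. -/
lemma Seq.T_sub_C_surjective (r : ℂ) :
    Function.Surjective fun f : Seq => (T 1 - C r : ℂ[T;T⁻¹]) • f := by
  intro g
  have key : ∀ (f : Seq) (k : ℤ), ((T 1 - C r : ℂ[T;T⁻¹]) • f) k = f (k + 1) - r * f k := by
    intro f k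
    rw [sub_smul, Seq.sub_apply, Seq.T_smul, Seq.C_smul, Seq.smul_apply]
  by_cases hr : r = 0
  · refine ⟨Seq.mk fun k => g (k - 1), funext fun k => ?_⟩
    refine (key _ k).trans ?_
    rw [Seq.mk_apply, hr, zero_mul, sub_zero, add_sub_cancel_right]
  · obtain ⟨h, hh⟩ := exists_forall_add_one_sub_eq fun k => r ^ (-(k + 1)) * g k
    refine ⟨Seq.mk fun k => r ^ k * h k, funext fun k => ?_⟩
    simp only [key, Seq.mk_apply]
    have h1 : h (k + 1) = r ^ (-(k + 1)) * g k + h k := by rw [← hh k]; ring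
    rw [h1, mul_add, ← mul_assoc, ← zpow_add₀ hr, zpow_add_one₀ hr]
    simp
    ring

/-- Elements acting surjectively are closed under products, and over ℂ every nonzero Laurent
polynomial is a unit times a product of factors T - r. -/
theorem Seq.isDivisible : IsDivisible ℂ[T;T⁻¹] Seq := by
  have hcomp : ∀ p q : ℂ[T;T⁻¹], (Function.Surjective fun f : Seq => p • f) →
      (Function.Surjective fun f : Seq => q • f) → Function.Surjective fun f : Seq => (p * q) • f := by
    intro p q hp hq g
    obtain ⟨f, hf⟩ := hp g
    obtain ⟨e, he⟩ := hq f
    refine ⟨e, ?_⟩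
    simp only at he hf ⊢
    rw [mul_smul, he, hf]
  have hunit : ∀ p : ℂ[T;T⁻¹], IsUnit p → Function.Surjective fun f : Seq => p • f := by
    rintro _ ⟨u, rfl⟩ g
    exact ⟨(u⁻¹ : (ℂ[T;T⁻¹])ˣ) • g, smul_inv_smul u g⟩
  have hpoly : ∀ q : Polynomial ℂ, q ≠ 0 →
      Function.Surjective fun f : Seq => Polynomial.toLaurent q • f := by
    intro q hq
    rw [(IsAlgClosed.splits q).eq_prod_roots, map_mul, Polynomial.toLaurent_C]
    refine hcomp _ _ (hunit _ ((isUnit_iff_ne_zero.2 (Polynomial.leadingCoeff_ne_zero.2 hq)).map C)) ?_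
    induction q.roots using Multiset.induction with
    | empty =>
      simp only [Multiset.map_zero, Multiset.prod_zero, map_one]
      exact hunit _ isUnit_one
    | cons r s ih =>
      rw [Multiset.map_cons, Multiset.prod_cons, map_mul]
      refine hcomp _ _ ?_ ih
      simpa using Seq.T_sub_C_surjective r
  intro p hp
  obtain ⟨n, q, hq⟩ := exists_T_pow p
  have hq0 : q ≠ 0 := by
    rintro rfl
    rw [map_zero] at hq
    exact hp ((isUnit_T (n : ℤ)).mul_left_eq_zero.1 hq.symm)
  have h1 : p = Polynomial.toLaurent q * T (-n) := by rw [hq, mul_T_assoc]; simp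
  rw [h1]
  exact hcomp _ _ (hpoly q hq0) (hunit _ (isUnit_T _))

lemma Seq.eq_of_T_sub_one_smul_eq_zero {f : Seq} (hf : (T 1 - 1 : ℂ[T;T⁻¹]) • f = 0) (k : ℤ) :
    f k = f 0 := by
  have h : ∀ k, f (k + 1) = f k := fun k => by
    have := congrFun hf k
    rw [sub_smul, one_smul, Seq.sub_apply, Seq.T_smul] at this
    exact sub_eq_zero.1 this
  induction k using Int.induction_on with
  | zero => rfl
  | succ k ih => rw [h, ih]
  | pred k ih => rw [← ih, ← h, sub_add_cancel]

/-- The sequences invariant under translation are the constants. -/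
def Seq.kerEquiv : LinearMap.ker (LinearMap.lsmul ℂ[T;T⁻¹] Seq (T 1 - 1)) ≃ₗ[ℂ] ℂ where
  toFun f := f.1 0
  map_add' _ _ := rfl
  map_smul' _ _ := rfl
  invFun c := ⟨Seq.mk fun _ => c, funext fun k => by
    rw [LinearMap.lsmul_apply, sub_smul, one_smul, Seq.sub_apply, Seq.T_smul]
    exact sub_self c⟩
  left_inv f := Subtype.ext (funext fun k => (Seq.eq_of_T_sub_one_smul_eq_zero f.2 k).symm)
  right_inv _ := rfl

lemma Seq.finrank_genKer {a : Type*} [Fintype a] [DecidableEq a] {B : Matrix a a ℂ[T;T⁻¹]}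
    {k : ℕ} {c : ℂ[T;T⁻¹]} (hc : evalOne c ≠ 0) (hB : B.det = (T 1 - 1) ^ k * c) :
    Module.Finite ℂ (genKer Seq (T 1 - 1) B) ∧
      Module.finrank ℂ (genKer Seq (T 1 - 1) B) = k := by
  have : Module.Finite ℂ (LinearMap.ker (LinearMap.lsmul ℂ[T;T⁻¹] Seq (T 1 - 1))) :=
    Module.Finite.equiv Seq.kerEquiv.symm
  exact KnotTorsion.finrank_genKer evalOne evalOne_eq_zero_iff T_one_sub_one_ne_zero
    Seq.isDivisible (by rw [Seq.kerEquiv.finrank_eq, Module.finrank_self]) k B c hc hB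

/-! ### Duality between twisted homology and cohomology -/

section FoxConj

variable {ι : Type*} [DecidableEq ι]

/-- Complex conjugation of the coefficients in a group ring. -/
abbrev conjRing (G : Type*) [Group G] : MonoidAlgebra ℂ G →+* MonoidAlgebra ℂ G :=
  MonoidAlgebra.mapRingHom G (starRingEnd ℂ)

lemma conjRing_of {G : Type*} [Group G] (g : G) :
    conjRing G (MonoidAlgebra.of ℂ G g) = MonoidAlgebra.of ℂ G g := by
  simp [conjRing, MonoidAlgebra.of_apply]

lemma conjRing_conjRing {G : Type*} [Group G] (x : MonoidAlgebra ℂ G) :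
    conjRing G (conjRing G x) = x := by
  have h : (conjRing G).comp (conjRing G) = RingHom.id _ := by
    ext <;> simp [conjRing]
  exact DFunLike.congr_fun h x

/-- Fox derivatives have integer coefficients. Therefore conjugation of coefficients commutes with
the boundary, which the sesquilinear pairing below requires. -/
lemma conjRing_foxWord (j : ι) (w : List (ι × Bool)) :
    conjRing (FreeGroup ι) (foxWord j w) = foxWord j w := by
  induction w with
  | nil => simp [foxWord]
  | cons x w ih =>
    obtain ⟨a, b⟩ := x
    cases b
    · rw [foxWord, map_mul, map_add, ih, conjRing_of]
      split_ifs <;> simp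
    · rw [foxWord, map_add, map_mul, ih, conjRing_of]
      split_ifs <;> simp

lemma conjRing_mapDomain {G G' : Type*} [Group G] [Group G'] (π : G →* G')
    (x : MonoidAlgebra ℂ G) : conjRing G' (MonoidAlgebra.mapDomain π x) =
      MonoidAlgebra.mapDomain π (conjRing G x) :=
  DFunLike.congr_fun (MonoidAlgebra.mapRingHom_comp_mapDomainRingHom (starRingEnd ℂ) π) x

end FoxConj

section Duality

variable {Γ : Type*} [Group Γ] {ι κ : Type}

/-- Complex conjugation of the coefficients of a chain. -/
def conjChain (i : ℕ) : Chain Γ ι κ i →+ Chain Γ ι κ i :=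
  Finsupp.mapRange.addMonoidHom (conjRing Γ).toAddMonoidHom

lemma conjChain_single {i : ℕ} (α : Cell ι κ i) (x : MonoidAlgebra ℂ Γ) :
    conjChain i (Finsupp.single α x) = Finsupp.single α (conjRing Γ x) := by
  simp [conjChain]

lemma conjChain_smul {i : ℕ} (x : MonoidAlgebra ℂ Γ) (c : Chain Γ ι κ i) :
    conjChain i (x • c) = conjRing Γ x • conjChain i c := by
  induction c using Finsupp.induction_linear with
  | zero => simp
  | add c d hc hd => rw [smul_add, map_add, map_add, smul_add, hc, hd]
  | single α y => simp only [Finsupp.smul_single, conjChain_single, smul_eq_mul, map_mul]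

lemma conjChain_act (g : Γ) {i : ℕ} (c : Chain Γ ι κ i) :
    conjChain i (act g i c) = act g i (conjChain i c) := by
  refine (conjChain_smul _ c).trans ?_
  rw [conjRing_of]
  rfl

lemma conjChain_conjChain {i : ℕ} (c : Chain Γ ι κ i) : conjChain i (conjChain i c) = c := by
  induction c using Finsupp.induction_linear with
  | zero => simp
  | add c d hc hd => rw [map_add, map_add, hc, hd]
  | single α y => rw [conjChain_single, conjChain_single, conjRing_conjRing]

lemma conjChain_smul_complex {i : ℕ} (a : ℂ) (c : Chain Γ ι κ i) :
    conjChain i (a • c) = (starRingEnd ℂ) a • conjChain i c := by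
  have h : a • c = algebraMap ℂ (MonoidAlgebra ℂ Γ) a • c := (algebraMap_smul _ a c).symm
  rw [h, conjChain_smul, ← algebraMap_smul (MonoidAlgebra ℂ Γ) ((starRingEnd ℂ) a)]
  congr 1
  simp [conjRing]

variable {V : Type*} [NormedAddCommGroup V] [InnerProductSpace ℂ V] {ρ : Representation ℂ Γ V}
  (hρ : ∀ g x y, inner ℂ (ρ g x) (ρ g y) = inner ℂ x y) {H : Subgroup Γ}

/-- The functional on `C_i ⊗_ℂ V` given by a cochain and the inner product. -/
def pairingAux {i : ℕ} (f : Cochain ι κ ρ H i) : TensorChain Γ ι κ V i →ₗ[ℂ] ℂ :=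
  -- The inner product is conjugate linear in its first argument; conjugating the chain restores
  -- linearity in c.
  TensorProduct.lift <| LinearMap.mk₂ ℂ (fun c v => inner ℂ (f.1 (conjChain i c)) v)
    (fun c d v => by rw [map_add, map_add, inner_add_left])
    (fun a c v => by
      rw [conjChain_smul_complex, map_smul, inner_smul_left, Complex.conj_conj, smul_eq_mul])
    (fun c v w => inner_add_right _ _ _)
    (fun a c v => inner_smul_right _ _ _)

lemma pairingAux_tmul {i : ℕ} (f : Cochain ι κ ρ H i) (c : Chain Γ ι κ i) (v : V) :
    pairingAux f (tmul c v) = inner ℂ (f.1 (conjChain i c)) v := rfl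

/-- The functional on the twisted chains given by a cochain and the inner product. -/
def pairing {i : ℕ} (f : Cochain ι κ ρ H i) : TwChain ι κ ρ H i →ₗ[ℂ] ℂ :=
  (coinvRel ι κ ρ H i).liftQ (pairingAux f) <| by
    rw [coinvRel, Submodule.span_le]
    rintro _ ⟨h, hh, c, v, rfl⟩
    change pairingAux f _ = 0
    rw [map_sub, pairingAux_tmul, pairingAux_tmul, conjChain_act, f.2 h hh, hρ, sub_self]

lemma pairing_mk {i : ℕ} (f : Cochain ι κ ρ H i) (c : Chain Γ ι κ i) (v : V) :
    pairing hρ f (Submodule.Quotient.mk (tmul c v)) = inner ℂ (f.1 (conjChain i c)) v := rfl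

lemma twChain_hom_ext {i : ℕ} {A B : TwChain ι κ ρ H i →ₗ[ℂ] ℂ}
    (h : ∀ c v, A (Submodule.Quotient.mk (tmul c v)) = B (Submodule.Quotient.mk (tmul c v))) :
    A = B := by
  refine Submodule.linearMap_qext _ ?_
  exact TensorProduct.ext' h

lemma pairing_add {i : ℕ} (f g : Cochain ι κ ρ H i) :
    pairing hρ (f + g) = pairing hρ f + pairing hρ g :=
  twChain_hom_ext fun c v => inner_add_left (f.1 (conjChain i c)) (g.1 (conjChain i c)) v

lemma pairing_smul {i : ℕ} (a : ℂ) (f : Cochain ι κ ρ H i) :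
    pairing hρ (a • f) = (starRingEnd ℂ) a • pairing hρ f :=
  twChain_hom_ext fun c v => inner_smul_left (f.1 (conjChain i c)) v a

lemma pairing_injective {i : ℕ} :
    Function.Injective (pairing hρ : Cochain ι κ ρ H i → _) := by
  intro f g h
  refine Subtype.ext (LinearMap.ext fun c => ext_inner_right ℂ fun v => ?_)
  have := DFunLike.congr_fun h (Submodule.Quotient.mk (tmul (conjChain i c) v))
  rwa [pairing_mk, pairing_mk, conjChain_conjChain] at this

/-- Riesz representation, chain by chain: f(c) is the vector representing w ↦ L(c̄ ⊗ w), expanded in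
the orthonormal basis. Equivariance of f follows from unitarity, since L respects the relations hc ⊗
hv = c ⊗ v. -/
lemma pairing_surjective {m : ℕ} (v : OrthonormalBasis (Fin m) ℂ V) {i : ℕ} :
    Function.Surjective (pairing hρ : Cochain ι κ ρ H i → _) := by
  intro L
  let f : Chain Γ ι κ i →ₗ[ℂ] V :=
    { toFun := fun c => ∑ a, (starRingEnd ℂ)
        (L (Submodule.Quotient.mk (tmul (conjChain i c) (v a)))) • v a
      map_add' := fun c d => by
        rw [← Finset.sum_add_distrib]
        refine Finset.sum_congr rfl fun a _ => ?_
        have : (tmul (conjChain i (c + d)) (v a) : TensorChain Γ ι κ V i) =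
            tmul (conjChain i c) (v a) + tmul (conjChain i d) (v a) := by
          rw [map_add]; exact TensorProduct.add_tmul _ _ _
        rw [this, Submodule.Quotient.mk_add, map_add, map_add, add_smul]
      map_smul' := fun s c => by
        rw [Finset.smul_sum]
        refine Finset.sum_congr rfl fun a _ => ?_
        have : (tmul (conjChain i (s • c)) (v a) : TensorChain Γ ι κ V i) =
            (starRingEnd ℂ) s • tmul (conjChain i c) (v a) := by
          rw [conjChain_smul_complex]; rfl
        rw [this, Submodule.Quotient.mk_smul, map_smul, smul_eq_mul, map_mul, Complex.conj_conj,
          mul_smul, RingHom.id_apply] }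
  have hf : ∀ c w, inner ℂ (f c) w = L (Submodule.Quotient.mk (tmul (conjChain i c) w)) := by
    intro c w
    let A : V →ₗ[ℂ] ℂ := L ∘ₗ (coinvRel ι κ ρ H i).mkQ ∘ₗ
      (TensorProduct.mk ℂ (Chain Γ ι κ i) V (conjChain i c))
    change inner ℂ (∑ a, (starRingEnd ℂ) (A (v a)) • v a) w = A w
    conv_rhs => rw [← v.sum_repr' w, map_sum]
    rw [sum_inner]
    refine Finset.sum_congr rfl fun a _ => ?_
    rw [inner_smul_left, Complex.conj_conj, map_smul, smul_eq_mul, mul_comm]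
  have hfe : ∀ h ∈ H, ∀ c, f (act h i c) = ρ h (f c) := by
    intro h hh c
    refine ext_inner_right ℂ fun w => ?_
    have hw : w = ρ h (ρ h⁻¹ w) := by
      rw [← Module.End.mul_apply, ← map_mul, mul_inv_cancel, map_one]; rfl
    rw [hw, hρ, hf, hf, conjChain_act]
    congr 1
    rw [Submodule.Quotient.eq]
    exact Submodule.subset_span ⟨h, hh, _, _, rfl⟩
  refine ⟨⟨f, hfe⟩, twChain_hom_ext fun c w => ?_⟩
  refine (pairing_mk hρ _ c w).trans ((hf _ _).trans ?_)
  rw [conjChain_conjChain]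

variable [Fintype ι] [DecidableEq ι]

lemma conjChain_boundary (π : FreeGroup ι →* Γ) (r : κ → FreeGroup ι) (i : ℕ)
    (c : Chain Γ ι κ (i + 1)) :
    boundary π r i (conjChain (i + 1) c) = conjChain i (boundary π r i c) := by
  have key : ∀ α : Cell ι κ (i + 1),
      conjChain i (cellBoundary π r i α) = cellBoundary π r i α := by
    intro α
    cases α with
    | edge j =>
      rw [cellBoundary, conjChain_single, map_sub, conjRing_of, map_one]
    | face β =>
      rw [cellBoundary, map_sum]
      refine Finset.sum_congr rfl fun j _ => ?_
      rw [conjChain_single, conjRing_mapDomain, fox, conjRing_foxWord]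
  induction c using Finsupp.induction_linear with
  | zero => simp
  | add c d hc hd => rw [map_add, map_add, map_add, map_add, hc, hd]
  | single α y =>
    rw [conjChain_single]
    simp only [boundary, Finsupp.linearCombination_single, conjChain_smul, key]

lemma pairing_coboundary (π : FreeGroup ι →* Γ) (r : κ → FreeGroup ι) {i : ℕ}
    (f : Cochain ι κ ρ H i) :
    pairing hρ (coboundary π r ρ H i f) = pairing hρ f ∘ₗ twBoundary π r ρ H i := by
  refine twChain_hom_ext fun c v => ?_
  change inner ℂ (f.1 (boundary π r i (conjChain (i + 1) c))) v =
    inner ℂ (f.1 (conjChain i (boundary π r i c))) v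
  rw [conjChain_boundary]

/-- Over a field, a functional vanishing on the kernel of ∂ factors through ∂; the functional on
boundaries so obtained is again the pairing with a cochain. -/
lemma mem_coboundaries_of_pairing {m : ℕ} (v : OrthonormalBasis (Fin m) ℂ V)
    (π : FreeGroup ι →* Γ) (r : κ → FreeGroup ι) {i : ℕ} (f : Cochain ι κ ρ H i)
    (hf : ∀ z ∈ cycles π r ρ H i, pairing hρ f z = 0) : f ∈ coboundaries π r ρ H i := by
  cases i with
  | zero =>
    have h0 : pairing hρ (0 : Cochain ι κ ρ H 0) = 0 :=
      twChain_hom_ext fun c v => inner_zero_left v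
    have : f = 0 := pairing_injective hρ (by
      rw [h0]
      exact LinearMap.ext fun z => hf z trivial)
    exact this
  | succ i =>
    have h1 : pairing hρ f ∈ (LinearMap.ker (twBoundary π r ρ H i)).dualAnnihilator :=
      (Submodule.mem_dualAnnihilator _).2 hf
    rw [← LinearMap.range_dualMap_eq_dualAnnihilator_ker] at h1
    obtain ⟨L, hL⟩ := h1
    obtain ⟨b, rfl⟩ := pairing_surjective hρ v L
    exact ⟨b, pairing_injective hρ ((pairing_coboundary hρ π r b).trans hL)⟩

/-- Cohomology with coefficients in a unitary representation is finite dimensional when the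
homology is. -/
theorem finite_cohomology {m : ℕ} (v : OrthonormalBasis (Fin m) ℂ V)
    (hρ : ∀ g x y, inner ℂ (ρ g x) (ρ g y) = inner ℂ x y)
    (π : FreeGroup ι →* Γ) (r : κ → FreeGroup ι) (i : ℕ)
    [Module.Finite ℂ (Homology π r ρ H i)] : Module.Finite ℂ (Cohomology π r ρ H i) := by
  let b := Module.finBasis ℂ (Homology π r ρ H i)
  choose z hz using fun k => Submodule.Quotient.mk_surjective _ (b k)
  -- Evaluation of cocycles on cycles representing a basis of homology, conjugated so as to be
  -- linear. Its kernel consists of coboundaries, so cohomology is a quotient of a space that embeds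
  -- in the finite dimensional target.
  let Ψ : cocycles π r ρ H i →ₗ[ℂ] (Fin (Module.finrank ℂ (Homology π r ρ H i)) → ℂ) :=
    { toFun := fun f k => (starRingEnd ℂ) (pairing hρ f.1 (z k).1)
      map_add' := fun f g => by
        ext k
        have := DFunLike.congr_fun (pairing_add hρ f.1 g.1) (z k).1
        exact (congrArg (starRingEnd ℂ) this).trans (map_add _ _ _)
      map_smul' := fun a f => by
        ext k
        have := DFunLike.congr_fun (pairing_smul hρ a f.1) (z k).1
        refine (congrArg (starRingEnd ℂ) this).trans ?_
        rw [LinearMap.smul_apply, smul_eq_mul, map_mul, Complex.conj_conj]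
        rfl }
  have hle : LinearMap.ker Ψ ≤
      (coboundaries π r ρ H i).submoduleOf (cocycles π r ρ H i) := by
    rintro ⟨f, hf⟩ hfΨ
    refine mem_coboundaries_of_pairing hρ v π r f fun y hy => ?_
    have hb : ∀ w : TwChain ι κ ρ H (i + 1), pairing hρ f (twBoundary π r ρ H i w) = 0 := by
      intro w
      have h1 := DFunLike.congr_fun (pairing_coboundary hρ π r f) w
      have hf' : coboundary π r ρ H i f = 0 := hf
      have h0 : pairing hρ (0 : Cochain ι κ ρ H (i + 1)) = 0 :=
        twChain_hom_ext fun c v => inner_zero_left v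
      rw [hf', h0] at h1
      exact h1.symm
    let Q : Homology π r ρ H i →ₗ[ℂ] ℂ := Submodule.liftQ _
      (pairing hρ f ∘ₗ (cycles π r ρ H i).subtype) (by
        rintro ⟨x, hx⟩ ⟨w, hw⟩
        change pairing hρ f x = 0
        have hw' : twBoundary π r ρ H i w = x := hw
        rw [← hw']
        exact hb w)
    have hQ : Q = 0 := b.ext fun k => by
      rw [← hz k]
      have := congrFun (show Ψ ⟨f, hf⟩ = 0 from hfΨ) k
      exact (map_eq_zero (starRingEnd ℂ)).1 this
    exact DFunLike.congr_fun hQ (Submodule.Quotient.mk ⟨y, hy⟩)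
  have : Module.Finite ℂ (cocycles π r ρ H i ⧸ LinearMap.ker Ψ) :=
    Module.Finite.equiv Ψ.quotKerEquivRange.symm
  exact Module.Finite.of_surjective (Submodule.factor hle) (Submodule.factor_surjective hle)

end Duality

/-! ### The fundamental formula of Fox calculus -/

section Fox

variable {ι : Type*} [DecidableEq ι] [Fintype ι]

/-- Induction on the letters by the product rule. Words need not be reduced here, so no cancellation
has to be followed. -/
lemma sum_foxWord_mul (w : List (ι × Bool)) :
    ∑ j, foxWord j w * (MonoidAlgebra.of ℂ (FreeGroup ι) (FreeGroup.of j) - 1) =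
      MonoidAlgebra.of ℂ _ (FreeGroup.mk w) - 1 := by
  have hite : ∀ (a : ι) (c : MonoidAlgebra ℂ (FreeGroup ι)),
      ∑ j, (if a = j then c else 0) * (MonoidAlgebra.of ℂ (FreeGroup ι) (FreeGroup.of j) - 1) =
        c * (MonoidAlgebra.of ℂ (FreeGroup ι) (FreeGroup.of a) - 1) := by
    intro a c
    simp only [ite_mul, zero_mul, Finset.sum_ite_eq, Finset.mem_univ, if_true]
  induction w with
  | nil =>
    have : (FreeGroup.mk [] : FreeGroup ι) = 1 := rfl
    simp only [foxWord, zero_mul, Finset.sum_const_zero, this, map_one, sub_self]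
  | cons x w ih =>
    obtain ⟨a, b⟩ := x
    cases b
    · have h1 : (FreeGroup.mk ((a, false) :: w) : FreeGroup ι) =
          (FreeGroup.of a)⁻¹ * FreeGroup.mk w := by
        rw [FreeGroup.of, FreeGroup.inv_mk, FreeGroup.mul_mk]; rfl
      simp only [foxWord, mul_assoc, ← Finset.mul_sum, add_mul, Finset.sum_add_distrib, ih, hite]
      have h2 : MonoidAlgebra.of ℂ (FreeGroup ι) (FreeGroup.of a)⁻¹ *
          MonoidAlgebra.of ℂ (FreeGroup ι) (FreeGroup.of a) = 1 := by
        rw [← map_mul, inv_mul_cancel, map_one]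
      rw [h1, map_mul]
      simp only [mul_add, mul_sub, neg_mul, one_mul, mul_neg, mul_one, h2]
      abel
    · have h1 : (FreeGroup.mk ((a, true) :: w) : FreeGroup ι) =
          FreeGroup.of a * FreeGroup.mk w := by
        rw [FreeGroup.of, FreeGroup.mul_mk]; rfl
      simp only [foxWord, add_mul, mul_assoc, Finset.sum_add_distrib, ← Finset.mul_sum, ih, hite]
      rw [h1, map_mul]
      simp only [mul_sub, one_mul, mul_one]
      abel

lemma sum_fox_mul (w : FreeGroup ι) :
    ∑ j, fox j w * (MonoidAlgebra.of ℂ (FreeGroup ι) (FreeGroup.of j) - 1) =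
      MonoidAlgebra.of ℂ _ w - 1 := by
  simp only [fox, sum_foxWord_mul, FreeGroup.mk_toWord]

lemma sum_mapDomain_fox_mul {Γ : Type*} [Group Γ] (π : FreeGroup ι →* Γ) (w : FreeGroup ι) :
    ∑ j, MonoidAlgebra.mapDomain π (fox j w) *
      (MonoidAlgebra.of ℂ Γ (π (FreeGroup.of j)) - 1) = MonoidAlgebra.of ℂ Γ (π w) - 1 := by
  have h := congrArg (MonoidAlgebra.mapDomainRingHom ℂ π) (sum_fox_mul w)
  have hof : ∀ g, MonoidAlgebra.mapDomainRingHom ℂ π (MonoidAlgebra.of ℂ _ g) =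
      MonoidAlgebra.of ℂ Γ (π g) := fun g => by simp [MonoidAlgebra.of_apply]
  rw [map_sub, hof, map_one, map_sum] at h
  rw [← h]
  refine Finset.sum_congr rfl fun j _ => ?_
  rw [map_mul, map_sub, hof, map_one]
  rfl

end Fox

/-! ### The complex property and the absence of cells above dimension two -/

section Complex

variable {Γ : Type*} [Group Γ] {ι κ : Type} [Fintype ι] [DecidableEq ι]
variable {π : FreeGroup ι →* Γ} {r : κ → FreeGroup ι}

lemma boundary_single (i : ℕ) (α : Cell ι κ (i + 1)) (x : MonoidAlgebra ℂ Γ) :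
    boundary π r i (Finsupp.single α x) = x • cellBoundary π r i α :=
  Finsupp.linearCombination_single _ _ _

/-- By the fundamental formula, ∂∂f_α is π(r_α) - 1 times the vertex, and relators are trivial in Γ.
-/
lemma boundary_boundary (hr : ∀ α, π (r α) = 1) (c : Chain Γ ι κ 2) :
    boundary π r 0 (boundary π r 1 c) = 0 := by
  induction c using Finsupp.induction_linear with
  | zero => simp
  | add c d hc hd => rw [map_add, map_add, hc, hd, add_zero]
  | single α x =>
    cases α with
    | face α =>
      rw [boundary_single, map_smul, cellBoundary, map_sum]
      have : ∀ j, boundary π r 0 (Finsupp.single (.edge j)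
          (MonoidAlgebra.mapDomain π (fox j (r α)))) =
          Finsupp.single .vertex (MonoidAlgebra.mapDomain π (fox j (r α)) *
            (MonoidAlgebra.of ℂ Γ (π (FreeGroup.of j)) - 1)) := by
        intro j
        rw [boundary_single, cellBoundary, Finsupp.smul_single, smul_eq_mul]
      rw [Finset.sum_congr rfl fun j _ => this j, ← Finsupp.single_finsetSum,
        sum_mapDomain_fox_mul, hr, map_one, sub_self, Finsupp.single_zero, smul_zero]

variable {V : Type*} [AddCommGroup V] [Module ℂ V] {ρ : Representation ℂ Γ V} {H : Subgroup Γ}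

lemma coboundary_coboundary (hr : ∀ α, π (r α) = 1) (f : Cochain ι κ ρ H 0) :
    coboundary π r ρ H 1 (coboundary π r ρ H 0 f) = 0 := by
  refine Subtype.ext (LinearMap.ext fun c => ?_)
  change f.1 (boundary π r 0 (boundary π r 1 c)) = 0
  rw [boundary_boundary hr, map_zero]

omit [Fintype ι] [DecidableEq ι] in
lemma subsingleton_cochain {i : ℕ} (hi : 2 < i) : Subsingleton (Cochain ι κ ρ H i) := by
  have : IsEmpty (Cell ι κ i) := ⟨fun c => by cases c <;> omega⟩
  exact ⟨fun f g => Subtype.ext (LinearMap.ext fun c => by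
    rw [Subsingleton.elim c 0, map_zero, map_zero])⟩

end Complex

/-! ### Laurent matrices -/

section LaurentRep

variable {Γ : Type*} [Group Γ] {V : Type*} [NormedAddCommGroup V] [InnerProductSpace ℂ V] {m : ℕ}
variable (v : OrthonormalBasis (Fin m) ℂ V) (ρ : Representation ℂ Γ V) (ε : Γ →* Multiplicative ℤ)

/-- `g ↦ T^{ε(g)} ρ(g)`, with Laurent polynomial entries. -/
def laurentRepHom : Γ →* Matrix (Fin m) (Fin m) ℂ[T;T⁻¹] where
  toFun g := (T (Multiplicative.toAdd (ε g)) : ℂ[T;T⁻¹]) •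
    (LinearMap.toMatrix v.toBasis v.toBasis (ρ g)).map C
  map_one' := by
    have : LinearMap.toMatrix v.toBasis v.toBasis (ρ 1) = 1 := by
      rw [map_one]; exact LinearMap.toMatrix_id v.toBasis
    rw [this]
    simp [Matrix.map_one]
  map_mul' g h := by
    rw [map_mul ρ, LinearMap.toMatrix_mul, Matrix.map_mul, map_mul,
      toAdd_mul, T_add, smul_mul_smul_comm]

/-- The representation of the group ring given by `g ↦ T^{ε(g)} ρ(g)`. -/
def laurentRep : MonoidAlgebra ℂ Γ →ₐ[ℂ] Matrix (Fin m) (Fin m) ℂ[T;T⁻¹] :=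
  MonoidAlgebra.lift ℂ _ _ (laurentRepHom v ρ ε)

lemma laurentRep_of (g : Γ) : laurentRep v ρ ε (MonoidAlgebra.of ℂ Γ g) =
    (T (Multiplicative.toAdd (ε g)) : ℂ[T;T⁻¹]) •
      (LinearMap.toMatrix v.toBasis v.toBasis (ρ g)).map C := by
  rw [laurentRep, MonoidAlgebra.lift_of]
  rfl

lemma map_laurentRep_of {A : Type*} [CommRing A] [Algebra ℂ A] (u : Aˣ) (g : Γ) :
    (laurentEval u).mapMatrix (laurentRep v ρ ε (MonoidAlgebra.of ℂ Γ g)) =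
      ((u ^ (Multiplicative.toAdd (ε g)) : Aˣ) : A) •
        (LinearMap.toMatrix v.toBasis v.toBasis (ρ g)).map (algebraMap ℂ A) := by
  rw [laurentRep_of]
  ext a b
  change laurentEval u (T _ * C _) = _
  rw [map_mul, laurentEval_T, C_eq_algebraMap, AlgHom.commutes]
  rfl

lemma Phi_eq_map {ι : Type} (π : FreeGroup ι →* Γ) (x : MonoidAlgebra ℂ (FreeGroup ι)) :
    Phi π v ρ ε x = toRat.mapMatrix (laurentRep v ρ ε (MonoidAlgebra.mapDomain π x)) := by
  have h : Phi π v ρ ε = (toRat.mapMatrix.comp (laurentRep v ρ ε)).comp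
      (MonoidAlgebra.mapDomainAlgHom ℂ ℂ π) := by
    apply MonoidAlgebra.algHom_ext _ (Subsingleton.elim _ _)
    intro g
    rw [AlgHom.comp_apply, AlgHom.comp_apply, ← MonoidAlgebra.of_apply]
    have h1 : MonoidAlgebra.mapDomainAlgHom ℂ ℂ π (MonoidAlgebra.of ℂ (FreeGroup ι) g) =
        MonoidAlgebra.of ℂ Γ (π g) := by simp [MonoidAlgebra.of_apply]
    rw [h1, map_laurentRep_of, Phi, MonoidAlgebra.lift_of]
    ext a b
    simp [rhoEps, RatFunc.algebraMap_eq_C]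
  exact DFunLike.congr_fun h x

lemma evalOne_laurentRep (x : MonoidAlgebra ℂ Γ) :
    evalOne.mapMatrix (laurentRep v ρ ε x) =
      LinearMap.toMatrix v.toBasis v.toBasis (ρ.asAlgebraHom x) := by
  have h : (evalOne.mapMatrix : Matrix (Fin m) (Fin m) ℂ[T;T⁻¹] →ₐ[ℂ] _).comp
      (laurentRep v ρ ε) =
      (LinearMap.toMatrixAlgEquiv v.toBasis).toAlgHom.comp ρ.asAlgebraHom := by
    apply MonoidAlgebra.algHom_ext _ (Subsingleton.elim _ _)
    intro g
    rw [AlgHom.comp_apply, AlgHom.comp_apply, ← MonoidAlgebra.of_apply, map_laurentRep_of,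
      Representation.asAlgebraHom_of]
    ext a b
    simp [LinearMap.toMatrixAlgEquiv_apply, LinearMap.toMatrix_apply]
  exact DFunLike.congr_fun h x

/-- If the determinant vanished, it would vanish at T = 2, giving y ≠ 0 with 2^{ε(g)} ρ(g) y = y. As
ρ(g) preserves norms, this forces ε(g) = 0. -/
lemma det_laurentRep_of_sub_one_ne_zero (hρ : ∀ g x y, inner ℂ (ρ g x) (ρ g y) = inner ℂ x y)
    {g : Γ} (hg : ε g ≠ 1) : (laurentRep v ρ ε (MonoidAlgebra.of ℂ Γ g - 1)).det ≠ 0 := by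
  intro h0
  have h1 := congrArg (laurentEval (Units.mk0 (2 : ℂ) two_ne_zero)) h0
  rw [AlgHom.map_det, map_sub, map_sub, map_one, map_one, map_zero, map_laurentRep_of] at h1
  obtain ⟨x, hx, hx'⟩ := Matrix.exists_mulVec_eq_zero_iff.2 h1
  rw [Matrix.sub_mulVec, Matrix.one_mulVec, sub_eq_zero, Algebra.algebraMap_self,
    Matrix.smul_mulVec] at hx'
  set e := Multiplicative.toAdd (ε g) with he
  set y := v.toBasis.equivFun.symm x with hy
  have hxy : v.toBasis.repr y = x := by
    ext a
    rw [← Module.Basis.equivFun_apply, hy, LinearEquiv.apply_symm_apply]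
  have hyg : ((2 : ℂ) ^ e) • ρ g y = y := by
    refine v.toBasis.equivFun.injective ?_
    rw [map_smul, Module.Basis.equivFun_apply, Module.Basis.equivFun_apply,
      ← LinearMap.toMatrix_mulVec_repr v.toBasis v.toBasis, hxy]
    simpa using hx'
  have hn : ‖ρ g y‖ = ‖y‖ := by
    have := hρ g y y
    rw [inner_self_eq_norm_sq_to_K, inner_self_eq_norm_sq_to_K] at this
    have h2 : ‖ρ g y‖ ^ 2 = ‖y‖ ^ 2 := by exact_mod_cast this
    exact (pow_left_inj₀ (norm_nonneg _) (norm_nonneg _) two_ne_zero).1 h2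
  have hy0 : y ≠ 0 := by
    rw [hy]
    exact (LinearEquiv.map_ne_zero_iff _).2 hx
  have h2 := congrArg norm hyg
  rw [norm_smul, hn, norm_zpow] at h2
  have h3 : ‖(2 : ℂ)‖ ^ e = 1 := mul_right_cancel₀ (norm_ne_zero_iff.2 hy0) (by rw [h2, one_mul])
  rw [Complex.norm_ofNat] at h3
  have h4 : e = 0 := (zpow_eq_one_iff_right₀ (by norm_num) (by norm_num)).1 h3
  exact hg (toAdd_eq_zero.1 h4)

end LaurentRep

/-! ### Cochains of the infinite cyclic covering as sequences -/

section Coordinates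

variable {Γ : Type*} [Group Γ] {ι κ : Type}
variable {V : Type*} [NormedAddCommGroup V] [InnerProductSpace ℂ V] {m : ℕ}
variable (v : OrthonormalBasis (Fin m) ℂ V) {ρ : Representation ℂ Γ V} {ε : Γ →* Multiplicative ℤ}

/-- The `k`-th term of a sequence of vectors given by its coordinates. -/
def seqVec (k : ℤ) (z : Fin m → Seq) : V := v.toBasis.equivFun.symm fun a => z a k

lemma seqVec_add (k : ℤ) (z z' : Fin m → Seq) :
    seqVec v k (z + z') = seqVec v k z + seqVec v k z' :=
  map_add v.toBasis.equivFun.symm (fun a => z a k) (fun a => z' a k)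

lemma seqVec_smul (k : ℤ) (s : ℂ) (z : Fin m → Seq) : seqVec v k (s • z) = s • seqVec v k z :=
  map_smul v.toBasis.equivFun.symm s (fun a => z a k)

lemma seqVec_zero (k : ℤ) : seqVec v k (0 : Fin m → Seq) = 0 :=
  map_zero v.toBasis.equivFun.symm

lemma seqVec_ext {z z' : Fin m → Seq} (h : ∀ k, seqVec v k z = seqVec v k z') : z = z' := by
  funext a k
  exact congrFun (v.toBasis.equivFun.symm.injective (h k)) a

lemma seqVec_T_smul (k e : ℤ) (z : Fin m → Seq) :
    seqVec v k ((T e : ℂ[T;T⁻¹]) • z) = seqVec v (k + e) z := by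
  simp only [seqVec, Pi.smul_apply, Seq.T_smul]

lemma seqVec_laurentRep_of (g : Γ) (k : ℤ) (z : Fin m → Seq) :
    seqVec v k (matAct Seq (laurentRep v ρ ε (MonoidAlgebra.of ℂ Γ g)) z) =
      ρ g (seqVec v (k + Multiplicative.toAdd (ε g)) z) := by
  have h1 : matAct Seq (laurentRep v ρ ε (MonoidAlgebra.of ℂ Γ g)) z =
      (T (Multiplicative.toAdd (ε g)) : ℂ[T;T⁻¹]) •
        matAct Seq ((LinearMap.toMatrix v.toBasis v.toBasis (ρ g)).map C) z := by
    ext a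
    rw [laurentRep_of, Pi.smul_apply, matAct_apply, matAct_apply, Finset.smul_sum]
    simp only [Matrix.smul_apply, smul_eq_mul, mul_smul]
  rw [h1, seqVec_T_smul]
  set l := k + Multiplicative.toAdd (ε g)
  refine v.toBasis.equivFun.injective ?_
  rw [seqVec, LinearEquiv.apply_symm_apply]
  funext a
  have h2 : ∀ b, v.toBasis.repr (seqVec v l z) b = z b l := fun b => by
    rw [← Module.Basis.equivFun_apply, seqVec, LinearEquiv.apply_symm_apply]
  rw [Module.Basis.equivFun_apply, ← LinearMap.toMatrix_mulVec_repr v.toBasis v.toBasis,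
    matAct_apply]
  simp only [Matrix.mulVec, dotProduct, h2, Matrix.map_apply, Seq.C_smul]
  exact Finset.sum_apply _ _ _

/-- A cochain of the infinite cyclic covering as a sequence: the terms are the values of its
translates on the cells. -/
def cochainSeq (t : Γ) {i : ℕ} (f : Cochain ι κ ρ ε.ker i) (α : Cell ι κ i) : Fin m → Seq :=
  fun a => Seq.mk fun k =>
    v.toBasis.equivFun (ρ (t ^ (-k)) (f.1 (act (t ^ k) i (Finsupp.single α 1)))) a

variable {t : Γ} {i : ℕ}

lemma seqVec_cochainSeq (f : Cochain ι κ ρ ε.ker i) (α : Cell ι κ i) (k : ℤ) :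
    seqVec v k (cochainSeq v t f α) = ρ (t ^ (-k)) (f.1 (act (t ^ k) i (Finsupp.single α 1))) :=
  v.toBasis.equivFun.symm_apply_apply _

lemma cochainSeq_add (f g : Cochain ι κ ρ ε.ker i) (α : Cell ι κ i) :
    cochainSeq v t (f + g) α = cochainSeq v t f α + cochainSeq v t g α := by
  refine seqVec_ext v fun k => ?_
  rw [seqVec_add]
  simp only [seqVec_cochainSeq]
  exact map_add (ρ (t ^ (-k))) _ _

lemma cochainSeq_smul (s : ℂ) (f : Cochain ι κ ρ ε.ker i) (α : Cell ι κ i) :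
    cochainSeq v t (s • f) α = s • cochainSeq v t f α := by
  refine seqVec_ext v fun k => ?_
  rw [seqVec_smul]
  simp only [seqVec_cochainSeq]
  exact map_smul (ρ (t ^ (-k))) _ _

lemma cochainSeq_sub (f g : Cochain ι κ ρ ε.ker i) (α : Cell ι κ i) :
    cochainSeq v t (f - g) α = cochainSeq v t f α - cochainSeq v t g α := by
  rw [sub_eq_add_neg, ← neg_one_smul ℂ g, cochainSeq_add, cochainSeq_smul, neg_one_smul,
    sub_eq_add_neg]

lemma act_single (g : Γ) (α : Cell ι κ i) (x : MonoidAlgebra ℂ Γ) :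
    act g i (Finsupp.single α x) = Finsupp.single α (MonoidAlgebra.of ℂ Γ g * x) :=
  Finsupp.smul_single _ _ _

lemma rho_mul_apply (g h : Γ) (x : V) : ρ (g * h) x = ρ g (ρ h x) := by
  rw [map_mul]; rfl

/-- This is what turns coboundaries into Laurent matrices: the coefficient x of a cell may be moved
from the chain to the sequence, where it acts through T^{ε(g)}ρ(g). -/
lemma seqVec_matAct_cochainSeq (ht : ε t = Multiplicative.ofAdd 1) (f : Cochain ι κ ρ ε.ker i)
    (α : Cell ι κ i) (x : MonoidAlgebra ℂ Γ) (k : ℤ) :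
    seqVec v k (matAct Seq (laurentRep v ρ ε x) (cochainSeq v t f α)) =
      ρ (t ^ (-k)) (f.1 (act (t ^ k) i (Finsupp.single α x))) := by
  induction x using MonoidAlgebra.induction_linear with
  | zero => rw [map_zero, matAct_zero, seqVec_zero, Finsupp.single_zero, map_zero, map_zero, map_zero]
  | add x y hx hy =>
    rw [map_add, matAct_add, seqVec_add, hx, hy, Finsupp.single_add, map_add, map_add, map_add]
  | single g s =>
    have hs : MonoidAlgebra.single g s = s • MonoidAlgebra.of ℂ Γ g := by
      simp [MonoidAlgebra.of_apply]
    have h1 : matAct Seq (laurentRep v ρ ε (s • MonoidAlgebra.of ℂ Γ g)) (cochainSeq v t f α) =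
        s • matAct Seq (laurentRep v ρ ε (MonoidAlgebra.of ℂ Γ g)) (cochainSeq v t f α) := by
      ext a : 1
      rw [map_smul, Pi.smul_apply, matAct_apply, matAct_apply, Finset.smul_sum]
      simp only [Matrix.smul_apply, smul_assoc]
    rw [hs, h1, seqVec_smul, seqVec_laurentRep_of, seqVec_cochainSeq, ← Finsupp.smul_single,
      map_smul, map_smul, map_smul]
    congr 1
    set l := k + Multiplicative.toAdd (ε g) with hl
    -- Write t^k g = h t^l with l = k + ε(g). Then h lies in the kernel of ε, so f commutes with it,
    -- and t^{-k} h = g t^{-l}.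
    have hh : t ^ k * g * t ^ (-l) ∈ ε.ker := by
      rw [MonoidHom.mem_ker, map_mul, map_mul, map_zpow, map_zpow, ht]
      refine Multiplicative.toAdd.injective ?_
      simp [hl]
    have h2 : act (t ^ k) i (Finsupp.single α (MonoidAlgebra.of ℂ Γ g)) =
        act (t ^ k * g * t ^ (-l)) i (act (t ^ l) i (Finsupp.single α 1)) := by
      rw [← act_mul, act_single, act_single, mul_one, ← map_mul]
      congr 2
      rw [mul_assoc, ← zpow_add]; simp
    rw [h2, f.2 _ hh, ← rho_mul_apply, ← rho_mul_apply]
    congr 2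
    simp only [mul_assoc, zpow_neg, inv_mul_cancel_left]

lemma cochain_ext (ht : ε t = Multiplicative.ofAdd 1) {f g : Cochain ι κ ρ ε.ker i}
    (h : ∀ α, cochainSeq v t f α = cochainSeq v t g α) : f = g := by
  refine Subtype.ext (Finsupp.lhom_ext fun α x => ?_)
  have h1 := seqVec_matAct_cochainSeq v ht f α x 0
  have h2 := seqVec_matAct_cochainSeq v ht g α x 0
  have h3 : ∀ c : Chain Γ ι κ i, act (t ^ (0 : ℤ)) i c = c := fun c => by
    rw [zpow_zero]; change MonoidAlgebra.of ℂ Γ 1 • c = c; rw [map_one, one_smul]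
  rw [h3, neg_zero, zpow_zero, map_one, Module.End.one_apply] at h1 h2
  rw [← h1, ← h2, h α]

/-- With `cochain_ext`, this identifies cochains with arbitrary families of sequences. The value on
xe_α is prescribed as the 0-th term of the sequence transformed by x; elements of the kernel of ε do
not shift indices, whence equivariance. -/
lemma exists_cochain (t : Γ) (ht : ε t = Multiplicative.ofAdd 1) (z : Cell ι κ i → Fin m → Seq) :
    ∃ f : Cochain ι κ ρ ε.ker i, ∀ α, cochainSeq v t f α = z α := by
  let F : Cell ι κ i → MonoidAlgebra ℂ Γ →ₗ[ℂ] V := fun α =>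
    { toFun := fun x => seqVec v 0 (matAct Seq (laurentRep v ρ ε x) (z α))
      map_add' := fun x y => by rw [map_add, matAct_add, seqVec_add]
      map_smul' := fun s x => by
        rw [RingHom.id_apply, ← seqVec_smul]
        congr 1
        ext a : 1
        rw [map_smul, Pi.smul_apply, matAct_apply, matAct_apply, Finset.smul_sum]
        simp only [Matrix.smul_apply, smul_assoc] }
  let f : Chain Γ ι κ i →ₗ[ℂ] V := Finsupp.lsum ℂ F
  have hfs : ∀ α x, f (Finsupp.single α x) = seqVec v 0 (matAct Seq (laurentRep v ρ ε x) (z α)) :=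
    fun α x => by rw [Finsupp.lsum_single]; rfl
  have hf : ∀ h ∈ ε.ker, ∀ c, f (act h i c) = ρ h (f c) := by
    intro h hh c
    induction c using Finsupp.induction_linear with
    | zero => rw [map_zero, map_zero, map_zero]
    | add c d hc hd => rw [map_add, map_add, map_add, map_add, hc, hd]
    | single α x =>
      rw [act_single, hfs, hfs, map_mul, matAct_mul, seqVec_laurentRep_of,
        MonoidHom.mem_ker.1 hh, toAdd_one, add_zero]
  refine ⟨⟨f, hf⟩, fun α => seqVec_ext v fun k => ?_⟩
  refine (seqVec_cochainSeq v _ α k).trans ?_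
  change ρ (t ^ (-k)) (f (act (t ^ k) i (Finsupp.single α 1))) = _
  rw [act_single, hfs, mul_one, seqVec_laurentRep_of, map_zpow ε t k, ht, ← rho_mul_apply, ← zpow_add,
    neg_add_cancel, zpow_zero, map_one, Module.End.one_apply, zero_add]
  simp

lemma cochainSeq_deck (f : Cochain ι κ ρ ε.ker i) (α : Cell ι κ i) :
    cochainSeq v t (deckCochain ρ ε.ker t i f) α = (T 1 : ℂ[T;T⁻¹]) • cochainSeq v t f α := by
  refine seqVec_ext v fun k => ?_
  rw [seqVec_T_smul, seqVec_cochainSeq, seqVec_cochainSeq]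
  change ρ (t ^ (-k)) (ρ t⁻¹ (f.1 (act t i (act (t ^ k) i (Finsupp.single α 1))))) = _
  rw [← rho_mul_apply, ← act_mul]
  congr 3
  · group
  · group

lemma cochainSeq_aeval_deck (p : Polynomial ℂ) (f : Cochain ι κ ρ ε.ker i) (α : Cell ι κ i) :
    cochainSeq v t (Polynomial.aeval (deckCochain ρ ε.ker t i) p f) α =
      Polynomial.toLaurent p • cochainSeq v t f α := by
  induction p using Polynomial.induction_on' generalizing f with
  | add p q hp hq =>
    rw [map_add, LinearMap.add_apply, cochainSeq_add, hp, hq, map_add, add_smul]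
  | monomial k s =>
    rw [← Polynomial.C_mul_X_pow_eq_monomial]
    induction k generalizing f with
    | zero =>
      rw [pow_zero, mul_one, Polynomial.aeval_C, Polynomial.toLaurent_C, C_eq_algebraMap,
        algebraMap_smul, ← cochainSeq_smul]
      rfl
    | succ k ih =>
      rw [pow_succ, ← mul_assoc, map_mul, Module.End.mul_apply, ih, Polynomial.aeval_X,
        cochainSeq_deck, map_mul _ _ Polynomial.X, mul_smul, Polynomial.toLaurent_X]

/-- In coordinates a polynomial in the covering transformation is multiplication by the same
polynomial in T, and `Seq` is divisible. -/
lemma aeval_deck_surjective (v : OrthonormalBasis (Fin m) ℂ V)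
    (ht : ε t = Multiplicative.ofAdd 1) {p : Polynomial ℂ} (hp : p ≠ 0) :
    Function.Surjective (Polynomial.aeval (deckCochain (ι := ι) (κ := κ) ρ ε.ker t i) p) := by
  intro g
  choose z hz using fun (α : Cell ι κ i) (a : Fin m) =>
    Seq.isDivisible _ (Polynomial.toLaurent_ne_zero.2 hp) (cochainSeq v t g α a)
  obtain ⟨f, hf⟩ := exists_cochain (ρ := ρ) v t ht z
  refine ⟨f, cochain_ext v ht fun α => ?_⟩
  rw [cochainSeq_aeval_deck, hf]
  funext a
  exact hz α a

variable [Fintype ι] [DecidableEq ι] {π : FreeGroup ι →* Γ} {r : κ → FreeGroup ι}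

lemma seqVec_cochainSeq_coboundary (f : Cochain ι κ ρ ε.ker i) (α : Cell ι κ (i + 1)) (k : ℤ) :
    seqVec v k (cochainSeq v t (coboundary π r ρ ε.ker i f) α) =
      ρ (t ^ (-k)) (f.1 (act (t ^ k) i (cellBoundary π r i α))) := by
  rw [seqVec_cochainSeq]
  change ρ (t ^ (-k)) (f.1 (boundary π r i (act (t ^ k) (i + 1) (Finsupp.single α 1)))) = _
  rw [boundary_act, boundary_single, one_smul]

lemma cochainSeq_coboundary_edge (ht : ε t = Multiplicative.ofAdd 1)
    (f : Cochain ι κ ρ ε.ker 0) (j : ι) :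
    cochainSeq v t (coboundary π r ρ ε.ker 0 f) (.edge j) =
      matAct Seq (laurentRep v ρ ε (MonoidAlgebra.of ℂ Γ (π (FreeGroup.of j)) - 1))
        (cochainSeq v t f .vertex) := by
  refine seqVec_ext v fun k => ?_
  rw [seqVec_cochainSeq_coboundary, seqVec_matAct_cochainSeq v ht]
  rfl

lemma cochainSeq_coboundary_face (ht : ε t = Multiplicative.ofAdd 1)
    (f : Cochain ι κ ρ ε.ker 1) (α : κ) :
    cochainSeq v t (coboundary π r ρ ε.ker 1 f) (.face α) =
      ∑ j, matAct Seq (laurentRep v ρ ε (MonoidAlgebra.mapDomain π (fox j (r α))))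
        (cochainSeq v t f (.edge j)) := by
  refine seqVec_ext v fun k => ?_
  have hsum : ∀ g : ι → Fin m → Seq, seqVec v k (∑ j, g j) = ∑ j, seqVec v k (g j) := fun g =>
    map_sum (⟨⟨seqVec v k, seqVec_zero v k⟩, seqVec_add v k⟩ : (Fin m → Seq) →+ V) g _
  rw [seqVec_cochainSeq_coboundary, hsum, cellBoundary, map_sum, map_sum, map_sum]
  exact Finset.sum_congr rfl fun j _ => (seqVec_matAct_cochainSeq v ht f _ _ k).symm

end Coordinates

lemma aeval_intertwine {M N : Type*} [AddCommGroup M] [Module ℂ M] [AddCommGroup N] [Module ℂ N]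
    {S : Module.End ℂ M} {U : Module.End ℂ N} (q : M →ₗ[ℂ] N) (h : ∀ x, q (S x) = U (q x))
    (p : Polynomial ℂ) (x : M) : q (Polynomial.aeval S p x) = Polynomial.aeval U p (q x) := by
  induction p using Polynomial.induction_on' generalizing x with
  | add p₁ p₂ h₁ h₂ =>
    rw [map_add, map_add, LinearMap.add_apply, LinearMap.add_apply, map_add, h₁, h₂]
  | monomial k s =>
    rw [← Polynomial.C_mul_X_pow_eq_monomial]
    induction k generalizing x with
    | zero =>
      rw [pow_zero, mul_one, Polynomial.aeval_C, Polynomial.aeval_C, Module.algebraMap_end_apply,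
        Module.algebraMap_end_apply, map_smul]
    | succ k ih =>
      rw [pow_succ, ← mul_assoc, map_mul _ _ Polynomial.X, map_mul _ _ Polynomial.X,
        Module.End.mul_apply, Module.End.mul_apply, ih, Polynomial.aeval_X, Polynomial.aeval_X, h]

/-! ### Cohomology classes and the vanishing of the second cohomology -/

section Cohomology

variable {Γ : Type*} [Group Γ] {ι κ : Type} [Fintype ι] [DecidableEq ι]
variable {V : Type*} [AddCommGroup V] [Module ℂ V] {ρ : Representation ℂ Γ V}
variable {π : FreeGroup ι →* Γ} {r : κ → FreeGroup ι} {H : Subgroup Γ} {i : ℕ}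

/-- The class of a cocycle. -/
def cohClass (f : Cochain ι κ ρ H i) (hf : coboundary π r ρ H i f = 0) :
    Cohomology π r ρ H i :=
  Submodule.Quotient.mk ⟨f, hf⟩

lemma exists_cohClass (y : Cohomology π r ρ H i) : ∃ f hf, y = cohClass f hf := by
  obtain ⟨⟨f, hf⟩, rfl⟩ := Submodule.Quotient.mk_surjective _ y
  exact ⟨f, hf, rfl⟩

lemma cohClass_eq_iff {f g : Cochain ι κ ρ H (i + 1)} (hf : coboundary π r ρ H (i + 1) f = 0)
    (hg : coboundary π r ρ H (i + 1) g = 0) :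
    cohClass f hf = cohClass g hg ↔ ∃ b, coboundary π r ρ H i b = f - g := by
  rw [cohClass, cohClass, Submodule.Quotient.eq]
  exact Iff.rfl

lemma cohClass_eq_zero_iff {f : Cochain ι κ ρ H (i + 1)} (hf : coboundary π r ρ H (i + 1) f = 0) :
    cohClass f hf = 0 ↔ ∃ b, coboundary π r ρ H i b = f := by
  rw [cohClass, Submodule.Quotient.mk_eq_zero]
  exact Iff.rfl

lemma coboundary_zero_injective [Subsingleton (Cohomology π r ρ H 0)] {f : Cochain ι κ ρ H 0}
    (hf : coboundary π r ρ H 0 f = 0) : f = 0 := by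
  have h : cohClass f hf = 0 := Subsingleton.elim _ _
  rw [cohClass, Submodule.Quotient.mk_eq_zero] at h
  exact h

lemma coboundary_aeval_deck [H.Normal] (g : Γ) (p : Polynomial ℂ) (f : Cochain ι κ ρ H i) :
    coboundary π r ρ H i (Polynomial.aeval (deckCochain ρ H g i) p f) =
      Polynomial.aeval (deckCochain ρ H g (i + 1)) p (coboundary π r ρ H i f) :=
  aeval_intertwine _ (coboundary_deck π r ρ H g i) p f

lemma aeval_deck_cohClass [H.Normal] (g : Γ) (p : Polynomial ℂ) (f : Cochain ι κ ρ H i)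
    (hf : coboundary π r ρ H i f = 0) :
    Polynomial.aeval (deck π r ρ H g i) p (cohClass f hf) =
      cohClass (Polynomial.aeval (deckCochain ρ H g i) p f)
        (by rw [coboundary_aeval_deck, hf, map_zero]) := by
  let S := (deckCochain ρ H g i).restrict (deck_cocycles π r ρ H g i)
  have h1 : Polynomial.aeval S p ⟨f, hf⟩ = ⟨Polynomial.aeval (deckCochain ρ H g i) p f,
      (by rw [cocycles, LinearMap.mem_ker, coboundary_aeval_deck, hf, map_zero])⟩ :=
    Subtype.ext (aeval_intertwine (S := S) (U := deckCochain ρ H g i)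
      (cocycles π r ρ H i).subtype (fun _ => rfl) p ⟨f, hf⟩)
  have h2 := aeval_intertwine (S := S) (U := deck π r ρ H g i)
    ((coboundaries π r ρ H i).submoduleOf (cocycles π r ρ H i)).mkQ (fun _ => rfl) p ⟨f, hf⟩
  rw [h1] at h2
  exact h2.symm

lemma mem_maxGenEigenspace_one_iff {M : Type*} [AddCommGroup M] [Module ℂ M]
    (S : Module.End ℂ M) (x : M) : x ∈ S.maxGenEigenspace 1 ↔
      ∃ k : ℕ, Polynomial.aeval S ((Polynomial.X - 1 : Polynomial ℂ) ^ k) x = 0 := by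
  rw [Module.End.mem_maxGenEigenspace]
  simp

/-- The second cohomology vanishes if it is finite dimensional, since all nonzero polynomials in
the covering transformation act surjectively. -/
lemma subsingleton_cohomology_two {V : Type*} [NormedAddCommGroup V] [InnerProductSpace ℂ V]
    {ρ : Representation ℂ Γ V} {m : ℕ} (v : OrthonormalBasis (Fin m) ℂ V)
    {ε : Γ →* Multiplicative ℤ} {t : Γ} (ht : ε t = Multiplicative.ofAdd 1)
    [Module.Finite ℂ (Cohomology π r ρ ε.ker 2)] : Subsingleton (Cohomology π r ρ ε.ker 2) := by
  refine subsingleton_of_forall_eq 0 fun y => ?_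
  obtain ⟨f, hf, rfl⟩ := exists_cohClass y
  have h0 := LinearMap.aeval_self_charpoly (deck π r ρ ε.ker t 2)
  have hne := (LinearMap.charpoly_monic (deck π r ρ ε.ker t 2)).ne_zero
  -- Write f as χ(τ^*) g with χ the characteristic polynomial of τ^* on cohomology. There are no
  -- 3-cells, so g is a cocycle, and [f] = χ(τ^*)[g] = 0 by Cayley–Hamilton.
  obtain ⟨g, rfl⟩ := aeval_deck_surjective (κ := κ) v ht hne f
  have : Subsingleton (Cochain ι κ ρ ε.ker 3) := subsingleton_cochain (by norm_num)
  rw [← aeval_deck_cohClass t _ g (Subsingleton.elim _ _), h0, LinearMap.zero_apply]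

end Cohomology

/-! ### The Wang sequence: H¹(X,ρ) as the 1-eigenspace -/

section Wang

variable {Γ : Type*} [Group Γ] {ι κ : Type}
variable {V : Type*} [NormedAddCommGroup V] [InnerProductSpace ℂ V] {ρ : Representation ℂ Γ V}
variable {ε : Γ →* Multiplicative ℤ} {i : ℕ}

/-- Pull-back of cochains to a covering. -/
def pullCochain (ε : Γ →* Multiplicative ℤ) (i : ℕ) :
    Cochain ι κ ρ (⊤ : Subgroup Γ) i →ₗ[ℂ] Cochain ι κ ρ ε.ker i where
  toFun f := ⟨f.1, fun h _ c => f.2 h trivial c⟩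
  map_add' _ _ := rfl
  map_smul' _ _ := rfl

lemma pullCochain_injective :
    Function.Injective (pullCochain ε i : Cochain ι κ ρ (⊤ : Subgroup Γ) i → _) :=
  fun f g h => Subtype.ext (by
    have h1 : (pullCochain ε i f).1 = (pullCochain ε i g).1 := by rw [h]
    exact h1)

lemma deckCochain_pullCochain (t : Γ) (f : Cochain ι κ ρ (⊤ : Subgroup Γ) i) :
    deckCochain ρ ε.ker t i (pullCochain ε i f) = pullCochain ε i f := by
  refine Subtype.ext (LinearMap.ext fun c => ?_)
  change ρ t⁻¹ (f.1 (act t i c)) = f.1 c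
  rw [f.2 t trivial, ← rho_mul_apply, inv_mul_cancel, map_one]
  rfl

/-- The elements under which g is equivariant form a subgroup. It contains the kernel of ε and, by
invariance, t; these generate Γ. -/
lemma exists_pullCochain {t : Γ} (ht : ε t = Multiplicative.ofAdd 1) (g : Cochain ι κ ρ ε.ker i)
    (hg : deckCochain ρ ε.ker t i g = g) : ∃ f, pullCochain ε i f = g := by
  let G : Subgroup Γ :=
    { carrier := {h | ∀ c, g.1 (act h i c) = ρ h (g.1 c)}
      one_mem' := fun c => by
        have : act (1 : Γ) i c = c := by
          change MonoidAlgebra.of ℂ Γ 1 • c = c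
          rw [map_one, one_smul]
        rw [this, map_one]
        rfl
      mul_mem' := fun {a b} ha hb c => by
        rw [act_mul, ha, hb, rho_mul_apply]
      inv_mem' := fun {a} ha c => by
        have h1 := ha (act a⁻¹ i c)
        have h2 : act a i (act a⁻¹ i c) = c := by
          rw [← act_mul, mul_inv_cancel]
          change MonoidAlgebra.of ℂ Γ 1 • c = c
          rw [map_one, one_smul]
        rw [h2] at h1
        rw [h1, ← rho_mul_apply, inv_mul_cancel, map_one]
        rfl }
  have htG : t ∈ G := fun c => by
    have h1 : ρ t⁻¹ (g.1 (act t i c)) = g.1 c := DFunLike.congr_fun (congrArg Subtype.val hg) c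
    rw [← h1, ← rho_mul_apply, mul_inv_cancel, map_one]
    rfl
  have hkG : ∀ h ∈ ε.ker, h ∈ G := fun h hh c => g.2 h hh c
  refine ⟨⟨g.1, fun h _ => ?_⟩, rfl⟩
  set e := Multiplicative.toAdd (ε h) with he
  have h1 : h * t ^ (-e) ∈ ε.ker := by
    rw [MonoidHom.mem_ker, map_mul, map_zpow, ht]
    refine Multiplicative.toAdd.injective ?_
    simp [he]
  have h2 := G.mul_mem (hkG _ h1) (G.zpow_mem htG e)
  rw [mul_assoc, ← zpow_add, neg_add_cancel, zpow_zero, mul_one] at h2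
  exact h2

variable [Fintype ι] [DecidableEq ι] {π : FreeGroup ι →* Γ} {r : κ → FreeGroup ι}

lemma coboundary_pullCochain (f : Cochain ι κ ρ (⊤ : Subgroup Γ) i) :
    coboundary π r ρ ε.ker i (pullCochain ε i f) =
      pullCochain ε (i + 1) (coboundary π r ρ ⊤ i f) := rfl

/-- Part of the Wang sequence of the infinite cyclic covering. -/
theorem finrank_cohomology_one_eq {m : ℕ} (v : OrthonormalBasis (Fin m) ℂ V) {t : Γ}
    (ht : ε t = Multiplicative.ofAdd 1) [Subsingleton (Cohomology π r ρ ε.ker 0)]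
    (hr : ∀ α, π (r α) = 1) :
    Module.finrank ℂ (Cohomology π r ρ ⊤ 1) =
      Module.finrank ℂ ((deck π r ρ ε.ker t 1).eigenspace 1) := by
  let P : Cohomology π r ρ ⊤ 1 →ₗ[ℂ] Cohomology π r ρ ε.ker 1 :=
    Submodule.mapQ _ _ ((pullCochain ε 1).restrict (p := cocycles π r ρ ⊤ 1)
      (q := cocycles π r ρ ε.ker 1) (fun f hf => by
        have hf' : coboundary π r ρ ⊤ 1 f = 0 := hf
        change coboundary π r ρ ε.ker 1 (pullCochain ε 1 f) = 0
        rw [coboundary_pullCochain, hf', map_zero])) (by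
      rintro ⟨f, hf⟩ ⟨b, hb⟩
      exact ⟨pullCochain ε 0 b, (coboundary_pullCochain b).trans (congrArg _ hb)⟩)
  have hP : ∀ f hf, P (cohClass f hf) = cohClass (pullCochain ε 1 f)
      (by rw [coboundary_pullCochain, hf, map_zero]) := fun f hf => rfl
  have hdeck : ∀ f hf, deck π r ρ ε.ker t 1 (cohClass f hf) = cohClass (deckCochain ρ ε.ker t 1 f)
      (by rw [coboundary_deck, hf, map_zero]) := fun f hf => rfl
  have hinj : Function.Injective P := by
    rw [injective_iff_map_eq_zero]
    intro y hy
    obtain ⟨f, hf, rfl⟩ := exists_cohClass y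
    rw [hP, cohClass_eq_zero_iff] at hy
    obtain ⟨b, hb⟩ := hy
    -- If the pull-back of f is db, then τ^*b - b is a 0-cocycle, hence zero; so b is invariant and
    -- descends to X.
    have h1 : coboundary π r ρ ε.ker 0 (deckCochain ρ ε.ker t 0 b - b) = 0 := by
      rw [map_sub, coboundary_deck, hb, deckCochain_pullCochain, sub_self]
    obtain ⟨b', rfl⟩ := exists_pullCochain ht b (sub_eq_zero.1 (coboundary_zero_injective h1))
    rw [cohClass_eq_zero_iff]
    exact ⟨b', pullCochain_injective hb⟩
  have hrange : LinearMap.range P = (deck π r ρ ε.ker t 1).eigenspace 1 := by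
    apply le_antisymm
    · rintro _ ⟨y, rfl⟩
      obtain ⟨f, hf, rfl⟩ := exists_cohClass y
      rw [Module.End.mem_eigenspace_iff, one_smul, hP, hdeck]
      congr 1
      exact deckCochain_pullCochain t f
    · intro y hy
      obtain ⟨f, hf, rfl⟩ := exists_cohClass y
      rw [Module.End.mem_eigenspace_iff, one_smul, hdeck, cohClass_eq_iff] at hy
      obtain ⟨b, hb⟩ := hy
      -- From τ^*f - f = db, solve (τ^* - 1)b' = b. Then f - db' is an invariant cocycle in the same
      -- class, and it descends to X.
      obtain ⟨b', hb'⟩ := aeval_deck_surjective (κ := κ) (ρ := ρ) v ht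
        (Polynomial.X_sub_C_ne_zero (1 : ℂ)) b
      have hb'' : deckCochain ρ ε.ker t 0 b' - b' = b := by
        rw [← hb']
        simp
      obtain ⟨g, hg⟩ := exists_pullCochain ht (f - coboundary π r ρ ε.ker 0 b') (by
        rw [map_sub, ← coboundary_deck, sub_eq_sub_iff_sub_eq_sub, ← map_sub, hb'', hb])
      have hgc : coboundary π r ρ ⊤ 1 g = 0 := by
        refine pullCochain_injective (ε := ε) ?_
        rw [← coboundary_pullCochain, hg, map_sub, hf, coboundary_coboundary hr, map_zero, sub_zero]
      refine ⟨cohClass g hgc, ?_⟩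
      rw [hP, cohClass_eq_iff]
      refine ⟨-b', ?_⟩
      rw [hg, map_neg]
      abel
  rw [← hrange, LinearMap.finrank_range_of_inj hinj]

end Wang

lemma detPoly_of_subsingleton {M : Type*} [AddCommGroup M] [Module ℂ M] [Subsingleton M]
    (S : Module.End ℂ M) : detPoly S = 1 := by
  have : Module.Finite ℂ M := inferInstance
  rw [detPoly, dif_pos this]
  refine Polynomial.eq_one_of_monic_natDegree_zero (LinearMap.charpoly_monic S) ?_
  rw [LinearMap.charpoly_natDegree, Module.finrank_zero_of_subsingleton]

/-! ### The twisted Alexander polynomial and the first cohomology of the infinite cyclic covering -/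

section Alexander

variable {Γ : Type*} [Group Γ] {n m : ℕ}
variable {V : Type*} [NormedAddCommGroup V] [InnerProductSpace ℂ V]
variable (v : OrthonormalBasis (Fin m) ℂ V) (ρ : Representation ℂ Γ V) (ε : Γ →* Multiplicative ℤ)
variable (π : FreeGroup (Fin (n + 1)) →* Γ) (r : Fin n → FreeGroup (Fin (n + 1)))

/-- The Laurent matrix of the boundary of an edge. -/
abbrev edgeMatrix (l : Fin (n + 1)) : Matrix (Fin m) (Fin m) ℂ[T;T⁻¹] :=
  laurentRep v ρ ε (MonoidAlgebra.of ℂ Γ (π (FreeGroup.of l)) - 1)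

/-- The matrix of Fox derivatives with one generator left out, over Laurent polynomials. -/
def foxMatrix (j : Fin (n + 1)) : Matrix (Fin n × Fin m) (Fin n × Fin m) ℂ[T;T⁻¹] :=
  Matrix.of fun a b =>
    laurentRep v ρ ε (MonoidAlgebra.mapDomain π (fox (j.succAbove b.1) (r a.1))) a.2 b.2

/-- The matrices of all edges but one. -/
def edgeRestMatrix (j : Fin (n + 1)) : Matrix (Fin n × Fin m) (Fin m) ℂ[T;T⁻¹] :=
  Matrix.of fun a b => edgeMatrix v ρ ε π (j.succAbove a.1) a.2 b

/-- Numerator and denominator are already Laurent polynomials; only in this form can their matrices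
act on `Seq`. -/
lemma twistedAlexander_eq (j : Fin (n + 1)) : twistedAlexander π r v ρ ε j =
    toRat (foxMatrix v ρ ε π r j).det / toRat (edgeMatrix v ρ ε π j).det := by
  rw [twistedAlexander, AlgHom.map_det, AlgHom.map_det]
  congr 2
  · ext a b
    rw [Matrix.of_apply, Phi_eq_map]
    rfl
  · rw [Phi_eq_map]
    congr 2
    have h := map_sub (MonoidAlgebra.mapDomainRingHom ℂ π)
      (MonoidAlgebra.of ℂ (FreeGroup (Fin (n + 1))) (FreeGroup.of j)) 1
    rw [map_one] at h
    refine h.trans ?_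
    congr 1
    simp [MonoidAlgebra.of_apply]

variable {v ρ ε π r} {t : Γ} (ht : ε t = Multiplicative.ofAdd 1) (j : Fin (n + 1))

/-- Sequences on all edges but the `j`-th, extended by zero. -/
def extendZero (z : Fin n × Fin m → Seq) : Cell (Fin (n + 1)) (Fin n) 1 → Fin m → Seq
  | .edge l => Fin.insertNth (α := fun _ => Fin m → Seq) j 0 (fun l' b => z (l', b)) l

lemma extendZero_self (z : Fin n × Fin m → Seq) : extendZero j z (.edge j) = 0 :=
  Fin.insertNth_apply_same _ _ _

lemma extendZero_succAbove (z : Fin n × Fin m → Seq) (l : Fin n) :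
    extendZero j z (.edge (j.succAbove l)) = fun b => z (l, b) :=
  Fin.insertNth_apply_succAbove _ _ _ _

variable (v ρ) in
/-- The cochain with given sequences on all edges but the `j`-th, where it vanishes. -/
def extendCochain (z : Fin n × Fin m → Seq) : Cochain (Fin (n + 1)) (Fin n) ρ ε.ker 1 :=
  (exists_cochain v t ht (extendZero j z)).choose

lemma cochainSeq_extendCochain (z : Fin n × Fin m → Seq) (α : Cell (Fin (n + 1)) (Fin n) 1) :
    cochainSeq v t (extendCochain v ρ ht j z) α = extendZero j z α :=
  (exists_cochain v t ht (extendZero j z)).choose_spec α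

include ht in
/-- Cochains on edges may be compared on the `j`-th edge and the others. -/
lemma cochain_one_ext {f g : Cochain (Fin (n + 1)) (Fin n) ρ ε.ker 1}
    (h0 : cochainSeq v t f (.edge j) = cochainSeq v t g (.edge j))
    (h : ∀ l, cochainSeq v t f (.edge (j.succAbove l)) = cochainSeq v t g (.edge (j.succAbove l))) :
    f = g := by
  refine cochain_ext v ht fun α => ?_
  cases α with
  | edge l =>
    rcases Fin.eq_self_or_eq_succAbove j l with rfl | ⟨l, rfl⟩
    · exact h0
    · exact h l

lemma eq_extendCochain {f : Cochain (Fin (n + 1)) (Fin n) ρ ε.ker 1}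
    (hf : cochainSeq v t f (.edge j) = 0) :
    f = extendCochain v ρ ht j fun a => cochainSeq v t f (.edge (j.succAbove a.1)) a.2 := by
  refine cochain_one_ext ht j (v := v) ?_ fun l => ?_
  · rw [hf, cochainSeq_extendCochain, extendZero_self]
  · rw [cochainSeq_extendCochain, extendZero_succAbove]

lemma extendCochain_add (z z' : Fin n × Fin m → Seq) :
    extendCochain v ρ ht j (z + z') = extendCochain v ρ ht j z + extendCochain v ρ ht j z' := by
  refine cochain_one_ext ht j (v := v) ?_ fun l => ?_
  · simp only [cochainSeq_add, cochainSeq_extendCochain, extendZero_self, add_zero]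
  · simp only [cochainSeq_add, cochainSeq_extendCochain, extendZero_succAbove]
    rfl

lemma extendCochain_smul (s : ℂ) (z : Fin n × Fin m → Seq) :
    extendCochain v ρ ht j (s • z) = s • extendCochain v ρ ht j z := by
  refine cochain_one_ext ht j (v := v) ?_ fun l => ?_
  · simp only [cochainSeq_smul, cochainSeq_extendCochain, extendZero_self, smul_zero]
  · simp only [cochainSeq_smul, cochainSeq_extendCochain, extendZero_succAbove]
    rfl

lemma extendCochain_zero : extendCochain v ρ ht j 0 = 0 := by
  have := extendCochain_smul (v := v) (ρ := ρ) ht j 0 0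
  rwa [zero_smul, zero_smul] at this

lemma extendCochain_injective : Function.Injective (extendCochain v ρ ht j) := by
  intro z z' h
  funext ⟨l, b⟩
  have h1 := cochainSeq_extendCochain (v := v) (ρ := ρ) ht j z (.edge (j.succAbove l))
  rw [h, cochainSeq_extendCochain, extendZero_succAbove, extendZero_succAbove] at h1
  exact (congrFun h1 b).symm

lemma aeval_deck_extendCochain (p : Polynomial ℂ) (z : Fin n × Fin m → Seq) :
    Polynomial.aeval (deckCochain ρ ε.ker t 1) p (extendCochain v ρ ht j z) =
      extendCochain v ρ ht j (Polynomial.toLaurent p • z) := by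
  refine cochain_one_ext ht j (v := v) ?_ fun l => ?_
  · simp only [cochainSeq_aeval_deck, cochainSeq_extendCochain, extendZero_self, smul_zero]
  · simp only [cochainSeq_aeval_deck, cochainSeq_extendCochain, extendZero_succAbove]
    rfl

lemma cochainSeq_coboundary_extendCochain (z : Fin n × Fin m → Seq) (i : Fin n) :
    cochainSeq v t (coboundary π r ρ ε.ker 1 (extendCochain v ρ ht j z)) (.face i) =
      fun a => matAct Seq (foxMatrix v ρ ε π r j) z (i, a) := by
  rw [cochainSeq_coboundary_face v ht, Fin.sum_univ_succAbove _ j, cochainSeq_extendCochain,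
    extendZero_self, map_zero, zero_add]
  funext a
  rw [Finset.sum_apply, matAct_apply, Fintype.sum_prod_type]
  refine Finset.sum_congr rfl fun l _ => ?_
  rw [cochainSeq_extendCochain, extendZero_succAbove, matAct_apply]
  rfl

lemma coboundary_extendCochain_eq_zero_iff (z : Fin n × Fin m → Seq) :
    coboundary π r ρ ε.ker 1 (extendCochain v ρ ht j z) = 0 ↔
      matAct Seq (foxMatrix v ρ ε π r j) z = 0 := by
  have hz : ∀ α, cochainSeq v t (0 : Cochain (Fin (n + 1)) (Fin n) ρ ε.ker 2) α = 0 := fun α => by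
    have := cochainSeq_smul (t := t) v (0 : ℂ) (0 : Cochain (Fin (n + 1)) (Fin n) ρ ε.ker 2) α
    rwa [zero_smul, zero_smul] at this
  constructor
  · intro h
    funext ⟨i, a⟩
    have h1 := cochainSeq_coboundary_extendCochain (π := π) (r := r) (v := v) (ρ := ρ) ht j z i
    rw [h, hz] at h1
    exact (congrFun h1 a).symm
  · intro h
    refine cochain_ext v ht fun α => ?_
    cases α with
    | face i =>
      rw [cochainSeq_coboundary_extendCochain, hz, h]
      rfl

/-- The coboundary of a vertex cochain vanishing on the `j`-th edge. -/
lemma coboundary_eq_extendCochain {f : Cochain (Fin (n + 1)) (Fin n) ρ ε.ker 0}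
    (hf : matAct Seq (edgeMatrix v ρ ε π j) (cochainSeq v t f .vertex) = 0) :
    coboundary π r ρ ε.ker 0 f = extendCochain v ρ ht j
      (matAct Seq (edgeRestMatrix v ρ ε π j) (cochainSeq v t f .vertex)) := by
  rw [eq_extendCochain (v := v) ht j (f := coboundary π r ρ ε.ker 0 f)
    (by rw [cochainSeq_coboundary_edge v ht, hf])]
  congr 1
  funext a
  rw [cochainSeq_coboundary_edge v ht, matAct_apply, matAct_apply]
  rfl

/-- Every cochain on edges vanishes on the `j`-th edge up to coboundaries. -/
lemma exists_sub_coboundary (hj : (edgeMatrix v ρ ε π j).det ≠ 0)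
    (f : Cochain (Fin (n + 1)) (Fin n) ρ ε.ker 1) :
    ∃ b z, f - coboundary π r ρ ε.ker 0 b = extendCochain v ρ ht j z := by
  obtain ⟨q, hq⟩ := Seq.isDivisible.matAct_surjective hj (cochainSeq v t f (.edge j))
  obtain ⟨b, hb⟩ := exists_cochain (ρ := ρ) (κ := Fin n) (ι := Fin (n + 1)) v t ht (i := 0)
    fun _ => q
  refine ⟨b, _, eq_extendCochain (v := v) ht j ?_⟩
  rw [cochainSeq_sub, cochainSeq_coboundary_edge v ht, hb, hq, sub_self]

include ht in
lemma exists_vertex_cochain (q : Fin m → Seq) :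
    ∃ b : Cochain (Fin (n + 1)) (Fin n) ρ ε.ker 0, cochainSeq v t b .vertex = q := by
  obtain ⟨b, hb⟩ := exists_cochain (ρ := ρ) (κ := Fin n) (ι := Fin (n + 1)) v t ht (i := 0)
    fun _ => q
  exact ⟨b, hb _⟩

include ht in
-- Since the second cohomology vanishes, every 2-cochain is df. Subtracting a coboundary makes f
-- zero on the j-th edge, and df is then given by the Fox matrix. So this matrix acts surjectively
-- on vectors over a divisible module.
theorem det_foxMatrix_ne_zero (hr : ∀ α, π (r α) = 1) (hj : (edgeMatrix v ρ ε π j).det ≠ 0)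
    [Subsingleton (Cohomology π r ρ ε.ker 2)] : (foxMatrix v ρ ε π r j).det ≠ 0 := by
  refine Seq.isDivisible.det_ne_zero fun y => ?_
  obtain ⟨g, hg⟩ := exists_cochain (ρ := ρ) (κ := Fin n) (ι := Fin (n + 1)) v t ht (i := 2)
    fun | .face i => fun a => y (i, a)
  have : Subsingleton (Cochain (Fin (n + 1)) (Fin n) ρ ε.ker 3) :=
    subsingleton_cochain (by norm_num)
  obtain ⟨f, hf⟩ := (cohClass_eq_zero_iff (π := π) (r := r) (f := g) (Subsingleton.elim _ _)).1
    (Subsingleton.elim _ _)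
  obtain ⟨b, z, hz⟩ := exists_sub_coboundary (π := π) (r := r) ht j hj f
  refine ⟨z, ?_⟩
  have h1 : coboundary π r ρ ε.ker 1 (extendCochain v ρ ht j z) = g := by
    rw [← hz, map_sub, coboundary_coboundary hr, sub_zero, hf]
  funext ⟨i, a⟩
  have h2 := cochainSeq_coboundary_extendCochain (π := π) (r := r) (v := v) (ρ := ρ) ht j z i
  rw [h1, hg] at h2
  exact (congrFun h2 a).symm

lemma toLaurent_X_sub_one_pow (k : ℕ) :
    Polynomial.toLaurent ((Polynomial.X - 1 : Polynomial ℂ) ^ k) = (T 1 - 1) ^ k := by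
  rw [map_pow, map_sub, map_one, Polynomial.toLaurent_X]

include ht in
/-- The generalized eigenspace of the covering transformation on the first cohomology is the
quotient of the local kernels of the matrices of the twisted Alexander polynomial. -/
theorem finrank_genKer_foxMatrix (hr : ∀ α, π (r α) = 1)
    (hj : (edgeMatrix v ρ ε π j).det ≠ 0) [Subsingleton (Cohomology π r ρ ε.ker 0)]
    [Module.Finite ℂ (genKer Seq (T 1 - 1) (foxMatrix v ρ ε π r j))] :
    Module.finrank ℂ (genKer Seq (T 1 - 1) (foxMatrix v ρ ε π r j)) =
      Module.finrank ℂ ((deck π r ρ ε.ker t 1).maxGenEigenspace 1) +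
        Module.finrank ℂ (genKer Seq (T 1 - 1) (edgeMatrix v ρ ε π j)) := by
  set A := foxMatrix v ρ ε π r j with hA
  set C₀ := edgeMatrix v ρ ε π j with hC₀
  set R := edgeRestMatrix v ρ ε π j with hR
  have hW : ∀ {z}, matAct Seq A z = 0 →
      coboundary π r ρ ε.ker 1 (extendCochain v ρ ht j z) = 0 := fun h =>
    (coboundary_extendCochain_eq_zero_iff ht j _).2 h
  let Φ : genKer Seq (T 1 - 1) A →ₗ[ℂ] Cohomology π r ρ ε.ker 1 :=
    { toFun := fun z => cohClass (extendCochain v ρ ht j z.1) (hW z.2.1)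
      map_add' := fun z z' => by
        rw [cohClass, cohClass, cohClass, ← Submodule.Quotient.mk_add]
        exact congrArg _ (Subtype.ext (extendCochain_add ht j z.1 z'.1))
      map_smul' := fun s z => by
        rw [cohClass, cohClass, RingHom.id_apply, ← Submodule.Quotient.mk_smul]
        exact congrArg _ (Subtype.ext (extendCochain_smul ht j s z.1)) }
  have hRA : ∀ q, matAct Seq C₀ q = 0 → matAct Seq A (matAct Seq R q) = 0 := by
    intro q hq
    obtain ⟨b, rfl⟩ := exists_vertex_cochain (ρ := ρ) (v := v) (n := n) ht q
    rw [← coboundary_extendCochain_eq_zero_iff ht j, ← coboundary_eq_extendCochain (r := r) ht j hq,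
      coboundary_coboundary hr]
  -- The kernel of C₀ consists of the vertex cochains whose coboundary vanishes on the j-th edge; R
  -- gives that coboundary on the other edges.
  let Ψ : genKer Seq (T 1 - 1) C₀ →ₗ[ℂ] genKer Seq (T 1 - 1) A :=
    ((matAct Seq R).restrict (p := genKer Seq (T 1 - 1) C₀) (q := genKer Seq (T 1 - 1) A) (by
      rintro q ⟨hq, k, hk⟩
      exact ⟨hRA q hq, k, by rw [← map_smul, hk, map_zero]⟩)).restrictScalars ℂ
  have hΨ : Function.Injective Ψ := by
    rw [injective_iff_map_eq_zero]
    rintro ⟨q, hq, k, hk⟩ h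
    have h0 : matAct Seq R q = 0 := congrArg Subtype.val h
    obtain ⟨b, rfl⟩ := exists_vertex_cochain (ρ := ρ) (v := v) (n := n) ht q
    have h1 := coboundary_eq_extendCochain (r := r) ht j hq
    rw [← hR, h0, extendCochain_zero] at h1
    have hb := coboundary_zero_injective h1
    refine Subtype.ext ?_
    change cochainSeq v t b .vertex = 0
    have := cochainSeq_smul (t := t) v (0 : ℂ) b .vertex
    rwa [zero_smul, zero_smul, ← hb] at this
  have hexact : Function.Exact Ψ Φ := by
    rintro ⟨z, hz, k, hk⟩
    constructor
    · intro h
      have h' : cohClass (π := π) (r := r) (extendCochain v ρ ht j z) (hW hz) = 0 := h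
      rw [cohClass_eq_zero_iff] at h'
      obtain ⟨b, hb⟩ := h'
      have hbC : matAct Seq C₀ (cochainSeq v t b .vertex) = 0 := by
        rw [← cochainSeq_coboundary_edge (π := π) (r := r) v ht, hb, cochainSeq_extendCochain,
          extendZero_self]
      -- A power of T - 1 killing db also kills b, because the coboundary is injective in degree 0.
      have hbk : (T 1 - 1 : ℂ[T;T⁻¹]) ^ k • cochainSeq v t b .vertex = 0 := by
        rw [← toLaurent_X_sub_one_pow, ← cochainSeq_aeval_deck]
        have h2 : Polynomial.aeval (deckCochain ρ ε.ker t 0)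
            ((Polynomial.X - 1 : Polynomial ℂ) ^ k) b = 0 := by
          apply coboundary_zero_injective (π := π) (r := r)
          rw [coboundary_aeval_deck, hb, aeval_deck_extendCochain, toLaurent_X_sub_one_pow, hk,
            extendCochain_zero]
        rw [h2]
        have := cochainSeq_smul (t := t) v (0 : ℂ) b .vertex
        rwa [zero_smul, zero_smul] at this
      refine ⟨⟨_, hbC, k, hbk⟩, Subtype.ext ?_⟩
      rw [coboundary_eq_extendCochain ht j hbC] at hb
      exact extendCochain_injective ht j hb
    · rintro ⟨⟨q, hq, hq'⟩, h⟩
      have h' : matAct Seq R q = z := congrArg Subtype.val h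
      change cohClass (π := π) (r := r) (extendCochain v ρ ht j z) (hW hz) = 0
      rw [cohClass_eq_zero_iff]
      obtain ⟨b, rfl⟩ := exists_vertex_cochain (ρ := ρ) (v := v) (n := n) ht q
      exact ⟨b, by rw [coboundary_eq_extendCochain ht j hq, ← h']⟩
  have hrange : LinearMap.range Φ = (deck π r ρ ε.ker t 1).maxGenEigenspace 1 := by
    apply le_antisymm
    · rintro _ ⟨⟨z, hz, k, hk⟩, rfl⟩
      rw [mem_maxGenEigenspace_one_iff]
      refine ⟨k, ?_⟩
      change Polynomial.aeval (deck π r ρ ε.ker t 1) _ (cohClass _ (hW hz)) = 0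
      rw [aeval_deck_cohClass, cohClass_eq_zero_iff]
      refine ⟨0, ?_⟩
      rw [map_zero, aeval_deck_extendCochain, toLaurent_X_sub_one_pow, hk, extendCochain_zero]
    · intro y hy
      rw [mem_maxGenEigenspace_one_iff] at hy
      obtain ⟨k, hy⟩ := hy
      obtain ⟨f, hf, rfl⟩ := exists_cohClass y
      obtain ⟨b, z, hz⟩ := exists_sub_coboundary (π := π) (r := r) ht j hj f
      have hzA : matAct Seq A z = 0 := by
        rw [← coboundary_extendCochain_eq_zero_iff ht j, ← hz, map_sub, hf,
          coboundary_coboundary hr, sub_zero]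
      have hyz : cohClass f hf = cohClass (π := π) (r := r) _ (hW hzA) := by
        rw [cohClass_eq_iff]
        exact ⟨b, by rw [← hz, sub_sub_cancel]⟩
      rw [hyz, aeval_deck_cohClass, cohClass_eq_zero_iff] at hy
      obtain ⟨g, hg⟩ := hy
      rw [aeval_deck_extendCochain, toLaurent_X_sub_one_pow] at hg
      set q := cochainSeq v t g .vertex with hq
      have hqC : matAct Seq C₀ q = 0 := by
        rw [hq, ← cochainSeq_coboundary_edge (π := π) (r := r) v ht, hg, cochainSeq_extendCochain,
          extendZero_self]
      have hqz : matAct Seq R q = (T 1 - 1 : ℂ[T;T⁻¹]) ^ k • z := by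
        rw [coboundary_eq_extendCochain ht j hqC] at hg
        exact extendCochain_injective ht j hg
      -- So far (T - 1)^k z is only known to be a coboundary Rq, with C₀q = 0. As det C₀ = (T - 1)^a
      -- c kills q, (T - 1)^{k+a} c z = 0. From uc + w(T - 1)^{k+a} = 1 one gets z = ucz + R(w(T -
      -- 1)^a q): the first term lies in the primary kernel of A, and the second is a coboundary.
      obtain ⟨a, c, hc, hdet⟩ := exists_eq_pow_mul hj
      obtain ⟨u, w, huw⟩ := (isCoprime_of_eval_ne_zero evalOne evalOne_eq_zero_iff hc).pow_right
        (n := k + a)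
      have hcz : (T 1 - 1 : ℂ[T;T⁻¹]) ^ (k + a) • c • z = 0 := by
        have h1 : (T 1 - 1 : ℂ[T;T⁻¹]) ^ (k + a) • c • z =
            matAct Seq R (((T 1 - 1 : ℂ[T;T⁻¹]) ^ a * c) • q) := by
          rw [map_smul, hqz, ← mul_smul, ← mul_smul]
          congr 1
          ring
        rw [h1, ← hdet, det_smul_eq_zero _ hqC, map_zero]
      have hzsplit : z - u • c • z = matAct Seq R ((w * (T 1 - 1) ^ a) • q) := by
        rw [map_smul, hqz, ← mul_smul, ← mul_smul, sub_eq_iff_eq_add, ← add_smul]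
        conv_lhs => rw [← one_smul ℂ[T;T⁻¹] z, ← huw]
        congr 1
        ring
      have hgen : u • c • z ∈ genKer Seq (T 1 - 1) A :=
        ⟨by rw [map_smul, map_smul, hzA, smul_zero, smul_zero], k + a, by
          rw [smul_comm, hcz, smul_zero]⟩
      refine ⟨⟨_, hgen⟩, ?_⟩
      rw [hyz]
      change cohClass _ (hW hgen.1) = _
      rw [cohClass_eq_iff]
      obtain ⟨b', hb'⟩ := exists_vertex_cochain (ρ := ρ) (v := v) (n := n) ht
        ((w * (T 1 - 1) ^ a) • q)
      have hb'C : matAct Seq C₀ (cochainSeq v t b' .vertex) = 0 := by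
        rw [hb', map_smul, hqC, smul_zero]
      refine ⟨-b', ?_⟩
      rw [map_neg, coboundary_eq_extendCochain ht j hb'C, hb', ← hzsplit, neg_eq_iff_eq_neg,
        neg_sub, eq_sub_iff_add_eq, ← extendCochain_add, sub_add_cancel]
  have h1 := LinearMap.finrank_range_add_finrank_ker Φ
  rw [hrange, hexact.linearMap_ker_eq, LinearMap.finrank_range_of_inj hΨ] at h1
  exact h1.symm

include ht in
-- The orders of the two determinants at 1 are the dimensions of the primary kernels of A and C, and
-- the exact sequence evaluates their difference.
theorem ordOne_twistedAlexander (hr : ∀ α, π (r α) = 1) (hj : (edgeMatrix v ρ ε π j).det ≠ 0)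
    [Subsingleton (Cohomology π r ρ ε.ker 0)] [Subsingleton (Cohomology π r ρ ε.ker 2)] :
    ordOne (twistedAlexander π r v ρ ε j) =
      Module.finrank ℂ ((deck π r ρ ε.ker t 1).maxGenEigenspace 1) := by
  obtain ⟨k, c, hc, hA⟩ := exists_eq_pow_mul (det_foxMatrix_ne_zero (r := r) ht j hr hj)
  obtain ⟨l, d, hd, hC⟩ := exists_eq_pow_mul hj
  obtain ⟨h1, h2⟩ := Seq.finrank_genKer hc hA
  obtain ⟨h3, h4⟩ := Seq.finrank_genKer hd hC
  have h5 := finrank_genKer_foxMatrix (r := r) ht j hr hj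
  rw [twistedAlexander_eq, ordOne_toRat_div hc hd hA hC]
  omega

/-- The order of the Alexander invariant when only the first cohomology survives. -/
theorem ordOne_alexanderInvariant (t : Γ)
    [Subsingleton (Cohomology π r ρ ε.ker 0)] [Subsingleton (Cohomology π r ρ ε.ker 2)]
    [Module.Finite ℂ (Cohomology π r ρ ε.ker 1)] :
    ordOne (alexanderInvariant π r ρ ε t) =
      -Module.finrank ℂ ((deck π r ρ ε.ker t 1).maxGenEigenspace 1) := by
  have h1 : detPoly (deck π r ρ ε.ker t 1) = (deck π r ρ ε.ker t 1).charpoly :=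
    dif_pos (inferInstanceAs (Module.Finite ℂ (Cohomology π r ρ ε.ker 1)))
  rw [alexanderInvariant, detPoly_of_subsingleton (deck π r ρ ε.ker t 0),
    detPoly_of_subsingleton (deck π r ρ ε.ker t 2), h1, map_one, mul_one]
  have := ordOne_div (p := 1) one_ne_zero (LinearMap.charpoly_monic (deck π r ρ ε.ker t 1)).ne_zero
  rw [map_one] at this
  rw [this, LinearMap.finrank_maxGenEigenspace_eq]
  simp

end Alexander

/-! ### Determinant identities for the torsion -/

section Matrices

/-- Two ways of making a matrix square by indexing rows and columns differ by a permutation, thus by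
a sign. Norms make all the orderings in the torsion irrelevant. -/
lemma norm_det_submatrix {A B k k' : Type*} [Fintype k] [DecidableEq k] [Fintype k']
    [DecidableEq k'] (M : Matrix A B ℂ) (e : k ≃ A) (f : k ≃ B) (e' : k' ≃ A) (f' : k' ≃ B) :
    ‖(M.submatrix e f).det‖ = ‖(M.submatrix e' f').det‖ := by
  let τ : Equiv.Perm k := e.trans (e'.symm.trans (f'.trans f.symm))
  have h : M.submatrix e f =
      ((M.submatrix e' f').submatrix (f.trans f'.symm) (f.trans f'.symm)).submatrix τ id := by
    ext a b
    simp [τ]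
  rw [h, Matrix.det_permute, Matrix.det_submatrix_equiv_self, norm_mul]
  rcases Int.units_eq_one_or (Equiv.Perm.sign τ) with h | h <;> simp [h]

variable {Γ : Type*} [Group Γ] {n m : ℕ}
variable {V : Type*} [NormedAddCommGroup V] [InnerProductSpace ℂ V]
variable (v : OrthonormalBasis (Fin m) ℂ V) (ρ : Representation ℂ Γ V) (ε : Γ →* Multiplicative ℤ)
variable (π : FreeGroup (Fin (n + 1)) →* Γ) (r : Fin n → FreeGroup (Fin (n + 1)))

/-- The Laurent matrix of the coboundary in degree `0`. -/
def vertexCoboundary : Matrix (Fin (n + 1) × Fin m) (Fin m) ℂ[T;T⁻¹] :=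
  Matrix.of fun a b => edgeMatrix v ρ ε π a.1 a.2 b

/-- The Laurent matrix of the coboundary in degree `1`. -/
def edgeCoboundary : Matrix (Fin n × Fin m) (Fin (n + 1) × Fin m) ℂ[T;T⁻¹] :=
  Matrix.of fun a b => laurentRep v ρ ε (MonoidAlgebra.mapDomain π (fox b.1 (r a.1))) a.2 b.2

variable {r π} in
lemma edgeCoboundary_mul_vertexCoboundary (hr : ∀ α, π (r α) = 1) :
    edgeCoboundary v ρ ε π r * vertexCoboundary v ρ ε π = 0 := by
  refine Matrix.ext fun ⟨i, a⟩ b => ?_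
  rw [Matrix.mul_apply, Fintype.sum_prod_type]
  have h := congrArg (laurentRep v ρ ε) (sum_mapDomain_fox_mul π (r i))
  rw [hr, map_one, sub_self, map_zero, map_sum] at h
  have h1 := congrFun (congrFun h a) b
  rw [Matrix.sum_apply] at h1
  refine Eq.trans (Finset.sum_congr rfl fun l _ => ?_) h1
  rw [map_mul, Matrix.mul_apply]
  rfl

/-- The edges but the `j`-th, followed by the `j`-th. -/
def succAboveEquiv (m : ℕ) (j : Fin (n + 1)) : (Fin n × Fin m) ⊕ Fin m ≃ Fin (n + 1) × Fin m :=
  ((Equiv.sumCongr (Equiv.refl _) (Equiv.punitProd.{0} (Fin m)).symm).trans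
    (Equiv.sumProdDistrib (Fin n) PUnit (Fin m)).symm).trans
    (Equiv.prodCongr ((Equiv.optionEquivSumPUnit (Fin n)).symm.trans (finSuccEquiv' j).symm)
      (Equiv.refl _))

lemma succAboveEquiv_inl (j : Fin (n + 1)) (a : Fin n × Fin m) :
    succAboveEquiv m j (Sum.inl a) = (j.succAbove a.1, a.2) := by
  simp [succAboveEquiv]

lemma succAboveEquiv_inr (j : Fin (n + 1)) (a : Fin m) :
    succAboveEquiv m j (Sum.inr a) = (j, a) := by
  simp [succAboveEquiv]

variable {r π} in
/-- The determinant identity behind the independence of torsions of choices. -/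
lemma det_foxMatrix_mul (hr : ∀ α, π (r α) = 1) (j : Fin (n + 1))
    (X : Matrix (Fin m) (Fin m) ℂ[T;T⁻¹])
    (Y : Matrix (Fin (n + 1) × Fin m) (Fin n × Fin m) ℂ[T;T⁻¹]) :
    (foxMatrix v ρ ε π r j).det *
      ((Matrix.fromCols Y (vertexCoboundary v ρ ε π * X)).submatrix (succAboveEquiv m j) id).det =
    (edgeCoboundary v ρ ε π r * Y).det * ((edgeMatrix v ρ ε π j).det * X.det) := by
  -- P selects the coordinates on the j-th edge. Stacked under the edge coboundary, with the j-th
  -- edge ordered last, it gives a block triangular matrix with diagonal blocks A and 1.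
  let P : Matrix (Fin m) (Fin (n + 1) × Fin m) ℂ[T;T⁻¹] :=
    (1 : Matrix (Fin (n + 1) × Fin m) (Fin (n + 1) × Fin m) ℂ[T;T⁻¹]).submatrix
      (fun a => (j, a)) id
  have hP : ∀ {b : Type} (B : Matrix (Fin (n + 1) × Fin m) b ℂ[T;T⁻¹]),
      P * B = B.submatrix (fun a => (j, a)) id := by
    intro b B
    ext a c
    simp [P, Matrix.mul_apply, Matrix.one_apply]
  have h1 : (Matrix.fromRows (edgeCoboundary v ρ ε π r) P).submatrix id (succAboveEquiv m j) =
      Matrix.fromBlocks (foxMatrix v ρ ε π r j)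
        ((edgeCoboundary v ρ ε π r).submatrix id fun a => (j, a)) 0 1 := by
    ext (a | a) (b | b)
    · rw [Matrix.submatrix_apply, succAboveEquiv_inl]; rfl
    · rw [Matrix.submatrix_apply, succAboveEquiv_inr]; rfl
    · rw [Matrix.submatrix_apply, succAboveEquiv_inl]
      simp [P, (Fin.succAbove_ne j b.1).symm]
    · rw [Matrix.submatrix_apply, succAboveEquiv_inr]
      simp [P, Matrix.one_apply]
  have h2 : (foxMatrix v ρ ε π r j).det =
      ((Matrix.fromRows (edgeCoboundary v ρ ε π r) P).submatrix id (succAboveEquiv m j)).det := by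
    rw [h1, Matrix.det_fromBlocks_zero₂₁, Matrix.det_one, mul_one]
  have h3 : P * (vertexCoboundary v ρ ε π * X) = edgeMatrix v ρ ε π j * X := by
    rw [← Matrix.mul_assoc, hP]
    rfl
  -- With D₁, D₀ the coboundary matrices and C the matrix of the j-th edge, the product has upper
  -- blocks D₁Y and D₁D₀X = 0, and lower right block PD₀X = CX.
  rw [h2, ← Matrix.det_mul, Matrix.submatrix_mul_equiv, Matrix.fromRows_mul_fromCols,
    Matrix.submatrix_id_id, ← Matrix.mul_assoc, edgeCoboundary_mul_vertexCoboundary v ρ ε hr,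
    Matrix.zero_mul, Matrix.det_fromBlocks_zero₁₂, h3, Matrix.det_mul]

variable {r π ε} in
-- The matrix of the j-th edge may be singular at T = 1, so its determinant cannot serve as
-- denominator. The determinant identity, with X and Y taken as constant Laurent matrices, replaces
-- it by one that does not vanish at 1.
lemma eval_twistedAlexander (hr : ∀ α, π (r α) = 1) (j : Fin (n + 1))
    (hj : (edgeMatrix v ρ ε π j).det ≠ 0)
    (X : Matrix (Fin m) (Fin m) ℂ) (Y : Matrix (Fin (n + 1) × Fin m) (Fin n × Fin m) ℂ)
    (hM : ((Matrix.fromCols Y ((vertexCoboundary v ρ ε π).map evalOne * X)).submatrix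
      (succAboveEquiv m j) id).det ≠ 0) :
    (twistedAlexander π r v ρ ε j).eval (RingHom.id ℂ) 1 =
      ((edgeCoboundary v ρ ε π r).map evalOne * Y).det * X.det /
      ((Matrix.fromCols Y ((vertexCoboundary v ρ ε π).map evalOne * X)).submatrix
        (succAboveEquiv m j) id).det := by
  have hC : ∀ {a b : Type} (B : Matrix a b ℂ), (B.map C).map evalOne = B := by
    intro a b B
    ext i k
    rw [Matrix.map_apply, Matrix.map_apply, C_eq_algebraMap, AlgHom.commutes]
    rfl
  have key := det_foxMatrix_mul v ρ ε hr j (X.map C) (Y.map C)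
  set M := (Matrix.fromCols (Y.map C) (vertexCoboundary v ρ ε π * X.map C)).submatrix
    (succAboveEquiv m j) id with hMdef
  have hM1 : evalOne M.det = ((Matrix.fromCols Y ((vertexCoboundary v ρ ε π).map evalOne * X)).submatrix
      (succAboveEquiv m j) id).det := by
    rw [AlgHom.map_det]
    congr 1
    have h4 : (vertexCoboundary v ρ ε π * X.map C).map evalOne =
        (vertexCoboundary v ρ ε π).map evalOne * X := by
      conv_rhs => rw [← hC X]
      exact Matrix.map_mul
    rw [← h4]
    conv_rhs => rw [← hC Y]
    ext a (b | b) <;> rfl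
  have hN : evalOne ((edgeCoboundary v ρ ε π r * Y.map C).det * (X.map C).det) =
      ((edgeCoboundary v ρ ε π r).map evalOne * Y).det * X.det := by
    rw [map_mul, AlgHom.map_det, AlgHom.map_det]
    congr 2
    · conv_rhs => rw [← hC Y]
      exact Matrix.map_mul
    · exact hC X
  rw [← hM1] at hM ⊢
  rw [← hN, ← eval_toRat_div hM, twistedAlexander_eq]
  congr 1
  have hM0 : toRat M.det ≠ 0 := by
    rw [Ne, map_eq_zero_iff _ toRat_injective]
    intro h
    rw [h, map_zero] at hM
    exact hM rfl
  have hj0 : toRat (edgeMatrix v ρ ε π j).det ≠ 0 := by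
    rwa [Ne, map_eq_zero_iff _ toRat_injective]
  rw [div_eq_div_iff hj0 hM0, ← map_mul, ← map_mul, key]
  congr 1
  ring

end Matrices

/-! ### The torsion in coordinates -/

section Torsion

variable {Γ : Type*} [Group Γ] {ι κ : Type}
variable {V : Type*} [NormedAddCommGroup V] [InnerProductSpace ℂ V] {m : ℕ}
variable (v : OrthonormalBasis (Fin m) ℂ V) (ρ : Representation ℂ Γ V)

lemma cochain_top_single {i : ℕ} (f : Cochain ι κ ρ (⊤ : Subgroup Γ) i) (α : Cell ι κ i)
    (x : MonoidAlgebra ℂ Γ) :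
    f.1 (Finsupp.single α x) = ρ.asAlgebraHom x (f.1 (Finsupp.single α 1)) := by
  induction x using MonoidAlgebra.induction_linear with
  | zero => rw [Finsupp.single_zero, map_zero, map_zero, LinearMap.zero_apply]
  | add x y hx hy => rw [Finsupp.single_add, map_add, map_add, LinearMap.add_apply, hx, hy]
  | single g s =>
    have h1 : (Finsupp.single α (MonoidAlgebra.single g s) : Cell ι κ i →₀ MonoidAlgebra ℂ Γ) =
        s • act g i (Finsupp.single α 1) := by
      simp [act]
    rw [h1, map_smul, f.2 g trivial, Representation.asAlgebraHom_single, LinearMap.smul_apply]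

lemma cochainBasis_repr {i : ℕ} [Fintype (Cell ι κ i)] (f : Cochain ι κ ρ (⊤ : Subgroup Γ) i)
    (α : Cell ι κ i) (a : Fin m) : (cochainBasis ι κ ρ v i).repr f ⟨α, a⟩ =
      v.toBasis.repr (f.1 (Finsupp.single α 1)) a := by
  rw [cochainBasis, Module.Basis.map_repr, LinearEquiv.trans_apply, LinearEquiv.symm_symm,
    Pi.basis_repr]
  rfl

variable (ι κ m) in
/-- The index set of the preferred basis in degree `0`. -/
def vertexIndexEquiv : ((_ : Cell ι κ 0) × Fin m) ≃ Fin m :=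
  (Equiv.sigmaEquivProd _ _).trans
    ((Equiv.prodCongr (vertexEquiv ι κ).symm (Equiv.refl _)).trans (Equiv.punitProd (Fin m)))

variable (ι κ m) in
/-- The index set of the preferred basis in degree `1`. -/
def edgeIndexEquiv : ((_ : Cell ι κ 1) × Fin m) ≃ ι × Fin m :=
  (Equiv.sigmaEquivProd _ _).trans (Equiv.prodCongr (edgeEquiv ι κ).symm (Equiv.refl _))

variable (ι κ m) in
/-- The index set of the preferred basis in degree `2`. -/
def faceIndexEquiv : ((_ : Cell ι κ 2) × Fin m) ≃ κ × Fin m :=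
  (Equiv.sigmaEquivProd _ _).trans (Equiv.prodCongr (faceEquiv ι κ).symm (Equiv.refl _))

end Torsion

section TorsionValue

variable {Γ : Type*} [Group Γ] {n m : ℕ}
variable {V : Type*} [NormedAddCommGroup V] [InnerProductSpace ℂ V]
variable {v : OrthonormalBasis (Fin m) ℂ V} {ρ : Representation ℂ Γ V} {ε : Γ →* Multiplicative ℤ}
variable {π : FreeGroup (Fin (n + 1)) →* Γ} {r : Fin n → FreeGroup (Fin (n + 1))}

/-- At T = 1 the character ε disappears and T^{ε(g)}ρ(g) becomes ρ(g), so the Laurent matrix of the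
coboundary specializes to its matrix for X in the preferred bases. -/
lemma repr_coboundary_zero (f : Cochain (Fin (n + 1)) (Fin n) ρ (⊤ : Subgroup Γ) 0)
    (l : Fin (n + 1)) (a : Fin m) :
    (cochainBasis _ _ ρ v 1).repr (coboundary π r ρ ⊤ 0 f) ⟨.edge l, a⟩ =
      ∑ b, (vertexCoboundary v ρ ε π).map evalOne (l, a) b *
        (cochainBasis _ _ ρ v 0).repr f ⟨.vertex, b⟩ := by
  rw [cochainBasis_repr]
  change v.toBasis.repr (f.1 (boundary π r 0 (Finsupp.single (.edge l) 1))) a = _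
  rw [boundary_single, one_smul, cellBoundary, cochain_top_single,
    ← LinearMap.toMatrix_mulVec_repr v.toBasis v.toBasis, ← evalOne_laurentRep v ρ ε]
  simp only [cochainBasis_repr]
  rfl

lemma repr_coboundary_one (f : Cochain (Fin (n + 1)) (Fin n) ρ (⊤ : Subgroup Γ) 1)
    (i : Fin n) (a : Fin m) :
    (cochainBasis _ _ ρ v 2).repr (coboundary π r ρ ⊤ 1 f) ⟨.face i, a⟩ =
      ∑ b : Fin (n + 1) × Fin m, (edgeCoboundary v ρ ε π r).map evalOne (i, a) b *
        (cochainBasis _ _ ρ v 1).repr f ⟨.edge b.1, b.2⟩ := by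
  rw [cochainBasis_repr]
  change v.toBasis.repr (f.1 (boundary π r 1 (Finsupp.single (.face i) 1))) a = _
  rw [boundary_single, one_smul, cellBoundary, map_sum, map_sum, Finsupp.finsetSum_apply,
    Fintype.sum_prod_type]
  refine Finset.sum_congr rfl fun l _ => ?_
  rw [cochain_top_single, ← LinearMap.toMatrix_mulVec_repr v.toBasis v.toBasis,
    ← evalOne_laurentRep v ρ ε]
  simp only [cochainBasis_repr]
  rfl

/-- The torsion of the twisted cochain complex is inverse to the value of the twisted Alexander
polynomial at `1`. -/
theorem norm_cochainTorsion (hr : ∀ α, π (r α) = 1) (j : Fin (n + 1))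
    (hj : (edgeMatrix v ρ ε π j).det ≠ 0) [Subsingleton (Cohomology π r ρ ⊤ 0)] {τ : ℂ}
    (hτ : IsCochainTorsion π r ρ v τ) :
    ‖τ‖ = 1 / ‖(twistedAlexander π r v ρ ε j).eval (RingHom.id ℂ) 1‖ := by
  obtain ⟨p, q, x, y, e₀, e₁, hx, hxs, hy, hys, hτ⟩ := hτ
  set c₀ := cochainBasis (Fin (n + 1)) (Fin n) ρ v 0 with hc₀
  set c₁ := cochainBasis (Fin (n + 1)) (Fin n) ρ v 1 with hc₁
  set c₂ := cochainBasis (Fin (n + 1)) (Fin n) ρ v 2 with hc₂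
  set dE := LinearMap.coprod (coboundary π r ρ (⊤ : Subgroup Γ) 0)
    (0 : Cochain (Fin (n + 1)) (Fin n) ρ (⊤ : Subgroup Γ) 2 →ₗ[ℂ] _) with hdE
  set dO := LinearMap.prod (0 : _ →ₗ[ℂ] Cochain (Fin (n + 1)) (Fin n) ρ (⊤ : Subgroup Γ) 0)
    (coboundary π r ρ (⊤ : Subgroup Γ) 1) with hdO
  have hdEx : ∀ z, dE z = coboundary π r ρ ⊤ 0 z.1 := fun z => by simp [hdE]
  have hinj : Function.Injective (coboundary π r ρ (⊤ : Subgroup Γ) 0) :=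
    (injective_iff_map_eq_zero _).2 fun _ h => coboundary_zero_injective h
  -- The vectors dE x form a basis of the image of C⁰, which has dimension m because the coboundary
  -- is injective there. Counting the even basis then gives q = nm.
  have hp : p = m := by
    have h1 := finrank_span_eq_card hx
    have h2 : LinearMap.range dE = LinearMap.range (coboundary π r ρ (⊤ : Subgroup Γ) 0) := by
      rw [hdE, LinearMap.range_coprod, LinearMap.range_zero, sup_bot_eq]
    rw [hxs, h2, LinearMap.finrank_range_of_inj hinj, Module.finrank_eq_card_basis c₀,
      Fintype.card_congr (vertexIndexEquiv (Fin (n + 1)) (Fin n) m)] at h1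
    simpa using h1.symm
  have hq : Fintype.card (Fin q) = Fintype.card (Fin n × Fin m) := by
    have h1 := Fintype.card_congr e₀
    rw [Fintype.card_sum, Fintype.card_sum,
      Fintype.card_congr (vertexIndexEquiv (Fin (n + 1)) (Fin n) m),
      Fintype.card_congr (faceIndexEquiv (Fin (n + 1)) (Fin n) m), Fintype.card_fin p, hp,
      Fintype.card_fin m] at h1
    omega
  subst hp
  let u : Fin q ≃ Fin n × Fin p := Fintype.equivOfCardEq hq
  let eE := edgeIndexEquiv (Fin (n + 1)) (Fin n) p
  let X : Matrix (Fin p) (Fin p) ℂ := Matrix.of fun a b => c₀.repr (x b).1 ⟨.vertex, a⟩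
  let Y : Matrix (Fin (n + 1) × Fin p) (Fin n × Fin p) ℂ :=
    Matrix.of fun a b => c₁.repr (y (u.symm b)) ⟨.edge a.1, a.2⟩
  let B : Matrix (Fin n × Fin p) (Fin p) ℂ := Matrix.of fun a b => c₂.repr (x b).2 ⟨.face a.1, a.2⟩
  let M := Matrix.fromCols Y ((vertexCoboundary v ρ ε π).map evalOne * X)
  -- The matrix of (x, dO y) is block triangular since dO y has no component in C⁰; the C²
  -- components B of x do not affect its determinant.
  let N := Matrix.fromBlocks X 0 B ((edgeCoboundary v ρ ε π r).map evalOne * Y)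
  have hM : c₁.toMatrix (Sum.elim y (dE ∘ x) ∘ e₁) =
      M.submatrix eE (e₁.trans (Equiv.sumCongr u (Equiv.refl _))) := by
    ext ⟨α, a⟩ b
    cases α with
    | edge l =>
      rw [Module.Basis.toMatrix_apply, Matrix.submatrix_apply, Function.comp_apply,
        Equiv.trans_apply]
      generalize e₁ b = b'
      rcases b' with b' | b'
      · change _ = c₁.repr (y (u.symm (u b'))) _
        rw [Equiv.symm_apply_apply]
        rfl
      · change c₁.repr (dE (x b')) _ = _
        rw [hdEx, repr_coboundary_zero (ε := ε)]
        rfl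
  have hN : (c₀.prod c₂).toMatrix (Sum.elim x (dO ∘ y) ∘ e₀) =
      N.submatrix (Equiv.sumCongr (vertexIndexEquiv (Fin (n + 1)) (Fin n) p)
        (faceIndexEquiv (Fin (n + 1)) (Fin n) p))
        (e₀.trans (Equiv.sumCongr (Equiv.refl _) u)) := by
    ext a b
    rw [Module.Basis.toMatrix_apply, Matrix.submatrix_apply, Function.comp_apply,
      Equiv.trans_apply]
    generalize e₀ b = b'
    rcases a with ⟨α, a⟩ | ⟨α, a⟩ <;> cases α <;> rcases b' with b' | b'
    · rw [Module.Basis.prod_repr_inl]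
      rfl
    · rw [Module.Basis.prod_repr_inl]
      change c₀.repr 0 _ = 0
      rw [map_zero]
      rfl
    · rw [Module.Basis.prod_repr_inr]
      rfl
    · rename_i i
      rw [Module.Basis.prod_repr_inr]
      change c₂.repr (coboundary π r ρ ⊤ 1 (y b')) _ = _
      rw [repr_coboundary_one (ε := ε)]
      change _ = ∑ c, _ * c₁.repr (y (u.symm (u b'))) _
      rw [Equiv.symm_apply_apply]
      rfl
  -- dO is injective on the span of y and kills the image of dE, so the two spans are disjoint. By
  -- its cardinality the family is then a basis of C¹, and the denominator required for the
  -- evaluation at 1 is nonzero.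
  have hind : LinearIndependent ℂ (Sum.elim y (dE ∘ x)) := by
    refine LinearIndependent.sum_type (LinearIndependent.of_comp dO hy) hx ?_
    rw [Submodule.disjoint_def]
    intro w hw hw'
    have h1 : dO w = 0 := by
      rw [hxs] at hw'
      obtain ⟨z, rfl⟩ := hw'
      rw [hdEx]
      simp [hdO, coboundary_coboundary hr]
    obtain ⟨c, rfl⟩ := (Submodule.mem_span_range_iff_exists_fun ℂ).1 hw
    rw [map_sum] at h1
    have h2 := Fintype.linearIndependent_iff.1 hy c (by simpa using h1)
    exact Finset.sum_eq_zero fun i _ => by rw [h2 i, zero_smul]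
  have hdet : c₁.det (Sum.elim y (dE ∘ x) ∘ e₁) ≠ 0 := by
    have h1 := hind.comp e₁ e₁.injective
    refine (c₁.is_basis_iff_det.1 ⟨h1, ?_⟩).ne_zero
    have := Module.Finite.of_basis c₁
    exact h1.span_eq_top_of_card_eq_finrank' (Module.finrank_eq_card_basis c₁).symm
  have hdetM : ‖c₁.det (Sum.elim y (dE ∘ x) ∘ e₁)‖ =
      ‖(M.submatrix (succAboveEquiv p j) id).det‖ := by
    rw [Module.Basis.det_apply, hM]
    exact norm_det_submatrix M _ _ _ (Equiv.refl _)
  have hdetN : ‖(c₀.prod c₂).det (Sum.elim x (dO ∘ y) ∘ e₀)‖ =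
      ‖((edgeCoboundary v ρ ε π r).map evalOne * Y).det * X.det‖ := by
    rw [Module.Basis.det_apply, hN]
    refine (norm_det_submatrix N _ _ (Equiv.refl _) (Equiv.refl _)).trans ?_
    rw [Equiv.coe_refl, Matrix.submatrix_id_id, Matrix.det_fromBlocks_zero₁₂, mul_comm]
  have hM0 : (M.submatrix (succAboveEquiv p j) id).det ≠ 0 := by
    rw [← norm_ne_zero_iff, ← hdetM, norm_ne_zero_iff]
    exact hdet
  have hnorm : ‖τ‖ = ‖c₁.det (Sum.elim y (dE ∘ x) ∘ e₁)‖ /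
      ‖(c₀.prod c₂).det (Sum.elim x (dO ∘ y) ∘ e₀)‖ := by
    rcases hτ with rfl | rfl
    · rw [norm_div]
    · rw [norm_neg, norm_div]
  rw [hnorm, eval_twistedAlexander v ρ hr j hj X Y hM0, norm_div, one_div_div, hdetM, hdetN]

/-- An acyclic twisted cochain complex has a torsion. -/
theorem exists_cochainTorsion [Subsingleton (Cohomology π r ρ ⊤ 0)]
    [Subsingleton (Cohomology π r ρ ⊤ 2)] : ∃ τ, IsCochainTorsion π r ρ v τ := by
  have hinj : Function.Injective (coboundary π r ρ (⊤ : Subgroup Γ) 0) :=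
    (injective_iff_map_eq_zero _).2 fun _ h => coboundary_zero_injective h
  have hsurj : Function.Surjective (coboundary π r ρ (⊤ : Subgroup Γ) 1) := by
    intro g
    have : Subsingleton (Cochain (Fin (n + 1)) (Fin n) ρ (⊤ : Subgroup Γ) 3) :=
      subsingleton_cochain (by norm_num)
    exact (cohClass_eq_zero_iff (π := π) (r := r) (f := g) (Subsingleton.elim _ _)).1
      (Subsingleton.elim _ _)
  let vE := vertexIndexEquiv (Fin (n + 1)) (Fin n) m
  let eE := edgeIndexEquiv (Fin (n + 1)) (Fin n) m
  let fE := (faceIndexEquiv (Fin (n + 1)) (Fin n) m).trans finProdFinEquiv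
  let c₀ := (cochainBasis (Fin (n + 1)) (Fin n) ρ v 0).reindex vE
  let c₂ := (cochainBasis (Fin (n + 1)) (Fin n) ρ v 2).reindex fE
  -- Take for x the preferred basis of C⁰, and for y preimages of the preferred basis of C².
  choose y hy using fun i => hsurj (c₂ i)
  have hx' : ⇑(LinearMap.coprod (coboundary π r ρ (⊤ : Subgroup Γ) 0)
      (0 : Cochain (Fin (n + 1)) (Fin n) ρ (⊤ : Subgroup Γ) 2 →ₗ[ℂ] _)) ∘ (fun i => (c₀ i, 0)) =
      coboundary π r ρ (⊤ : Subgroup Γ) 0 ∘ c₀ := by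
    ext1 i
    simp
  have hy' : ⇑(LinearMap.prod (0 : _ →ₗ[ℂ] Cochain (Fin (n + 1)) (Fin n) ρ (⊤ : Subgroup Γ) 0)
      (coboundary π r ρ (⊤ : Subgroup Γ) 1)) ∘ y = LinearMap.inr ℂ _ _ ∘ c₂ := by
    ext1 i
    simp [hy]
  refine ⟨_, m, n * m, fun i => (c₀ i, 0), y, Equiv.sumCongr vE fE,
    eE.trans ((succAboveEquiv m 0).symm.trans
      (Equiv.sumCongr finProdFinEquiv (Equiv.refl _))), ?_, ?_, ?_, ?_, Or.inl rfl⟩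
  · rw [hx']
    exact c₀.linearIndependent.map' _ (LinearMap.ker_eq_bot.2 hinj)
  · rw [hx', Set.range_comp, ← Submodule.map_span, c₀.span_eq, Submodule.map_top,
      LinearMap.range_coprod, LinearMap.range_zero, sup_bot_eq]
  · rw [hy']
    exact c₂.linearIndependent.map' _ (LinearMap.ker_eq_bot.2 LinearMap.inr_injective)
  · rw [hy', Set.range_comp, ← Submodule.map_span, c₂.span_eq, Submodule.map_top]
    apply le_antisymm
    · rintro _ ⟨z, rfl⟩
      obtain ⟨w, rfl⟩ := hsurj z
      exact ⟨w, rfl⟩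
    · rintro _ ⟨w, rfl⟩
      exact ⟨coboundary π r ρ ⊤ 1 w, rfl⟩

end TorsionValue

/-! ### Meridians and the Wirtinger presentation -/

/-- The generators of a Wirtinger presentation are conjugate. -/
lemma Diagram.map_of_eq {K : Set S3} (D : Diagram K) {A : Type*} [CommGroup A]
    (φ : FreeGroup (Fin (D.n + 1)) →* A) (hφ : ∀ i, φ (D.relator i) = 1) (j : Fin (D.n + 1)) :
    φ (FreeGroup.of j) = φ (FreeGroup.of 0) := by
  induction j using Fin.induction with
  | zero => rfl
  | succ i ih =>
    rw [← ih]
    have h := hφ i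
    rw [Diagram.relator, map_mul, map_inv, mul_inv_eq_one, map_mul, map_mul, map_inv,
      mul_inv_cancel_comm] at h
    exact h.symm

/-- A nontrivial homomorphism to an abelian group is nontrivial on each meridian. -/
lemma Diagram.map_of_ne_one {K : Set S3} (D : Diagram K) {Γ A : Type*} [Group Γ] [CommGroup A]
    {π : FreeGroup (Fin (D.n + 1)) →* Γ} (hπ : Function.Surjective π)
    (hr : ∀ i, π (D.relator i) = 1) (ε : Γ →* A) {t : Γ} (ht : ε t ≠ 1) (j : Fin (D.n + 1)) :
    ε (π (FreeGroup.of j)) ≠ 1 := by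
  intro h
  have hφ : ∀ i, ε.comp π (D.relator i) = 1 := fun i => by
    rw [MonoidHom.comp_apply, hr, map_one]
  have h1 : ε.comp π = 1 := FreeGroup.ext_hom _ _ fun l => by
    rw [D.map_of_eq _ hφ l, ← D.map_of_eq _ hφ j]
    exact h
  obtain ⟨w, rfl⟩ := hπ t
  exact ht (DFunLike.congr_fun h1 w)

lemma IsPresentation.map_eq_one {ι κ Γ : Type*} [Group Γ] {π : FreeGroup ι →* Γ}
    {r : κ → FreeGroup ι} (h : IsPresentation π r) (α : κ) : π (r α) = 1 := by
  rw [← MonoidHom.mem_ker, h.2]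
  exact Subgroup.subset_normalClosure ⟨α, rfl⟩

end KnotTorsion

end

/-! ### Proof of the theorem -/

open KnotTorsion in
theorem corollary4p1
    {K : Set S3} (D : Diagram K) (x₀ : (Kᶜ : Set S3))
    (π : FreeGroup (Fin (D.n + 1)) →* FundamentalGroup (Kᶜ : Set S3) x₀)
    (hπ : IsPresentation π D.relator)
    (ε : FundamentalGroup (Kᶜ : Set S3) x₀ →* Multiplicative ℤ) (hε : Function.Surjective ε)
    {V : Type*} [NormedAddCommGroup V] [InnerProductSpace ℂ V] {m : ℕ}
    (v : OrthonormalBasis (Fin m) ℂ V)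
    (ρ : Representation ℂ (FundamentalGroup (Kᶜ : Set S3) x₀) V)
    (hρ : ∀ g x y, inner ℂ (ρ g x) (ρ g y) = inner ℂ x y)
    (hfin : ∀ i, Module.Finite ℂ (Homology π D.relator ρ ε.ker i))
    (t : FundamentalGroup (Kᶜ : Set S3) x₀) (ht : ε t = Multiplicative.ofAdd 1)
    (j : Fin (D.n + 1)) :
    (∀ i, Module.Finite ℂ (Cohomology π D.relator ρ ε.ker i)) ∧
    twistedAlexander π D.relator v ρ ε j ≠ 0 ∧
    (Subsingleton (Cohomology π D.relator ρ ε.ker 0) →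
      ordOne (twistedAlexander π D.relator v ρ ε j) =
          -ordOne (alexanderInvariant π D.relator ρ ε t) ∧
      (Module.finrank ℂ (Cohomology π D.relator ρ ⊤ 1) : ℤ) ≤
          ordOne (twistedAlexander π D.relator v ρ ε j) ∧
      ((deck π D.relator ρ ε.ker t 1).IsSemisimple →
        ordOne (twistedAlexander π D.relator v ρ ε j) =
          (Module.finrank ℂ (Cohomology π D.relator ρ ⊤ 1) : ℤ))) ∧
    ((∀ i, Subsingleton (Cohomology π D.relator ρ ⊤ i)) →
      (∃ τ, IsCochainTorsion π D.relator ρ v τ) ∧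
      ∀ τ, IsCochainTorsion π D.relator ρ v τ →
        ‖τ‖ = 1 / ‖(twistedAlexander π D.relator v ρ ε j).eval (RingHom.id ℂ) 1‖) := by
  have hr : ∀ α, π (D.relator α) = 1 := hπ.map_eq_one
  have hcoh : ∀ i, Module.Finite ℂ (Cohomology π D.relator ρ ε.ker i) := fun i => by
    have := hfin i
    exact finite_cohomology v hρ π D.relator i
  have ht1 : ε t ≠ 1 := by
    rw [ht]
    exact fun h => one_ne_zero (ofAdd_eq_one.1 h)
  -- All meridians have the same image under ε, and ε is nontrivial; so every generator may be the
  -- one left out.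
  have hj : (edgeMatrix v ρ ε π j).det ≠ 0 :=
    det_laurentRep_of_sub_one_ne_zero v ρ ε hρ (D.map_of_ne_one hπ.1 hr ε ht1 j)
  have hc1 := hcoh 1
  have hc2 := hcoh 2
  have h2 : Subsingleton (Cohomology π D.relator ρ ε.ker 2) := subsingleton_cohomology_two v ht
  refine ⟨hcoh, ?_, fun h0 => ?_, fun hX => ?_⟩
  · rw [twistedAlexander_eq]
    exact div_ne_zero ((map_ne_zero_iff _ toRat_injective).2 (det_foxMatrix_ne_zero ht j hr hj))
      ((map_ne_zero_iff _ toRat_injective).2 hj)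
  · rw [ordOne_twistedAlexander ht j hr hj, ordOne_alexanderInvariant,
      finrank_cohomology_one_eq v ht hr, neg_neg]
    refine ⟨rfl, ?_, fun hs => ?_⟩
    -- After the rewriting, the inequality compares the eigenspace of τ^* for 1 with the generalized
    -- eigenspace; they coincide when τ^* is semisimple.
    · exact_mod_cast Submodule.finrank_mono
        (Module.End.genEigenspace_le_maximal (deck π D.relator ρ ε.ker t 1) 1 1)
    · rw [hs.isFinitelySemisimple.maxGenEigenspace_eq_eigenspace]
  · have h0 := hX 0
    have h2 := hX 2
    exact ⟨exists_cochainTorsion, fun τ hτ => norm_cochainTorsion hr j hj hτ⟩
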